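/- Let $M$ be a smooth four-manifold, $g$ a smooth Lorentzian metric of signature $(-,+,+,+)$ with volume form $\eta$, and $\xi$ a smooth Killing vector field, of arbitrary causal character, with $\xi^\alpha R_{\alpha\beta}=0$. Let $\lambda=-\xi^\alpha\xi_\alpha$, $F_{\alpha\beta}=\nabla_\alpha\xi_\beta$, let $\mathcal F=F+iF^\star$ be the Killing form, where $F^\star_{\alpha\beta}=\frac12\eta_{\alpha\beta\mu\nu}F^{\mu\nu}$, and let $\sigma_\mu=2\xi^\alpha\mathcal F_{\alpha\mu}$ be the Ernst one-form. Assume the following global conditions. 1. There is a smooth complex function $\sigma=\lambda-i\omega$ on $M$ with $\nabla_\mu\sigma=\sigma_\mu$. 2. For all real $(\gamma,\delta)\neq(0,0)$ there is a smooth one-form $W$ on $M$ with $$\nabla_\alpha W_\beta-\nabla_\beta W_\alpha=\mathrm{Re}\big[-4\gamma(\gamma\bar\sigma+i\delta)\mathcal F_{\alpha\beta}\big],\qquad \xi^\alpha W_\alpha+1=|i\gamma\sigma+\delta|^2. \tag{$*$}$$ Let $E$ be the group, under matrix multiplication, of the matrices $A=\begin{pmatrix}\alpha&i\beta\\ i\gamma&\delta\end{pmatrix}$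 with $\alpha,\beta,\gamma,\delta\in\mathbb R$ and $\alpha\delta+\beta\gamma=1$. Then: (a) Let $A\in E$, let $W$ be any smooth solution of $(*)$ for $(\gamma,\delta)$, let $\Omega^2=1+\xi^\alpha W_\alpha$, and let $M_A=\{p\in M: i\gamma\sigma(p)+\delta\neq0\}$ (one removes the points with $\lambda=0$ and $\gamma\omega+\delta=0$). On $M_A$ the tensor $$T_W(g)_{\alpha\beta}=\Omega^2g_{\alpha\beta}-\xi_\alpha W_\beta-\xi_\beta W_\alpha-\frac{\lambda}{\Omega^2}W_\alpha W_\beta$$ is a smooth Lorentzian metric with volume form $\Omega^2\eta$; $\xi$ is a Killing vector of it and is annihilated by its Ricci tensor. The Killing form and the Ernst one-form of $\xi$ with respect to $T_W(g)$ are $$\mathcal F'_{\alpha\beta}=\frac{1}{(\delta+i\gamma\sigma)^2}\Big[\Omega^2\mathcal F_{\alpha\beta}-\tfrac12(W_\alpha\sigma_\beta-W_\beta\sigma_\alpha)\Big],\qquad \sigma'_\alpha=\frac{\sigma_\alpha}{(i\gamma\sigma+\delta)^2},$$ and $\sigma'=\dfrac{\alpha\sigma+i\beta}{i\gamma\sigma+\delta}$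 satisfies $\nabla_\alpha\sigma'=\sigma'_\alpha$, with real part $-T_W(g)(\xi,\xi)$. (b) There is a family $(W_A)_{A\in E}$ of smooth one-forms on $M$ such that $W_A$ solves $(*)$ for the $(\gamma,\delta)$ of $A$ and $W_1=0$. Call such $(g,\eta,\sigma,(W_A)_{A\in E})$ an Ehlers system on $M$. Given one, define its transform by $A\in E$ to be, on $M_A$, $$\big(T_{W_A}(g),\ \Omega_A^2\,\eta,\ \sigma',\ (W'_B)_{B\in E}\big),\qquad \Omega_A^2=1+\xi^\alpha(W_A)_\alpha,\qquad W'_B=W_{BA}-|i\gamma_B\sigma'+\delta_B|^2\,W_A .$$ That is, $W'=W''-\Omega'^2W$ with $W=W_A$, $W''=W_{BA}$, $W'=W'_B$, $\Omega'^2=|i\gamma_B\sigma'+\delta_B|^2$. The transform is again an Ehlers system on $M_A$; in particular, $W'_B$ is a globally defined solution of $(*)$ for $B$ on the transformed spacetime. (c) For every Ehlers system, the transformation by the identity is the identity, and the transformation by $A$ followed by the transformation by $B$ is defined exactly on $M_A\cap M_{BA}$ and coincides there with the transformation by $BA$. (d) If $M$ is connected and $\sigma$ is not constant, the family in (b) can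 be chosen so that the transforms of the resulting Ehlers system by distinct elements of $E$ are distinct. (e) The map $A\mapsto\begin{pmatrix}\alpha&\beta\\-\gamma&\delta\end{pmatrix}$ is a group isomorphism from $E$ onto $SL(2,\mathbb R)$. Thus the transformations form, up to the removal of the points above, a group isomorphic to $SL(2,\mathbb R)$, whatever the causal character of $\xi$. -/

import Mathlib

open scoped Manifold ContDiff MatrixGroups
open Matrix

noncomputable section

namespace Ehlers

/-! ## Tensor calculus in a local coordinate system

All objects here are given by their components, as functions on (an open subset of) `ℝ⁴`. -/

/-- The coordinate space `ℝ⁴`. -/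
abbrev E4 : Type := EuclideanSpace ℝ (Fin 4)

/-- The `i`-th partial derivative `∂ᵢ f` at `x`. -/
def pd {V : Type*} [NormedAddCommGroup V] [NormedSpace ℝ V] (i : Fin 4) (f : E4 → V) (x : E4) : V :=
  fderiv ℝ f x (EuclideanSpace.single i 1)

/-- Christoffel symbols
`Γᵏᵢⱼ = ½ gᵏˡ (∂ᵢ gⱼₗ + ∂ⱼ gᵢₗ - ∂ₗ gᵢⱼ)` of the metric components `G`. -/
def christoffel (G : E4 → Matrix (Fin 4) (Fin 4) ℝ) (x : E4) (k i j : Fin 4) : ℝ :=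
  (1 / 2 : ℝ) * ∑ l, (G x)⁻¹ k l *
    (pd i (fun y => G y j l) x + pd j (fun y => G y i l) x - pd l (fun y => G y i j) x)

/-- Ricci tensor `Rᵢⱼ = ∂ₖ Γᵏᵢⱼ - ∂ⱼ Γᵏᵢₖ + Γᵏₖₗ Γˡᵢⱼ - Γᵏⱼₗ Γˡᵢₖ`. -/
def ricci (G : E4 → Matrix (Fin 4) (Fin 4) ℝ) (x : E4) (i j : Fin 4) : ℝ :=
  ∑ k, (pd k (fun y => christoffel G y k i j) x - pd j (fun y => christoffel G y k i k) x
    + ∑ l, (christoffel G x k k l * christoffel G x l i j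
      - christoffel G x k j l * christoffel G x l i k))

/-- Components of the Lie derivative of the metric:
`(£_X g)ᵢⱼ = Xᵏ ∂ₖ gᵢⱼ + gₖⱼ ∂ᵢ Xᵏ + gᵢₖ ∂ⱼ Xᵏ`. -/
def lieMetric (G : E4 → Matrix (Fin 4) (Fin 4) ℝ) (X : E4 → Fin 4 → ℝ) (x : E4)
    (i j : Fin 4) : ℝ :=
  ∑ k, (X x k * pd k (fun y => G y i j) x + G x k j * pd i (fun y => X y k) x
    + G x i k * pd j (fun y => X y k) x)

/-- Lowering the index, `Xᵢ = gᵢⱼ Xʲ`. -/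
def lower (G : E4 → Matrix (Fin 4) (Fin 4) ℝ) (X : E4 → Fin 4 → ℝ) (x : E4) (i : Fin 4) : ℝ :=
  ∑ j, G x i j * X x j

/-- `Fᵢⱼ = ∇ᵢ Xⱼ = ∂ᵢ Xⱼ - Γᵏᵢⱼ Xₖ`. -/
def nablaLower (G : E4 → Matrix (Fin 4) (Fin 4) ℝ) (X : E4 → Fin 4 → ℝ) (x : E4)
    (i j : Fin 4) : ℝ :=
  pd i (fun y => lower G X y j) x - ∑ k, christoffel G x k i j * lower G X x k

/-- Hodge dual of a two-form, `F⋆ᵢⱼ = ½ ηᵢⱼₖₗ Fᵏˡ`, where `η` is the volume form. -/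
def hodge (G : E4 → Matrix (Fin 4) (Fin 4) ℝ) (η : E4 → Fin 4 → Fin 4 → Fin 4 → Fin 4 → ℝ)
    (F : Fin 4 → Fin 4 → ℝ) (x : E4) (i j : Fin 4) : ℝ :=
  (1 / 2 : ℝ) * ∑ k, ∑ l, ∑ m, ∑ n, η x i j k l * (G x)⁻¹ k m * (G x)⁻¹ l n * F m n

/-- Components `𝓕ᵢⱼ = Fᵢⱼ + i F⋆ᵢⱼ`, `F = ∇X`, of the (self-dual) Killing form of `X`. -/
def killingFormCoord (G : E4 → Matrix (Fin 4) (Fin 4) ℝ)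
    (η : E4 → Fin 4 → Fin 4 → Fin 4 → Fin 4 → ℝ) (X : E4 → Fin 4 → ℝ) (x : E4)
    (i j : Fin 4) : ℂ :=
  (nablaLower G X x i j : ℂ) + Complex.I * (hodge G η (nablaLower G X x) x i j : ℂ)

/-- Components `σⱼ = 2 Xⁱ 𝓕ᵢⱼ` of the Ernst one-form of `X`. -/
def ernstFormCoord (G : E4 → Matrix (Fin 4) (Fin 4) ℝ)
    (η : E4 → Fin 4 → Fin 4 → Fin 4 → Fin 4 → ℝ) (X : E4 → Fin 4 → ℝ) (x : E4)
    (j : Fin 4) : ℂ :=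
  2 * ∑ i, (X x i : ℂ) * killingFormCoord G η X x i j

/-! ## Tensor fields on a four-manifold and their components -/

section Fields

variable (M : Type*) [TopologicalSpace M] [ChartedSpace E4 M]

/-- Vector fields (not necessarily smooth). -/
abbrev VField := (p : M) → TangentSpace (𝓡 4) p

/-- One-form fields (not necessarily smooth). -/
abbrev OneForm := (p : M) → (TangentSpace (𝓡 4) p →ₗ[ℝ] ℝ)

/-- Two-covariant tensor fields (not necessarily smooth or symmetric). -/
abbrev BilinField := (p : M) → (TangentSpace (𝓡 4) p →ₗ[ℝ] TangentSpace (𝓡 4) p →ₗ[ℝ] ℝ)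

/-- Four-form fields (not necessarily smooth). -/
abbrev FourForm := (p : M) → (TangentSpace (𝓡 4) p) [⋀^Fin 4]→ₗ[ℝ] ℝ

end Fields

section Components

variable {M : Type*} [TopologicalSpace M] [ChartedSpace E4 M]

/-- `φ` is a local coordinate system of the smooth manifold `M`. -/
def IsChart (φ : OpenPartialHomeomorph M E4) : Prop :=
  φ ∈ IsManifold.maximalAtlas (𝓡 4) ∞ M

/-- The coordinates, with respect to `φ`, of the points of `U` in the domain of `φ`. -/
def coordSet (φ : OpenPartialHomeomorph M E4) (U : Set M) : Set E4 :=
  φ.target ∩ φ.symm ⁻¹' U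

/-- The coordinate vector `∂ᵢ` of `φ` at the point with coordinates `x`. -/
def coordVec (φ : OpenPartialHomeomorph M E4) (x : E4) (i : Fin 4) :
    TangentSpace (𝓡 4) (φ.symm x) :=
  mfderiv (𝓡 4) (𝓡 4) φ.symm x
    (show TangentSpace (𝓡 4) x from (EuclideanSpace.single i (1 : ℝ) : E4))

/-- Components `Xⁱ = dφⁱ(X)` of a vector field. -/
def vecComp (φ : OpenPartialHomeomorph M E4) (X : VField M) (x : E4) (i : Fin 4) : ℝ :=
  (show E4 from mfderiv (𝓡 4) (𝓡 4) φ (φ.symm x) (X (φ.symm x))) i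

/-- Components `Wᵢ = W(∂ᵢ)` of a one-form. -/
def oneComp (φ : OpenPartialHomeomorph M E4) (W : OneForm M) (x : E4) (i : Fin 4) : ℝ :=
  W (φ.symm x) (coordVec φ x i)

/-- Components `gᵢⱼ = g(∂ᵢ, ∂ⱼ)` of a two-covariant tensor. -/
def bilinComp (φ : OpenPartialHomeomorph M E4) (g : BilinField M) (x : E4) :
    Matrix (Fin 4) (Fin 4) ℝ :=
  Matrix.of fun i j => g (φ.symm x) (coordVec φ x i) (coordVec φ x j)

/-- Components `ηᵢⱼₖₗ = η(∂ᵢ, ∂ⱼ, ∂ₖ, ∂ₗ)` of a four-form. -/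
def fourComp (φ : OpenPartialHomeomorph M E4) (η : FourForm M) (x : E4) (i j k l : Fin 4) : ℝ :=
  η (φ.symm x) ![coordVec φ x i, coordVec φ x j, coordVec φ x k, coordVec φ x l]

/-- Smoothness of a vector field on an open set: smoothness of all its components
in all local coordinate systems. -/
def SmoothVec (X : VField M) (U : Set M) : Prop :=
  ∀ φ : OpenPartialHomeomorph M E4, IsChart φ →
    ∀ i, ContDiffOn ℝ ∞ (fun x => vecComp φ X x i) (coordSet φ U)

/-- Smoothness of one-forms, in the same sense. -/
def SmoothOne (W : OneForm M) (U : Set M) : Prop :=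
  ∀ φ : OpenPartialHomeomorph M E4, IsChart φ →
    ∀ i, ContDiffOn ℝ ∞ (fun x => oneComp φ W x i) (coordSet φ U)

/-- Smoothness of two-covariant tensors, in the same sense. -/
def SmoothBilin (g : BilinField M) (U : Set M) : Prop :=
  ∀ φ : OpenPartialHomeomorph M E4, IsChart φ →
    ∀ i j, ContDiffOn ℝ ∞ (fun x => bilinComp φ g x i j) (coordSet φ U)

/-- Smoothness of four-forms, in the same sense. -/
def SmoothFour (η : FourForm M) (U : Set M) : Prop :=
  ∀ φ : OpenPartialHomeomorph M E4, IsChart φ →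
    ∀ i j k l, ContDiffOn ℝ ∞ (fun x => fourComp φ η x i j k l) (coordSet φ U)

/-- `g` is, at the point `p`, a symmetric bilinear form of signature `(-1,1,1,1)`. -/
def IsLorentzAt (g : BilinField M) (p : M) : Prop :=
  (∀ v w, g p v w = g p w v) ∧
  ∃ b : Module.Basis (Fin 4) ℝ (TangentSpace (𝓡 4) p),
    ∀ i j, g p (b i) (b j) = Matrix.diagonal ![(-1 : ℝ), 1, 1, 1] i j

/-- `η` is, at the point `p`, one of the two metric volume forms of `g`
(so `η = ±1` on orthonormal bases). -/
def IsVolumeAt (g : BilinField M) (η : FourForm M) (p : M) : Prop :=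
  ∀ v : Fin 4 → TangentSpace (𝓡 4) p,
    (η p v) ^ 2 = -(Matrix.of fun i j => g p (v i) (v j)).det

/-- `λ = -ξ^α ξ_α`. -/
def normFn (g : BilinField M) (ξ : VField M) (p : M) : ℝ := -(g p (ξ p) (ξ p))

/-- The Killing form of `ξ`, in the chart `φ`. -/
def killingForm (φ : OpenPartialHomeomorph M E4) (g : BilinField M) (η : FourForm M)
    (ξ : VField M) : E4 → Fin 4 → Fin 4 → ℂ :=
  killingFormCoord (bilinComp φ g) (fourComp φ η) (vecComp φ ξ)

/-- The Ernst one-form of `ξ`, in the chart `φ`. -/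
def ernstForm (φ : OpenPartialHomeomorph M E4) (g : BilinField M) (η : FourForm M)
    (ξ : VField M) : E4 → Fin 4 → ℂ :=
  ernstFormCoord (bilinComp φ g) (fourComp φ η) (vecComp φ ξ)

/-- `ξ` is a Killing vector of `g` on `U`. -/
def IsKilling (g : BilinField M) (ξ : VField M) (U : Set M) : Prop :=
  ∀ φ : OpenPartialHomeomorph M E4, IsChart φ → ∀ x ∈ coordSet φ U, ∀ i j,
    lieMetric (bilinComp φ g) (vecComp φ ξ) x i j = 0

/-- `ξ^α R_{αβ} = 0` on `U`. -/
def RicciAnnihilates (g : BilinField M) (ξ : VField M) (U : Set M) : Prop :=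
  ∀ φ : OpenPartialHomeomorph M E4, IsChart φ → ∀ x ∈ coordSet φ U, ∀ j,
    ∑ i, vecComp φ ξ x i * ricci (bilinComp φ g) x i j = 0

/-- The complex function `σ` is an Ernst potential on `U`: it is smooth, its real part is `λ`,
and `dσ` is the Ernst one-form. -/
structure IsErnstPotential (g : BilinField M) (η : FourForm M) (ξ : VField M) (σ : M → ℂ)
    (U : Set M) : Prop where
  smooth : ContMDiffOn (𝓡 4) 𝓘(ℝ, ℂ) ∞ σ U
  re_eq : ∀ p ∈ U, (σ p).re = normFn g ξ p
  grad : ∀ φ : OpenPartialHomeomorph M E4, IsChart φ → ∀ x ∈ coordSet φ U, ∀ j,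
    pd j (fun y => σ (φ.symm y)) x = ernstForm φ g η ξ x j

/-! ## The transformation `T(ζ, W, g)` -/

/-- `Ω² = 1 + ζ^α W_α`. -/
def Omega2 (ζ : VField M) (W : OneForm M) (p : M) : ℝ := 1 + W p (ζ p)

/-- `T(ζ, W, g)_{αβ} = Ω² g_{αβ} - ζ_α W_β - ζ_β W_α - (λ / Ω²) W_α W_β`. -/
def T (ζ : VField M) (W : OneForm M) (g : BilinField M) : BilinField M := fun p =>
  LinearMap.mk₂ ℝ
    (fun v w => Omega2 ζ W p * g p v w - g p v (ζ p) * W p w - g p w (ζ p) * W p v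
      - normFn g ζ p / Omega2 ζ W p * (W p v * W p w))
    (fun v v' w => by simp only [map_add, LinearMap.add_apply]; ring)
    (fun c v w => by simp only [map_smul, LinearMap.smul_apply, smul_eq_mul]; ring)
    (fun v w w' => by simp only [map_add, LinearMap.add_apply]; ring)
    (fun c v w => by simp only [map_smul, LinearMap.smul_apply, smul_eq_mul]; ring)

end Components

/-! ## The matrix group of parameters -/

/-- The group of the matrices `(α, iβ; iγ, δ)` with `α, β, γ, δ` real and `αδ + βγ = 1`,
under matrix multiplication. -/
def ehlersGroup : Subgroup SL(2, ℂ) where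
  carrier := {A | (A.1 0 0).im = 0 ∧ (A.1 0 1).re = 0 ∧ (A.1 1 0).re = 0 ∧ (A.1 1 1).im = 0}
  one_mem' := by simp
  mul_mem' := by
    rintro A B ⟨a1, a2, a3, a4⟩ ⟨b1, b2, b3, b4⟩
    simp [Matrix.mul_apply, Fin.sum_univ_two, a1, a2, a3, a4, b1, b2, b3, b4]
  inv_mem' := by
    rintro A ⟨a1, a2, a3, a4⟩
    simp [Matrix.adjugate_fin_two, a1, a2, a3, a4]

namespace Param

def α (A : ehlersGroup) : ℝ := (A.1.1 0 0).re
def β (A : ehlersGroup) : ℝ := (A.1.1 0 1).im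
def γ (A : ehlersGroup) : ℝ := (A.1.1 1 0).im
def δ (A : ehlersGroup) : ℝ := (A.1.1 1 1).re

end Param

/-- `i γ s + δ`. -/
def factor (γ δ : ℝ) (s : ℂ) : ℂ := Complex.I * γ * s + δ

/-- The Möbius map `s ↦ (α s + i β) / (i γ s + δ)`. -/
def mobius (A : ehlersGroup) (s : ℂ) : ℂ :=
  (Param.α A * s + Complex.I * Param.β A) / factor (Param.γ A) (Param.δ A) s

/-! ## Ehlers transformations -/

/-- An open region `U` of `M` with a metric, a volume form and a complex function on it
(values outside `U` are irrelevant). -/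
structure ErnstData (M : Type*) [TopologicalSpace M] [ChartedSpace E4 M] where
  U : Set M
  g : BilinField M
  η : FourForm M
  σ : M → ℂ

section Transformations

variable {M : Type*} [TopologicalSpace M] [ChartedSpace E4 M]

/-- `D` is a smooth oriented Lorentzian spacetime with Killing vector `ξ`, `ξ^α R_{αβ} = 0`, and
exact Ernst one-form with potential `D.σ`. No condition is put on the causal character of `ξ`. -/
structure IsErnstSpacetime (ξ : VField M) (D : ErnstData M) : Prop where
  isOpen : IsOpen D.U
  smooth_metric : SmoothBilin D.g D.U
  lorentz : ∀ p ∈ D.U, IsLorentzAt D.g p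
  smooth_volume : SmoothFour D.η D.U
  volume : ∀ p ∈ D.U, IsVolumeAt D.g D.η p
  smooth_killing : SmoothVec ξ D.U
  killing : IsKilling D.g ξ D.U
  ricci : RicciAnnihilates D.g ξ D.U
  potential : IsErnstPotential D.g D.η ξ D.σ D.U

/-- `W` is a smooth one-form on the spacetime `D` with
`dW = Re[-4γ(γ σ̄ + iδ) 𝓕]` and `ξ^α W_α + 1 = |iγσ + δ|²`. -/
structure IsEhlersForm (ξ : VField M) (D : ErnstData M) (γ δ : ℝ) (W : OneForm M) : Prop where
  smooth : SmoothOne W D.U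
  ext_deriv : ∀ φ : OpenPartialHomeomorph M E4, IsChart φ → ∀ x ∈ coordSet φ D.U, ∀ i j,
    pd i (fun y => oneComp φ W y j) x - pd j (fun y => oneComp φ W y i) x =
      (-4 * γ * (γ * (starRingEnd ℂ) (D.σ (φ.symm x)) + Complex.I * δ)
        * killingForm φ D.g D.η ξ x i j).re
  norm : ∀ p ∈ D.U, W p (ξ p) + 1 = Complex.normSq (factor γ δ (D.σ p))

/-- The transformed spacetime: the points where `iγσ + δ = 0` (that is, `λ = 0` and
`γω + δ = 0`) are removed, the metric becomes `T(ξ, W, g)`, the volume form `Ω² η`, and the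
Ernst potential is changed by the Möbius map of `A`. -/
def ErnstData.transform (ξ : VField M) (A : ehlersGroup) (W : OneForm M) (D : ErnstData M) :
    ErnstData M where
  U := {p ∈ D.U | factor (Param.γ A) (Param.δ A) (D.σ p) ≠ 0}
  g := T ξ W D.g
  η := fun p => Omega2 ξ W p • D.η p
  σ := fun p => mobius A (D.σ p)

/-- A spacetime together with a choice, for each element of the parameter group, of a one-form. -/
structure EhlersSystem (M : Type*) [TopologicalSpace M] [ChartedSpace E4 M]
    extends ErnstData M where
  W : ehlersGroup → OneForm M

/-- All the chosen one-forms solve the Ehlers equations, and the choice for the identity is `0`. -/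
structure IsEhlersSystem (ξ : VField M) (S : EhlersSystem M) : Prop where
  spacetime : IsErnstSpacetime ξ S.toErnstData
  form : ∀ A : ehlersGroup, IsEhlersForm ξ S.toErnstData (Param.γ A) (Param.δ A) (S.W A)
  form_one : ∀ p ∈ S.U, S.W 1 p = 0

/-- The Ehlers transformation with parameter `A`. The one-form for `B` on the transformed
spacetime is `W' = W'' - Ω'² W`, where `W`, `W''` are the one-forms for `A`, `B A` on the original
spacetime and `Ω'² = |iγ'σ' + δ'|²`. -/
def EhlersSystem.act (ξ : VField M) (A : ehlersGroup) (S : EhlersSystem M) : EhlersSystem M where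
  toErnstData := S.toErnstData.transform ξ A (S.W A)
  W := fun B p => S.W (B * A) p
    - Complex.normSq (factor (Param.γ B) (Param.δ B) (mobius A (S.σ p))) • S.W A p

/-- Two systems coincide at all points of `V`. -/
def AgreeOn (V : Set M) (S S' : EhlersSystem M) : Prop :=
  ∀ p ∈ V, S.g p = S'.g p ∧ S.η p = S'.η p ∧ S.σ p = S'.σ p ∧ ∀ A, S.W A p = S'.W A p

end Transformations

end Ehlers

end

/-! Everything except the group law is local, so the argument runs on components in a chart. The
Killing equation makes F = ∇ξ antisymmetric and equal to half the exterior derivative of the lowered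
field, so F is closed. The contracted Ricci identity then turns ξ^α R_{αβ} into the divergence of F
(`ricci_killing`). Hence the Ricci condition holds exactly when ⋆F is closed
(`ricci_annihilates_iff_closed`), and it can be carried through the transformation without computing
any curvature of the new metric.

Write f = iγσ + δ and Ω² = |f|². The decisive remark is `metric_eq_conj`: T(g) = Ω² Lᵗ g L with L =
1 − Ω⁻² ξ ⊗ W, and W(ξ) = Ω² − 1 gives det L = Ω⁻². On two-forms the Hodge star is natural and
conformally invariant (`hodgeMat_conj`), so the new star intertwines with the old one through L. The
lowered field becomes ξ♭ + (λ/Ω²) W; its derivative, with dW known, is the real part of (f̄/f) L*𝓕.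
Multiplication by the phase f̄/f preserves self-duality, so the imaginary part is the new dual, and
𝓕' = (f̄/f) L*𝓕 (`selfDual_eq`). The form 𝓕' is closed because of the curl equation for W and dσ̄ ∧
𝓕 + dσ ∧ 𝓕̄ = 0 (`wedge_conj`), which itself comes from F∧F + ⋆F∧⋆F = 0.

Composition is pointwise algebra resting on the cocycle identity f_B(σ') f_A(σ) = f_{BA}(σ)
(`factor_mobius`): it makes the domains, the volume forms, the metrics (`T_T`) and the one-forms
match.

For faithfulness, equal transforms give equal Möbius maps on the values of σ near a point with dσ ≠
0, hence B = ±A. The sign acts trivially on σ but is detected by the one-forms, provided the one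
chosen for −1 is not zero. For (0, −1) the equations only require a closed form annihilated by ξ,
and Re(c dσ) is one (`isEhlersForm_reDiff`). -/

noncomputable section

namespace Ehlers

/-! ## Partial derivatives -/

section PartialDerivatives

variable {x : E4}

lemma pd_eq_of_hasFDerivAt {V : Type*} [NormedAddCommGroup V] [NormedSpace ℝ V] {f : E4 → V}
    {f' : E4 →L[ℝ] V} (h : HasFDerivAt f f' x) (i : Fin 4) :
    pd i f x = f' (EuclideanSpace.single i 1) := by rw [pd, h.fderiv]

lemma pd_congr {V : Type*} [NormedAddCommGroup V] [NormedSpace ℝ V] {f g : E4 → V} {O : Set E4}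
    (hO : IsOpen O) (hx : x ∈ O) (h : ∀ y ∈ O, f y = g y) (i : Fin 4) : pd i f x = pd i g x := by
  rw [pd, pd, Filter.EventuallyEq.fderiv_eq (Filter.eventually_of_mem (hO.mem_nhds hx) h)]

lemma hasFDerivAt_of_smooth {V : Type*} [NormedAddCommGroup V] [NormedSpace ℝ V] {f : E4 → V}
    (h : ContDiffAt ℝ ∞ f x) : HasFDerivAt f (fderiv ℝ f x) x :=
  (h.differentiableAt (by simp)).hasFDerivAt

lemma contDiffAt_pd {V : Type*} [NormedAddCommGroup V] [NormedSpace ℝ V] {f : E4 → V}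
    (h : ContDiffAt ℝ ∞ f x) (i : Fin 4) : ContDiffAt ℝ ∞ (pd i f) x :=
  (h.fderiv_right (m := ∞) (by simp)).clm_apply contDiffAt_const

lemma pd_const {V : Type*} [NormedAddCommGroup V] [NormedSpace ℝ V] (c : V) (i : Fin 4) :
    pd i (fun _ => c) x = 0 := by simp [pd]

lemma pd_add {V : Type*} [NormedAddCommGroup V] [NormedSpace ℝ V] {f g : E4 → V} (hf : ContDiffAt ℝ ∞ f x) (hg : ContDiffAt ℝ ∞ g x) (i : Fin 4) :
    pd i (fun y => f y + g y) x = pd i f x + pd i g x :=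
  pd_eq_of_hasFDerivAt ((hasFDerivAt_of_smooth hf).add (hasFDerivAt_of_smooth hg)) i

lemma pd_sub {V : Type*} [NormedAddCommGroup V] [NormedSpace ℝ V] {f g : E4 → V} (hf : ContDiffAt ℝ ∞ f x) (hg : ContDiffAt ℝ ∞ g x) (i : Fin 4) :
    pd i (fun y => f y - g y) x = pd i f x - pd i g x :=
  pd_eq_of_hasFDerivAt ((hasFDerivAt_of_smooth hf).sub (hasFDerivAt_of_smooth hg)) i

lemma pd_neg {V : Type*} [NormedAddCommGroup V] [NormedSpace ℝ V] {f : E4 → V} (hf : ContDiffAt ℝ ∞ f x) (i : Fin 4) :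
    pd i (fun y => -f y) x = -pd i f x :=
  pd_eq_of_hasFDerivAt (hasFDerivAt_of_smooth hf).neg i

lemma pd_mul {A : Type*} [NormedCommRing A] [NormedAlgebra ℝ A] {f g : E4 → A} (hf : ContDiffAt ℝ ∞ f x) (hg : ContDiffAt ℝ ∞ g x) (i : Fin 4) :
    pd i (fun y => f y * g y) x = pd i f x * g x + f x * pd i g x := by
  rw [pd_eq_of_hasFDerivAt ((hasFDerivAt_of_smooth hf).fun_mul (hasFDerivAt_of_smooth hg)) i]
  simp [pd]; ring

lemma pd_const_mul {A : Type*} [NormedCommRing A] [NormedAlgebra ℝ A] (c : A) {f : E4 → A} (hf : ContDiffAt ℝ ∞ f x) (i : Fin 4) :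
    pd i (fun y => c * f y) x = c * pd i f x := by
  rw [pd_eq_of_hasFDerivAt ((hasFDerivAt_of_smooth hf).const_mul c) i]; simp [pd]

lemma pd_sum {V : Type*} [NormedAddCommGroup V] [NormedSpace ℝ V] {ι : Type*} (s : Finset ι) {f : ι → E4 → V} (hf : ∀ k, ContDiffAt ℝ ∞ (f k) x)
    (i : Fin 4) : pd i (fun y => ∑ k ∈ s, f k y) x = ∑ k ∈ s, pd i (f k) x := by
  rw [pd_eq_of_hasFDerivAt (HasFDerivAt.fun_sum fun k _ => hasFDerivAt_of_smooth (hf k)) i]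
  simp [pd]

lemma pd_inv {K : Type*} [NormedField K] [NormedAlgebra ℝ K] {f : E4 → K}
    (hf : ContDiffAt ℝ ∞ f x) (h0 : f x ≠ 0) (i : Fin 4) :
    pd i (fun y => (f y)⁻¹) x = -pd i f x / f x ^ 2 := by
  have hg : ContDiffAt ℝ ∞ (fun y => (f y)⁻¹) x := hf.inv h0
  have h1 : (fun y => (f y)⁻¹ * f y) =ᶠ[nhds x] fun _ => 1 :=
    (hf.continuousAt.eventually_ne h0).mono fun y hy => inv_mul_cancel₀ hy
  have h2 : pd i (fun y => (f y)⁻¹ * f y) x = 0 := by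
    rw [pd, h1.fderiv_eq]; simp
  rw [pd_mul hg hf] at h2
  rw [eq_div_iff (pow_ne_zero 2 h0)]
  linear_combination f x * h2 - pd i f x * (inv_mul_cancel₀ h0)

lemma pd_clm {V V' : Type*} [NormedAddCommGroup V] [NormedSpace ℝ V] [NormedAddCommGroup V']
    [NormedSpace ℝ V'] (L : V →L[ℝ] V') {f : E4 → V} (hf : ContDiffAt ℝ ∞ f x) (i : Fin 4) :
    pd i (fun y => L (f y)) x = L (pd i f x) :=
  pd_eq_of_hasFDerivAt (L.hasFDerivAt.comp x (hasFDerivAt_of_smooth hf)) i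

lemma pd_ofReal {f : E4 → ℝ} (hf : ContDiffAt ℝ ∞ f x) (i : Fin 4) :
    pd i (fun y => (f y : ℂ)) x = ((pd i f x : ℝ) : ℂ) := pd_clm Complex.ofRealCLM hf i

lemma pd_re {f : E4 → ℂ} (hf : ContDiffAt ℝ ∞ f x) (i : Fin 4) :
    pd i (fun y => (f y).re) x = (pd i f x).re := pd_clm Complex.reCLM hf i

lemma pd_conj {f : E4 → ℂ} (hf : ContDiffAt ℝ ∞ f x) (i : Fin 4) :
    pd i (fun y => (starRingEnd ℂ) (f y)) x = (starRingEnd ℂ) (pd i f x) :=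
  pd_clm Complex.conjCLE.toContinuousLinearMap hf i

lemma pd_comm {V : Type*} [NormedAddCommGroup V] [NormedSpace ℝ V] {f : E4 → V} (hf : ContDiffAt ℝ ∞ f x) (i j : Fin 4) :
    pd i (pd j f) x = pd j (pd i f) x := by
  have key : ∀ i j : Fin 4, pd i (pd j f) x =
      fderiv ℝ (fderiv ℝ f) x (EuclideanSpace.single i 1) (EuclideanSpace.single j 1) := by
    intro i j
    have h := (hasFDerivAt_of_smooth (hf.fderiv_right (m := ∞) (by simp))).clm_apply
      (hasFDerivAt_const (EuclideanSpace.single j (1 : ℝ) : E4) x)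
    rw [show pd j f = fun y => fderiv ℝ f y (EuclideanSpace.single j 1) from rfl,
      pd_eq_of_hasFDerivAt h]
    simp
  rw [key, key]
  -- Over ℝ the smoothness required for symmetry of the second derivative is 2.
  exact (hf.isSymmSndFDerivAt (by simp only [minSmoothness_of_isRCLikeNormedField]; exact WithTop.coe_le_coe.2 (le_top (a := (2 : ℕ∞))))).eq _ _

lemma contDiffAt_det {n : Type*} [Fintype n] [DecidableEq n] {G : E4 → Matrix n n ℝ}
    (hG : ∀ i j, ContDiffAt ℝ ∞ (fun y => G y i j) x) : ContDiffAt ℝ ∞ (fun y => (G y).det) x := by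
  simp only [Matrix.det_apply']
  exact ContDiffAt.sum fun σ _ => contDiffAt_const.mul (contDiffAt_prod fun i _ => hG _ _)

lemma contDiffAt_inv_apply {G : E4 → Matrix (Fin 4) (Fin 4) ℝ}
    (hG : ∀ i j, ContDiffAt ℝ ∞ (fun y => G y i j) x) (h0 : (G x).det ≠ 0) (i j : Fin 4) :
    ContDiffAt ℝ ∞ (fun y => (G y)⁻¹ i j) x := by
  simp only [Matrix.inv_def, Matrix.smul_apply, Ring.inverse_eq_inv', smul_eq_mul,
    Matrix.adjugate_apply]
  refine ((contDiffAt_det hG).inv h0).mul (contDiffAt_det fun a b => ?_)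
  by_cases h : a = j
  · subst h; simpa using contDiffAt_const
  · simpa [Matrix.updateRow_ne h] using hG a b

/-- Jacobi's formula. -/
lemma pd_det {G : E4 → Matrix (Fin 4) (Fin 4) ℝ}
    (hG : ∀ i j, ContDiffAt ℝ ∞ (fun y => G y i j) x) (h0 : (G x).det ≠ 0) (l : Fin 4) :
    pd l (fun y => (G y).det) x =
      (G x).det * ∑ i, ∑ j, (G x)⁻¹ i j * pd l (fun y => G y j i) x := by
  have h1 : pd l (fun y => (G y).det) x
      = ∑ i, ((G x).updateCol i (fun j => pd l (fun y => G y j i) x)).det := by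
    simp only [Matrix.det_apply']
    rw [pd_sum _ fun σ => contDiffAt_const.mul (contDiffAt_prod fun i _ => hG _ _),
      Finset.sum_comm]
    refine Finset.sum_congr rfl fun σ _ => ?_
    rw [pd_const_mul _ (contDiffAt_prod fun i _ => hG _ _), ← Finset.mul_sum]
    congr 1
    rw [pd_eq_of_hasFDerivAt (HasFDerivAt.finsetProd fun i _ => hasFDerivAt_of_smooth (hG _ _)) l]
    simp only [_root_.sum_apply, _root_.smul_apply, smul_eq_mul]
    refine Finset.sum_congr rfl fun i _ => ?_
    rw [← Finset.mul_prod_erase _ _ (Finset.mem_univ i), Matrix.updateCol_self, mul_comm]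
    congr 1
    refine Finset.prod_congr rfl fun j hj => ?_
    rw [Matrix.updateCol_ne (Finset.ne_of_mem_erase hj)]
  rw [h1, Finset.mul_sum]
  refine Finset.sum_congr rfl fun i _ => ?_
  rw [← Matrix.cramer_apply, Matrix.cramer_eq_adjugate_mulVec, Matrix.mulVec, dotProduct,
    Finset.mul_sum]
  refine Finset.sum_congr rfl fun j _ => ?_
  rw [Matrix.inv_def, Matrix.smul_apply, Ring.inverse_eq_inv', smul_eq_mul]
  field_simp

end PartialDerivatives

/-! ## The metric and its Killing vector in local coordinates -/

/-- A smooth metric `G` with volume form `e dx⁰∧dx¹∧dx²∧dx³` and a smooth vector field `X`, on an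
open subset of `ℝ⁴`. -/
structure IsMetricRegion (O : Set E4) (G : E4 → Matrix (Fin 4) (Fin 4) ℝ) (e : E4 → ℝ)
    (X : E4 → Fin 4 → ℝ) : Prop where
  isOpen : IsOpen O
  metric : ∀ x ∈ O, ∀ i j, ContDiffAt ℝ ∞ (fun y => G y i j) x
  symm : ∀ x ∈ O, ∀ i j, G x i j = G x j i
  volume : ∀ x ∈ O, ContDiffAt ℝ ∞ e x
  sq_volume : ∀ x ∈ O, e x ^ 2 = -(G x).det
  det_ne : ∀ x ∈ O, (G x).det ≠ 0
  field : ∀ x ∈ O, ∀ i, ContDiffAt ℝ ∞ (fun y => X y i) x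

/-- The form `F^{ij}` with indices raised, as a matrix. -/
def raised (G : E4 → Matrix (Fin 4) (Fin 4) ℝ) (X : E4 → Fin 4 → ℝ) (x : E4) :
    Matrix (Fin 4) (Fin 4) ℝ :=
  (G x)⁻¹ * Matrix.of (nablaLower G X x) * (G x)⁻¹ᵀ

/-- `∇ⱼ Xᵏ`. -/
def nablaUpper (G : E4 → Matrix (Fin 4) (Fin 4) ℝ) (X : E4 → Fin 4 → ℝ) (x : E4)
    (j k : Fin 4) : ℝ :=
  pd j (fun y => X y k) x + ∑ l, christoffel G x k l j * X x l

namespace IsMetricRegion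

variable {O : Set E4} {G : E4 → Matrix (Fin 4) (Fin 4) ℝ} {e : E4 → ℝ} {X : E4 → Fin 4 → ℝ}
  {x : E4}

lemma isUnit_det (h : IsMetricRegion O G e X) (hx : x ∈ O) : IsUnit (G x).det :=
  isUnit_iff_ne_zero.2 (h.det_ne x hx)

lemma volume_ne (h : IsMetricRegion O G e X) (hx : x ∈ O) : e x ≠ 0 := by
  intro h0
  have := h.sq_volume x hx
  rw [h0] at this
  exact h.det_ne x hx (by linarith)

lemma inv (h : IsMetricRegion O G e X) (hx : x ∈ O) (i j : Fin 4) :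
    ContDiffAt ℝ ∞ (fun y => (G y)⁻¹ i j) x :=
  contDiffAt_inv_apply (h.metric x hx) (h.det_ne x hx) i j

lemma contDiffAt_christoffel (h : IsMetricRegion O G e X) (hx : x ∈ O) (k i j : Fin 4) :
    ContDiffAt ℝ ∞ (fun y => christoffel G y k i j) x := by
  have hd := fun a b c => contDiffAt_pd (h.metric x hx a b) c
  exact contDiffAt_const.mul (ContDiffAt.sum fun l _ =>
    (h.inv hx k l).mul (((hd _ _ _).add (hd _ _ _)).sub (hd _ _ _)))

lemma contDiffAt_lower (h : IsMetricRegion O G e X) (hx : x ∈ O) (i : Fin 4) :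
    ContDiffAt ℝ ∞ (fun y => lower G X y i) x :=
  ContDiffAt.sum fun j _ => (h.metric x hx i j).mul (h.field x hx j)

lemma contDiffAt_nablaLower (h : IsMetricRegion O G e X) (hx : x ∈ O) (i j : Fin 4) :
    ContDiffAt ℝ ∞ (fun y => nablaLower G X y i j) x :=
  (contDiffAt_pd (h.contDiffAt_lower hx j) i).sub (ContDiffAt.sum fun k _ =>
    (h.contDiffAt_christoffel hx k i j).mul (h.contDiffAt_lower hx k))

lemma contDiffAt_raised (h : IsMetricRegion O G e X) (hx : x ∈ O) (i j : Fin 4) :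
    ContDiffAt ℝ ∞ (fun y => raised G X y i j) x := by
  simp only [raised, Matrix.mul_apply, Matrix.transpose_apply, Matrix.of_apply]
  exact ContDiffAt.sum fun k _ => (ContDiffAt.sum fun l _ =>
    (h.inv hx _ _).mul (h.contDiffAt_nablaLower hx _ _)).mul (h.inv hx _ _)

lemma pd_metric_symm (h : IsMetricRegion O G e X) (hx : x ∈ O) (l i j : Fin 4) :
    pd l (fun y => G y i j) x = pd l (fun y => G y j i) x :=
  pd_congr h.isOpen hx (fun y hy => h.symm y hy i j) l

lemma christoffel_symm (h : IsMetricRegion O G e X) (hx : x ∈ O) (k i j : Fin 4) :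
    christoffel G x k i j = christoffel G x k j i := by
  simp only [christoffel]
  congr 1
  refine Finset.sum_congr rfl fun l _ => ?_
  rw [h.pd_metric_symm hx l i j]; ring

lemma inv_symm (h : IsMetricRegion O G e X) (hx : x ∈ O) (i j : Fin 4) :
    (G x)⁻¹ i j = (G x)⁻¹ j i := by
  have hs : (G x)ᵀ = G x := by ext a b; exact h.symm x hx b a
  have := Matrix.transpose_nonsing_inv (G x)
  rw [hs] at this
  exact congrFun (congrFun this j) i

lemma sum_metric_christoffel (h : IsMetricRegion O G e X) (hx : x ∈ O) (m i j : Fin 4) :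
    ∑ k, G x m k * christoffel G x k i j = 1 / 2 * (pd i (fun y => G y j m) x
      + pd j (fun y => G y i m) x - pd m (fun y => G y i j) x) := by
  set t : Fin 4 → ℝ := fun l => pd i (fun y => G y j l) x + pd j (fun y => G y i l) x
    - pd l (fun y => G y i j) x with ht
  have h1 : (G x) *ᵥ ((G x)⁻¹ *ᵥ t) = t := by
    rw [Matrix.mulVec_mulVec, Matrix.mul_nonsing_inv _ (h.isUnit_det hx), Matrix.one_mulVec]
  have h2 := congrFun h1 m
  simp only [Matrix.mulVec, dotProduct] at h2
  rw [show pd i (fun y => G y j m) x + pd j (fun y => G y i m) x - pd m (fun y => G y i j) x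
    = t m from rfl, ← h2, Finset.mul_sum]
  refine Finset.sum_congr rfl fun k _ => ?_
  simp only [christoffel]; ring

lemma pd_lower (h : IsMetricRegion O G e X) (hx : x ∈ O) (i j : Fin 4) :
    pd i (fun y => lower G X y j) x
      = ∑ k, (pd i (fun y => G y j k) x * X x k + G x j k * pd i (fun y => X y k) x) := by
  simp only [lower]
  rw [pd_sum _ fun k => (h.metric x hx j k).mul (h.field x hx k)]
  exact Finset.sum_congr rfl fun k _ => pd_mul (h.metric x hx j k) (h.field x hx k) i

lemma sum_christoffel_lower (h : IsMetricRegion O G e X) (hx : x ∈ O) (i j : Fin 4) :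
    ∑ k, christoffel G x k i j * lower G X x k = ∑ m, 1 / 2 * (pd i (fun y => G y j m) x
      + pd j (fun y => G y i m) x - pd m (fun y => G y i j) x) * X x m := by
  simp only [← h.sum_metric_christoffel hx, lower, Finset.mul_sum, Finset.sum_mul]
  rw [Finset.sum_comm]
  refine Finset.sum_congr rfl fun m _ => Finset.sum_congr rfl fun k _ => ?_
  rw [h.symm x hx m k]; ring

/-- In the symmetrised sum only one derivative of the metric survives in each Christoffel bracket.
This converts the Killing equation into antisymmetry of ∇X. -/
lemma nablaLower_add_swap (h : IsMetricRegion O G e X) (hx : x ∈ O) (i j : Fin 4) :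
    nablaLower G X x i j + nablaLower G X x j i = lieMetric G X x i j := by
  simp only [nablaLower, h.pd_lower hx, h.sum_christoffel_lower hx, lieMetric,
    ← Finset.sum_sub_distrib, ← Finset.sum_add_distrib]
  refine Finset.sum_congr rfl fun k _ => ?_
  rw [h.pd_metric_symm hx k j i, h.symm x hx k j]; ring

/-- This is metric compatibility: the Christoffel symbols with lowered first index account exactly
for the derivative of the metric, so lowering commutes with ∇. -/
lemma nablaLower_eq (h : IsMetricRegion O G e X) (hx : x ∈ O) (i j : Fin 4) :
    nablaLower G X x i j = ∑ k, G x j k * nablaUpper G X x i k := by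
  simp only [nablaLower, h.pd_lower hx, h.sum_christoffel_lower hx, nablaUpper, mul_add,
    Finset.mul_sum, Finset.sum_add_distrib]
  rw [Finset.sum_comm (s := Finset.univ) (t := Finset.univ)
    (f := fun k l => G x j k * (christoffel G x k l i * X x l))]
  simp only [← mul_assoc, ← Finset.sum_mul, h.sum_metric_christoffel hx]
  rw [← Finset.sum_add_distrib, ← Finset.sum_sub_distrib, ← Finset.sum_add_distrib]
  refine Finset.sum_congr rfl fun k _ => ?_
  simp only [h.pd_metric_symm hx _ k]
  ring

lemma nablaUpper_eq (h : IsMetricRegion O G e X) (hx : x ∈ O) (j k : Fin 4) :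
    nablaUpper G X x j k = ∑ m, G x j m * raised G X x m k := by
  have h1 : (Matrix.of (nablaLower G X x)) = Matrix.of (nablaUpper G X x) * (G x)ᵀ := by
    ext i j
    simp only [Matrix.of_apply, Matrix.mul_apply, Matrix.transpose_apply, h.nablaLower_eq hx i j,
      mul_comm]
  have h2 : G x * raised G X x = Matrix.of (nablaUpper G X x) := by
    rw [raised, h1, ← Matrix.mul_assoc, ← Matrix.mul_assoc, ← Matrix.mul_assoc,
      Matrix.mul_nonsing_inv _ (h.isUnit_det hx),
      Matrix.one_mul, Matrix.mul_assoc, ← Matrix.transpose_mul,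
      Matrix.nonsing_inv_mul _ (h.isUnit_det hx)]
    simp
  have := congrFun (congrFun h2 j) k
  simp only [Matrix.mul_apply, Matrix.of_apply] at this
  exact this.symm

lemma nablaLower_antisymm (h : IsMetricRegion O G e X)
    (hK : ∀ x ∈ O, ∀ i j, lieMetric G X x i j = 0) (hx : x ∈ O) (i j : Fin 4) :
    nablaLower G X x i j = -nablaLower G X x j i := by
  linarith [h.nablaLower_add_swap hx i j, hK x hx i j]

/-- The connection term is symmetric in its two lower indices, so it drops out once ∇X is
antisymmetric. -/
lemma nablaLower_eq_curl (h : IsMetricRegion O G e X)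
    (hK : ∀ x ∈ O, ∀ i j, lieMetric G X x i j = 0) (hx : x ∈ O) (i j : Fin 4) :
    nablaLower G X x i j
      = 1 / 2 * (pd i (fun y => lower G X y j) x - pd j (fun y => lower G X y i) x) := by
  have h1 := h.nablaLower_antisymm hK hx i j
  have h2 : ∑ k, christoffel G x k i j * lower G X x k
      = ∑ k, christoffel G x k j i * lower G X x k :=
    Finset.sum_congr rfl fun k _ => by rw [h.christoffel_symm hx]
  simp only [nablaLower] at h1 ⊢
  linarith

lemma raised_antisymm (h : IsMetricRegion O G e X)
    (hK : ∀ x ∈ O, ∀ i j, lieMetric G X x i j = 0) (hx : x ∈ O) (i j : Fin 4) :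
    raised G X x i j = -raised G X x j i := by
  have hF : (Matrix.of (nablaLower G X x))ᵀ = -Matrix.of (nablaLower G X x) := by
    ext a b; simpa using h.nablaLower_antisymm hK hx b a
  have : (raised G X x)ᵀ = -raised G X x := by
    rw [raised, Matrix.transpose_mul, Matrix.transpose_mul, Matrix.transpose_transpose, hF,
      Matrix.mul_assoc, Matrix.neg_mul, Matrix.mul_neg]
  have h2 := congrFun (congrFun this j) i
  simpa using h2

lemma trace_nablaUpper (h : IsMetricRegion O G e X)
    (hK : ∀ x ∈ O, ∀ i j, lieMetric G X x i j = 0) (hx : x ∈ O) :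
    ∑ k, nablaUpper G X x k k = 0 := by
  have h1 : ∑ k, nablaUpper G X x k k = -∑ k, nablaUpper G X x k k := by
    simp only [h.nablaUpper_eq hx]
    conv_rhs => rw [Finset.sum_comm]
    rw [← Finset.sum_neg_distrib]
    refine Finset.sum_congr rfl fun k _ => ?_
    rw [← Finset.sum_neg_distrib]
    refine Finset.sum_congr rfl fun m _ => ?_
    rw [h.symm x hx k m, h.raised_antisymm hK hx m k]; ring
  linarith

lemma contDiffAt_nablaUpper (h : IsMetricRegion O G e X) (hx : x ∈ O) (j k : Fin 4) :
    ContDiffAt ℝ ∞ (fun y => nablaUpper G X y j k) x :=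
  (contDiffAt_pd (h.field x hx k) j).add (ContDiffAt.sum fun l _ =>
    (h.contDiffAt_christoffel hx k l j).mul (h.field x hx l))

/-- The contracted Ricci identity. -/
lemma ricci_identity (h : IsMetricRegion O G e X) (hx : x ∈ O) (j : Fin 4) :
    ∑ i, X x i * ricci G x i j =
      ∑ k, pd k (fun y => nablaUpper G X y j k) x - pd j (fun y => ∑ k, nablaUpper G X y k k) x
      + ∑ k, ∑ l, (christoffel G x k k l * nablaUpper G X x j l
          - christoffel G x k j l * nablaUpper G X x k l) := by
  have hA : ∀ a b c, pd a (fun y => nablaUpper G X y b c) x = pd a (pd b (fun y => X y c)) x +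
      ∑ l, (pd a (fun y => christoffel G y c l b) x * X x l
        + christoffel G x c l b * pd a (fun y => X y l) x) := by
    intro a b c
    simp only [nablaUpper]
    rw [pd_add (contDiffAt_pd (h.field x hx c) b) (ContDiffAt.sum fun l _ =>
        (h.contDiffAt_christoffel hx c l b).mul (h.field x hx l)),
      pd_sum _ fun l => (h.contDiffAt_christoffel hx c l b).mul (h.field x hx l)]
    congr 1
    exact Finset.sum_congr rfl fun l _ =>
      pd_mul (h.contDiffAt_christoffel hx c l b) (h.field x hx l) a
  rw [pd_sum _ fun k => h.contDiffAt_nablaUpper hx k k]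
  simp only [hA]
  simp only [nablaUpper, ricci]
  have hc : ∀ k, pd j (pd k fun y => X y k) x = pd k (pd j fun y => X y k) x :=
    fun k => pd_comm (h.field x hx k) j k
  -- The index order in `nablaUpper` makes the terms with ∂Γ coincide literally with those of
  -- `ricci`. The symmetry of Γ is therefore needed only for undifferentiated symbols.
  have hs := fun k l => h.christoffel_symm hx k l j
  have hs' := fun k l => h.christoffel_symm hx k l k
  simp only [hc, hs, hs']
  simp only [Fin.sum_univ_four]
  ring

end IsMetricRegion

/-! ### The Ricci condition as closedness of the dual two-form -/

/-- The matrix `½ ε_{ijkl} B^{kl}`, for antisymmetric `B`. -/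
def dual {R : Type*} [Ring R] (B : Matrix (Fin 4) (Fin 4) R) : Matrix (Fin 4) (Fin 4) R :=
  !![0, B 2 3, -B 1 3, B 1 2; -B 2 3, 0, B 0 3, -B 0 2; B 1 3, -B 0 3, 0, B 0 1;
    -B 1 2, B 0 2, -B 0 1, 0]

lemma dual_smul {R : Type*} [Ring R] (c : R) (B : Matrix (Fin 4) (Fin 4) R) :
    dual (c • B) = c • dual B := by
  ext i j; fin_cases i <;> fin_cases j <;> simp [dual]

lemma dual_antisymm {R : Type*} [Ring R] (B : Matrix (Fin 4) (Fin 4) R) (i j : Fin 4) :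
    dual B i j = -dual B j i := by
  fin_cases i <;> fin_cases j <;> simp [dual]

/-- In dimension four the four index triples without repetition give, up to sign, the four
components of the divergence; a triple with a repetition contributes nothing by antisymmetry. -/
lemma sum_div_eq_zero_iff {D : Fin 4 → Matrix (Fin 4) (Fin 4) ℝ}
    (hD : ∀ l i j, D l i j = -D l j i) :
    (∀ m, ∑ k, D k m k = 0) ↔
      ∀ a b c, dual (D a) b c + dual (D b) c a + dual (D c) a b = 0 := by
  have hz : ∀ l m, D l m m = 0 := fun l m => by linarith [hD l m m]
  have h10 := fun l => hD l 1 0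
  have h20 := fun l => hD l 2 0
  have h30 := fun l => hD l 3 0
  have h21 := fun l => hD l 2 1
  have h31 := fun l => hD l 3 1
  have h32 := fun l => hD l 3 2
  simp only [Fin.sum_univ_four]
  constructor
  · intro h
    have h0 := h 0
    have h1 := h 1
    have h2 := h 2
    have h3 := h 3
    rw [hz] at h0 h1 h2 h3
    rw [h10] at h1
    rw [h20, h21] at h2
    rw [h30, h31, h32] at h3
    intro a b c
    fin_cases a <;> fin_cases b <;> fin_cases c <;> simp [dual] <;> linarith
  · intro h
    have h0 := h 1 2 3
    have h1 := h 0 2 3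
    have h2 := h 0 1 3
    have h3 := h 0 1 2
    simp only [dual, Matrix.of_apply, Matrix.cons_val] at h0 h1 h2 h3
    intro m
    fin_cases m <;> simp only [Fin.zero_eta, Fin.mk_one, Fin.reduceFinMk, hz, h10, h20, h30, h21, h31, h32] <;> linarith

namespace IsMetricRegion

variable {O : Set E4} {G : E4 → Matrix (Fin 4) (Fin 4) ℝ} {e : E4 → ℝ} {X : E4 → Fin 4 → ℝ}
  {x : E4}

/-- Differentiate e² = −det G and apply Jacobi's formula. In the contracted Christoffel symbol two
of the three derivative terms cancel by symmetry of the inverse metric. -/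
lemma pd_volume (h : IsMetricRegion O G e X) (hx : x ∈ O) (l : Fin 4) :
    pd l e x = e x * ∑ k, christoffel G x k k l := by
  have h1 : pd l (fun y => e y * e y) x = pd l (fun y => -(G y).det) x :=
    pd_congr h.isOpen hx (fun y hy => by rw [← h.sq_volume y hy]; ring) l
  rw [pd_mul (h.volume x hx) (h.volume x hx), pd_neg (contDiffAt_det (h.metric x hx)),
    pd_det (h.metric x hx) (h.det_ne x hx)] at h1
  have h2 : ∑ k, christoffel G x k k l
      = 1 / 2 * ∑ i, ∑ j, (G x)⁻¹ i j * pd l (fun y => G y j i) x := by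
    simp only [christoffel, ← Finset.mul_sum]
    congr 1
    simp only [mul_sub, mul_add, Finset.sum_add_distrib, Finset.sum_sub_distrib]
    have h3 : ∑ k, ∑ m, (G x)⁻¹ k m * pd m (fun y => G y k l) x
        = ∑ k, ∑ m, (G x)⁻¹ k m * pd k (fun y => G y l m) x := by
      rw [Finset.sum_comm]
      refine Finset.sum_congr rfl fun k _ => Finset.sum_congr rfl fun m _ => ?_
      rw [h.inv_symm hx m k, h.pd_metric_symm hx k m l]
    rw [h3, add_sub_cancel_left]
    refine Finset.sum_congr rfl fun k _ => Finset.sum_congr rfl fun m _ => ?_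
    rw [h.pd_metric_symm hx l k m]
  rw [h2]
  have h4 := h.volume_ne hx
  have h5 := h.sq_volume x hx
  apply mul_left_cancel₀ (mul_ne_zero two_ne_zero h4)
  linear_combination h1 - (∑ i, ∑ j, (G x)⁻¹ i j * pd l (fun y => G y j i) x) * h5

/-- Commuting derivatives gives ∇_k ∇_j X^k − ∇_j ∇_k X^k, and the second term vanishes since the
trace does. For an antisymmetric tensor the covariant divergence is an ordinary divergence weighted
by the volume density. -/
lemma ricci_killing (h : IsMetricRegion O G e X)
    (hK : ∀ x ∈ O, ∀ i j, lieMetric G X x i j = 0) (hx : x ∈ O) (j : Fin 4) :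
    e x * ∑ i, X x i * ricci G x i j =
      ∑ m, G x j m * ∑ k, pd k (fun y => e y * raised G X y m k) x := by
  have ht : pd j (fun y => ∑ k, nablaUpper G X y k k) x = 0 := by
    rw [pd_congr h.isOpen hx (fun y hy => h.trace_nablaUpper hK hy) j, pd_const]
  have hdiv : ∀ k, pd k (fun y => nablaUpper G X y j k) x = ∑ m,
      (pd k (fun y => G y j m) x * raised G X x m k
        + G x j m * pd k (fun y => raised G X y m k) x) := by
    intro k
    rw [pd_congr h.isOpen hx (fun y hy => h.nablaUpper_eq hy j k) k,
      pd_sum _ fun m => (h.metric x hx j m).mul (h.contDiffAt_raised hx m k)]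
    exact Finset.sum_congr rfl fun m _ =>
      pd_mul (h.metric x hx j m) (h.contDiffAt_raised hx m k) k
  have hU : ∀ m k, pd k (fun y => e y * raised G X y m k) x =
      e x * ((∑ l, christoffel G x l l k) * raised G X x m k
        + pd k (fun y => raised G X y m k) x) := by
    intro m k
    rw [pd_mul (h.volume x hx) (h.contDiffAt_raised hx m k), h.pd_volume hx]; ring
  -- This connection term cancels the part of `hdiv` in which the metric is differentiated. The
  -- derivative along j is symmetric in (l, m) and dies against the antisymmetric F; the other two
  -- terms are equal.
  have hconn : ∑ k, ∑ l, christoffel G x k j l * nablaUpper G X x k l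
      = ∑ k, ∑ m, pd k (fun y => G y j m) x * raised G X x m k := by
    have h1 : ∑ k, ∑ l, christoffel G x k j l * nablaUpper G X x k l
        = ∑ m, ∑ l, (1 / 2 * (pd j (fun y => G y l m) x + pd l (fun y => G y j m) x
          - pd m (fun y => G y j l) x)) * raised G X x m l := by
      simp only [← h.sum_metric_christoffel hx, h.nablaUpper_eq hx, Finset.mul_sum,
        Finset.sum_mul]
      rw [Finset.sum_comm_cycle]
      refine Finset.sum_congr rfl fun m _ => ?_
      rw [Finset.sum_comm]
      refine Finset.sum_congr rfl fun l _ => Finset.sum_congr rfl fun k _ => ?_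
      rw [h.symm x hx k m]; ring
    have h2 : ∑ m, ∑ l, pd j (fun y => G y l m) x * raised G X x m l = 0 := by
      have h3 : ∑ m, ∑ l, pd j (fun y => G y l m) x * raised G X x m l
          = -∑ m, ∑ l, pd j (fun y => G y l m) x * raised G X x m l := by
        conv_lhs => rw [Finset.sum_comm]
        rw [← Finset.sum_neg_distrib]
        refine Finset.sum_congr rfl fun m _ => ?_
        rw [← Finset.sum_neg_distrib]
        refine Finset.sum_congr rfl fun l _ => ?_
        rw [h.pd_metric_symm hx j m l, h.raised_antisymm hK hx l m]; ring
      linarith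
    have h4 : ∑ m, ∑ l, pd m (fun y => G y j l) x * raised G X x m l
        = -∑ m, ∑ l, pd l (fun y => G y j m) x * raised G X x m l := by
      conv_lhs => rw [Finset.sum_comm]
      rw [← Finset.sum_neg_distrib]
      refine Finset.sum_congr rfl fun m _ => ?_
      rw [← Finset.sum_neg_distrib]
      refine Finset.sum_congr rfl fun l _ => ?_
      rw [h.raised_antisymm hK hx l m]; ring
    rw [h1, Finset.sum_comm (f := fun k m => pd k (fun y => G y j m) x * raised G X x m k)]
    simp only [mul_assoc, add_mul, sub_mul, ← Finset.mul_sum, Finset.sum_add_distrib,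
      Finset.sum_sub_distrib, h2, h4]
    ring
  -- This is the trace of the connection, which the volume density absorbs.
  have htr : ∑ k, ∑ l, christoffel G x k k l * nablaUpper G X x j l
      = ∑ m, ∑ k, G x j m * ((∑ l, christoffel G x l l k) * raised G X x m k) := by
    simp only [h.nablaUpper_eq hx, Finset.mul_sum, Finset.sum_mul]
    rw [Finset.sum_comm_cycle]
    refine Finset.sum_congr rfl fun m _ => ?_
    rw [Finset.sum_comm]
    refine Finset.sum_congr rfl fun l _ => Finset.sum_congr rfl fun k _ => ?_
    ring
  rw [h.ricci_identity hx, ht]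
  simp only [hdiv, Finset.sum_sub_distrib, hconn, htr, hU, ← Finset.mul_sum]
  simp only [Finset.sum_add_distrib, mul_add]
  rw [Finset.sum_comm (f := fun k m => G x j m * pd k (fun y => raised G X y m k) x)]
  simp only [mul_left_comm _ (e x), ← Finset.mul_sum]
  ring

lemma ricci_annihilates_iff (h : IsMetricRegion O G e X)
    (hK : ∀ x ∈ O, ∀ i j, lieMetric G X x i j = 0) (hx : x ∈ O) :
    (∀ j, ∑ i, X x i * ricci G x i j = 0) ↔
      ∀ m, ∑ k, pd k (fun y => e y * raised G X y m k) x = 0 := by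
  have hr := fun j => h.ricci_killing hK hx j
  constructor
  · intro h0
    have h1 : G x *ᵥ (fun m => ∑ k, pd k (fun y => e y * raised G X y m k) x) = 0 := by
      ext j
      simpa [Matrix.mulVec, dotProduct, h0] using (hr j).symm
    exact congrFun (Matrix.eq_zero_of_mulVec_eq_zero (h.det_ne x hx) h1)
  · intro h0 j
    have h1 := hr j
    simp only [h0, mul_zero, Finset.sum_const_zero] at h1
    exact (mul_eq_zero.1 h1).resolve_left (h.volume_ne hx)

/-- The dual of the two-form `∇X`. -/
def hodgeNabla (G : E4 → Matrix (Fin 4) (Fin 4) ℝ) (e : E4 → ℝ) (X : E4 → Fin 4 → ℝ) (x : E4) :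
    Matrix (Fin 4) (Fin 4) ℝ := dual (e x • raised G X x)

lemma contDiffAt_hodgeNabla (h : IsMetricRegion O G e X) (hx : x ∈ O) (i j : Fin 4) :
    ContDiffAt ℝ ∞ (fun y => hodgeNabla G e X y i j) x := by
  have h1 := fun a b => (h.volume x hx).mul (h.contDiffAt_raised hx a b)
  have h2 := fun a b => ((h.volume x hx).mul (h.contDiffAt_raised hx a b)).neg
  fin_cases i <;> fin_cases j <;> simp [hodgeNabla, dual] <;>
    first | exact h1 _ _ | exact h2 _ _ | exact contDiffAt_const

/-- `ξ^α R_{αβ} = 0` if and only if the dual of `∇ξ` is closed. -/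
lemma ricci_annihilates_iff_closed (h : IsMetricRegion O G e X)
    (hK : ∀ x ∈ O, ∀ i j, lieMetric G X x i j = 0) (hx : x ∈ O) :
    (∀ j, ∑ i, X x i * ricci G x i j = 0) ↔
      ∀ a b c, pd a (fun y => hodgeNabla G e X y b c) x + pd b (fun y => hodgeNabla G e X y c a) x
        + pd c (fun y => hodgeNabla G e X y a b) x = 0 := by
  rw [h.ricci_annihilates_iff hK hx]
  have hB := fun a b => (h.volume x hx).mul (h.contDiffAt_raised hx a b)
  have hanti : ∀ l m k, pd l (fun y => e y * raised G X y m k) x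
      = -pd l (fun y => e y * raised G X y k m) x := by
    intro l m k
    rw [← pd_neg (hB k m)]
    exact pd_congr h.isOpen hx (fun y hy => by rw [h.raised_antisymm hK hy m k]; ring) l
  have hd : ∀ a b c, pd a (fun y => hodgeNabla G e X y b c) x
      = dual (Matrix.of fun m k => pd a (fun y => e y * raised G X y m k) x) b c := by
    intro a b c
    have hn := fun i j => pd_neg (hB i j) a
    fin_cases b <;> fin_cases c <;> simp [hodgeNabla, dual, pd_const, hn]
  simp only [hd]
  exact sum_div_eq_zero_iff (D := fun l => Matrix.of fun m k =>
    pd l (fun y => e y * raised G X y m k) x) hanti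

end IsMetricRegion

/-! ## Pointwise algebra of two-forms -/

/-- The Levi-Civita symbol. -/
def eps (i j k l : Fin 4) : ℝ :=
  (((j : ℕ) : ℝ) - ((i : ℕ) : ℝ)) * (((k : ℕ) : ℝ) - ((i : ℕ) : ℝ))
    * (((l : ℕ) : ℝ) - ((i : ℕ) : ℝ)) * (((k : ℕ) : ℝ) - ((j : ℕ) : ℝ))
    * (((l : ℕ) : ℝ) - ((j : ℕ) : ℝ)) * (((l : ℕ) : ℝ) - ((k : ℕ) : ℝ)) / 12

/-- A permutation multiplies the Vandermonde product of 0, 1, 2, 3 by its sign, and that product is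
1!·2!·3! = 12. A polynomial formula for the symbol lets later component identities be settled by
evaluation. -/
lemma sign_eq_eps (σ : Equiv.Perm (Fin 4)) :
    ((Equiv.Perm.sign σ : ℤ) : ℝ) = eps (σ 0) (σ 1) (σ 2) (σ 3) := by
  have h : ∀ σ : Equiv.Perm (Fin 4), 12 * (Equiv.Perm.sign σ : ℤ) =
      (((σ 1 : ℕ) : ℤ) - ((σ 0 : ℕ) : ℤ)) * (((σ 2 : ℕ) : ℤ) - ((σ 0 : ℕ) : ℤ))
      * (((σ 3 : ℕ) : ℤ) - ((σ 0 : ℕ) : ℤ)) * (((σ 2 : ℕ) : ℤ) - ((σ 1 : ℕ) : ℤ))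
      * (((σ 3 : ℕ) : ℤ) - ((σ 1 : ℕ) : ℤ)) * (((σ 3 : ℕ) : ℤ) - ((σ 2 : ℕ) : ℤ)) := by decide
  have h2 := congrArg (Int.cast : ℤ → ℝ) (h σ)
  push_cast at h2
  rw [eps, eq_div_iff (by norm_num), ← h2]; ring

/-- An injective index tuple is a permutation, which costs its sign. In a tuple with a repetition
the form vanishes, and so does one factor of the Vandermonde product. -/
lemma alternating_apply_eq_eps {V : Type*} [AddCommGroup V] [Module ℝ V]
    (f : V [⋀^Fin 4]→ₗ[ℝ] ℝ) (v : Fin 4 → V) (i j k l : Fin 4) :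
    f ![v i, v j, v k, v l] = f ![v 0, v 1, v 2, v 3] * eps i j k l := by
  by_cases hinj : Function.Injective ![i, j, k, l]
  · set σ : Equiv.Perm (Fin 4) := Equiv.ofBijective _ (Finite.injective_iff_bijective.1 hinj)
    have h1 : ![v i, v j, v k, v l] = ![v 0, v 1, v 2, v 3] ∘ σ := by
      have h2 : ![v 0, v 1, v 2, v 3] = v := by ext a; fin_cases a <;> rfl
      rw [h2]
      ext a; fin_cases a <;> rfl
    have h3 := sign_eq_eps σ
    rw [h1, f.map_perm, show eps i j k l = eps (σ 0) (σ 1) (σ 2) (σ 3) from rfl, ← h3,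
      Units.smul_def, zsmul_eq_mul, mul_comm]
  · have h0 : ∃ a b : Fin 4, a ≠ b ∧ ![i, j, k, l] a = ![i, j, k, l] b := by
      simp only [Function.Injective] at hinj
      push Not at hinj
      obtain ⟨a, b, h1, h2⟩ := hinj
      exact ⟨a, b, h2, h1⟩
    obtain ⟨a, b, hab, h1⟩ := h0
    have h2 : f ![v i, v j, v k, v l] = 0 := by
      refine f.map_eq_zero_of_eq _ (i := a) (j := b) ?_ hab
      have h3 : ∀ c, ![v i, v j, v k, v l] c = v (![i, j, k, l] c) := by
        intro c; fin_cases c <;> rfl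
      rw [h3, h3, h1]
    have h4 : eps i j k l = 0 := by
      fin_cases a <;> fin_cases b <;> simp at hab h1 <;> simp [eps, h1]
    rw [h2, h4, mul_zero]

/-- The Hodge dual of `F` with respect to the metric matrix `G` and the volume form
`e dx⁰∧dx¹∧dx²∧dx³`. -/
def hodgeMat (G : Matrix (Fin 4) (Fin 4) ℝ) (e : ℝ) (F : Matrix (Fin 4) (Fin 4) ℝ) :
    Matrix (Fin 4) (Fin 4) ℝ := dual (e • (G⁻¹ * F * G⁻¹ᵀ))

lemma conj_antisymm {B : Matrix (Fin 4) (Fin 4) ℝ} (hB : Bᵀ = -B) (L : Matrix (Fin 4) (Fin 4) ℝ) :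
    (L * B * Lᵀ)ᵀ = -(L * B * Lᵀ) := by
  rw [Matrix.transpose_mul, Matrix.transpose_mul, Matrix.transpose_transpose, hB,
    Matrix.neg_mul, Matrix.mul_neg, Matrix.mul_assoc]

/-- The factor ½ compensates for each unordered pair (k, l) occurring twice in the double sum. -/
lemma hodge_eq_hodgeMat {G : E4 → Matrix (Fin 4) (Fin 4) ℝ}
    {η : E4 → Fin 4 → Fin 4 → Fin 4 → Fin 4 → ℝ} {e : ℝ} {x : E4}
    (hη : ∀ i j k l, η x i j k l = e * eps i j k l) {F : Fin 4 → Fin 4 → ℝ}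
    (hF : ∀ i j, F i j = -F j i) (i j : Fin 4) :
    hodge G η F x i j = hodgeMat (G x) e (Matrix.of F) i j := by
  set B := (G x)⁻¹ * Matrix.of F * (G x)⁻¹ᵀ with hB
  have hBe : ∀ k l, B k l = ∑ m, ∑ n, (G x)⁻¹ k m * (G x)⁻¹ l n * F m n := by
    intro k l
    simp only [hB, Matrix.mul_apply, Matrix.transpose_apply, Matrix.of_apply, Finset.sum_mul]
    rw [Finset.sum_comm]
    exact Finset.sum_congr rfl fun m _ => Finset.sum_congr rfl fun n _ => by ring
  have h1 : hodge G η F x i j = 1 / 2 * ∑ k, ∑ l, e * eps i j k l * B k l := by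
    simp only [hodge, hη, hBe, Finset.mul_sum]
    refine Finset.sum_congr rfl fun k _ => Finset.sum_congr rfl fun l _ =>
      Finset.sum_congr rfl fun m _ => Finset.sum_congr rfl fun n _ => by ring
  have hBt : Bᵀ = -B := conj_antisymm (by ext a b; simp [hF b a]) _
  have hBs : ∀ k l, B k l = -B l k := fun k l => congrFun (congrFun hBt l) k
  have h10 := hBs 1 0
  have h20 := hBs 2 0
  have h30 := hBs 3 0
  have h21 := hBs 2 1
  have h31 := hBs 3 1
  have h32 := hBs 3 2
  rw [h1, hodgeMat, ← hB]
  simp only [Fin.sum_univ_four, h10, h20, h30, h21, h31, h32]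
  clear_value B
  fin_cases i <;> fin_cases j <;> simp [dual, eps] <;> ring

/-- With six free entries exposed, the identities below become polynomial identities that `ring` can
check. -/
lemma antisymm_eta {B : Matrix (Fin 4) (Fin 4) ℝ} (hB : Bᵀ = -B) :
    B = !![0, B 0 1, B 0 2, B 0 3; -B 0 1, 0, B 1 2, B 1 3; -B 0 2, -B 1 2, 0, B 2 3;
      -B 0 3, -B 1 3, -B 2 3, 0] := by
  have hBs : ∀ k l, B k l = -B l k := fun k l => congrFun (congrFun hB l) k
  ext i j
  fin_cases i <;> fin_cases j <;> simp <;> linarith [hBs 0 0, hBs 1 1, hBs 2 2, hBs 3 3, hBs 1 0,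
    hBs 2 0, hBs 3 0, hBs 2 1, hBs 3 1, hBs 3 2]

lemma det_fin_four (L : Matrix (Fin 4) (Fin 4) ℝ) :
    L.det = L 0 0 * (L 1 1 * (L 2 2 * L 3 3 - L 2 3 * L 3 2) - L 1 2 * (L 2 1 * L 3 3 - L 2 3 * L 3 1)
        + L 1 3 * (L 2 1 * L 3 2 - L 2 2 * L 3 1))
      - L 0 1 * (L 1 0 * (L 2 2 * L 3 3 - L 2 3 * L 3 2) - L 1 2 * (L 2 0 * L 3 3 - L 2 3 * L 3 0)
        + L 1 3 * (L 2 0 * L 3 2 - L 2 2 * L 3 0))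
      + L 0 2 * (L 1 0 * (L 2 1 * L 3 3 - L 2 3 * L 3 1) - L 1 1 * (L 2 0 * L 3 3 - L 2 3 * L 3 0)
        + L 1 3 * (L 2 0 * L 3 1 - L 2 1 * L 3 0))
      - L 0 3 * (L 1 0 * (L 2 1 * L 3 2 - L 2 2 * L 3 1) - L 1 1 * (L 2 0 * L 3 2 - L 2 2 * L 3 0)
        + L 1 2 * (L 2 0 * L 3 1 - L 2 1 * L 3 0)) := by
  rw [Matrix.det_succ_row_zero]
  simp only [Fin.sum_univ_four, Matrix.det_fin_three, Matrix.submatrix_apply]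
  simp [Fin.succAbove, Fin.lt_def]
  ring

/-- This is ε_{abcd} L^a_i L^b_j L^c_k L^d_l = det L · ε_{ijkl}, contracted with B. -/
lemma dual_conj {B : Matrix (Fin 4) (Fin 4) ℝ} (hB : Bᵀ = -B) (L : Matrix (Fin 4) (Fin 4) ℝ) :
    Lᵀ * dual (L * B * Lᵀ) * L = L.det • dual B := by
  rw [antisymm_eta hB]
  generalize B 0 1 = b01
  generalize B 0 2 = b02
  generalize B 0 3 = b03
  generalize B 1 2 = b12
  generalize B 1 3 = b13
  generalize B 2 3 = b23
  rw [det_fin_four]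
  ext i j
  fin_cases i <;> fin_cases j <;>
    simp [dual, Matrix.mul_apply, Fin.sum_univ_four] <;> ring

lemma dual_dual {B : Matrix (Fin 4) (Fin 4) ℝ} (hB : Bᵀ = -B) : dual (dual B) = B := by
  rw [antisymm_eta hB]
  ext i j; fin_cases i <;> fin_cases j <;> simp [dual]

lemma dual_transpose (B : Matrix (Fin 4) (Fin 4) ℝ) : (dual B)ᵀ = -dual B := by
  ext i j; simpa using dual_antisymm B j i

/-- The Hodge dual of two-forms is natural and conformally invariant. -/
lemma hodgeMat_conj {G F L : Matrix (Fin 4) (Fin 4) ℝ} {e c : ℝ} (hF : Fᵀ = -F) (hc : c ≠ 0)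
    (hL : L.det ≠ 0) :
    hodgeMat (c • (Lᵀ * G * L)) (c ^ 2 * L.det * e) (Lᵀ * F * L) = Lᵀ * hodgeMat G e F * L := by
  have hLu : IsUnit L.det := isUnit_iff_ne_zero.2 hL
  set B := G⁻¹ * F * G⁻¹ᵀ with hB
  have hBt : Bᵀ = -B := conj_antisymm hF _
  set C := L⁻¹ * B * L⁻¹ᵀ with hC
  have hCt : Cᵀ = -C := conj_antisymm hBt _
  have hLL : L * L⁻¹ = 1 := Matrix.mul_nonsing_inv _ hLu
  have hLLt : L⁻¹ᵀ * Lᵀ = 1 := by rw [← Matrix.transpose_mul, hLL, Matrix.transpose_one]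
  have hinv : (c • (Lᵀ * G * L))⁻¹ = c⁻¹ • (L⁻¹ * G⁻¹ * L⁻¹ᵀ) := by
    by_cases hG : IsUnit G.det
    · apply Matrix.inv_eq_right_inv
      rw [Matrix.smul_mul, Matrix.mul_smul, smul_smul, mul_inv_cancel₀ hc, one_smul]
      calc Lᵀ * G * L * (L⁻¹ * G⁻¹ * L⁻¹ᵀ) = Lᵀ * (G * (L * L⁻¹) * G⁻¹) * L⁻¹ᵀ := by
            simp only [Matrix.mul_assoc]
        _ = 1 := by
            rw [hLL, Matrix.mul_one, Matrix.mul_nonsing_inv _ hG, Matrix.mul_one,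
              ← Matrix.transpose_mul, Matrix.nonsing_inv_mul _ hLu, Matrix.transpose_one]
    -- For singular G both inverses are zero by convention.
    · rw [Matrix.nonsing_inv_apply_not_isUnit _ hG, Matrix.nonsing_inv_apply_not_isUnit]
      · simp
      · simpa [Matrix.det_smul, Matrix.det_mul, hc, hL] using hG
  have h1 : (c • (Lᵀ * G * L))⁻¹ * (Lᵀ * F * L) * (c • (Lᵀ * G * L))⁻¹ᵀ = (c⁻¹) ^ 2 • C := by
    rw [hinv, Matrix.transpose_smul, Matrix.smul_mul, Matrix.mul_smul, Matrix.smul_mul, smul_smul,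
      ← sq]
    congr 1
    rw [Matrix.transpose_mul, Matrix.transpose_mul, Matrix.transpose_transpose]
    calc L⁻¹ * G⁻¹ * L⁻¹ᵀ * (Lᵀ * F * L) * (L⁻¹ * (G⁻¹ᵀ * L⁻¹ᵀ))
        = L⁻¹ * G⁻¹ * (L⁻¹ᵀ * Lᵀ) * F * (L * L⁻¹) * G⁻¹ᵀ * L⁻¹ᵀ := by
          simp only [Matrix.mul_assoc]
      _ = C := by rw [hLL, hLLt, hC, hB]; simp only [Matrix.mul_one, Matrix.mul_assoc]
  have h2 : L * C * Lᵀ = B := by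
    calc L * C * Lᵀ = (L * L⁻¹) * B * (L⁻¹ᵀ * Lᵀ) := by rw [hC]; simp only [Matrix.mul_assoc]
      _ = B := by rw [hLL, hLLt, Matrix.mul_one, Matrix.one_mul]
  -- The two inverse metrics contribute c⁻², cancelling the c² of the volume: this is the conformal
  -- invariance. The remaining det L is the one supplied by `dual_conj`.
  rw [hodgeMat, hodgeMat, h1, ← hB, ← h2, smul_smul, dual_smul, dual_smul, Matrix.mul_smul,
    Matrix.smul_mul, dual_conj hCt, smul_smul]
  congr 1
  field_simp

/-- The sign is that of e² / det G, that is, the Lorentzian signature. -/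
lemma hodgeMat_hodgeMat {G F : Matrix (Fin 4) (Fin 4) ℝ} {e : ℝ} (hF : Fᵀ = -F) (hG : Gᵀ = G)
    (h0 : G.det ≠ 0) (he : e ^ 2 = -G.det) : hodgeMat G e (hodgeMat G e F) = -F := by
  have hGi : G⁻¹ᵀ = G⁻¹ := by rw [Matrix.transpose_nonsing_inv, hG]
  have h1 := dual_conj hF G⁻¹
  rw [hGi] at h1
  rw [hodgeMat, hodgeMat, hGi, dual_smul, dual_smul, Matrix.mul_smul, Matrix.smul_mul, h1,
    smul_smul, dual_smul, dual_dual hF, smul_smul, Matrix.det_nonsing_inv,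
    Ring.inverse_eq_inv', ← mul_assoc, ← sq, he, neg_mul, mul_inv_cancel₀ h0, neg_one_smul]

/-- The Pfaffian of an antisymmetric matrix. -/
def pf (F : Matrix (Fin 4) (Fin 4) ℝ) : ℝ := F 0 1 * F 2 3 - F 0 2 * F 1 3 + F 0 3 * F 1 2

lemma pf_conj {B : Matrix (Fin 4) (Fin 4) ℝ} (hB : Bᵀ = -B) (L : Matrix (Fin 4) (Fin 4) ℝ) :
    pf (L * B * Lᵀ) = L.det * pf B := by
  rw [antisymm_eta hB]
  generalize B 0 1 = b01
  generalize B 0 2 = b02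
  generalize B 0 3 = b03
  generalize B 1 2 = b12
  generalize B 1 3 = b13
  generalize B 2 3 = b23
  rw [det_fin_four]
  simp [pf, Matrix.mul_apply, Fin.sum_univ_four]
  ring

/-- Dualising multiplies the Pfaffian by e² det G⁻¹ = −1. In invariant terms F∧F + ⋆F∧⋆F = 0. -/
lemma pf_add_pf_hodgeMat {G F : Matrix (Fin 4) (Fin 4) ℝ} {e : ℝ} (hF : Fᵀ = -F)
    (h0 : G.det ≠ 0) (he : e ^ 2 = -G.det) : pf F + pf (hodgeMat G e F) = 0 := by
  have h1 : pf (hodgeMat G e F) = e ^ 2 * pf (G⁻¹ * F * G⁻¹ᵀ) := by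
    simp [pf, hodgeMat, dual]; ring
  rw [h1, pf_conj hF, Matrix.det_nonsing_inv, Ring.inverse_eq_inv', he]
  field_simp
  ring

/-- `i_v F ∧ F = ½ i_v (F ∧ F)`. -/
lemma contract_wedge {F : Matrix (Fin 4) (Fin 4) ℝ} (hF : Fᵀ = -F) (v : Fin 4 → ℝ)
    (a b c : Fin 4) :
    (∑ i, v i * F i a) * F b c + (∑ i, v i * F i b) * F c a + (∑ i, v i * F i c) * F a b
      = pf F * ∑ d, v d * eps d a b c := by
  rw [antisymm_eta hF]
  generalize F 0 1 = b01
  generalize F 0 2 = b02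
  generalize F 0 3 = b03
  generalize F 1 2 = b12
  generalize F 1 3 = b13
  generalize F 2 3 = b23
  simp only [Fin.sum_univ_four]
  fin_cases a <;> fin_cases b <;> fin_cases c <;> simp [pf, eps] <;> ring

/-! ## The transformation in local coordinates -/

/-- The Killing form `∇X + i ⋆∇X`. -/
def selfDual (G : E4 → Matrix (Fin 4) (Fin 4) ℝ) (e : E4 → ℝ) (X : E4 → Fin 4 → ℝ) (x : E4)
    (i j : Fin 4) : ℂ :=
  (nablaLower G X x i j : ℂ) + Complex.I * (IsMetricRegion.hodgeNabla G e X x i j : ℂ)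

/-- A metric region with Killing vector `X`, closed Killing form and Ernst potential `s`. -/
structure IsErnstRegion (O : Set E4) (G : E4 → Matrix (Fin 4) (Fin 4) ℝ) (e : E4 → ℝ)
    (X : E4 → Fin 4 → ℝ) (s : E4 → ℂ) : Prop extends IsMetricRegion O G e X where
  killing : ∀ x ∈ O, ∀ i j, lieMetric G X x i j = 0
  closed : ∀ x ∈ O, ∀ a b c, pd a (fun y => IsMetricRegion.hodgeNabla G e X y b c) x
    + pd b (fun y => IsMetricRegion.hodgeNabla G e X y c a) x
    + pd c (fun y => IsMetricRegion.hodgeNabla G e X y a b) x = 0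
  potential : ∀ x ∈ O, ContDiffAt ℝ ∞ s x
  re_eq : ∀ x ∈ O, (s x).re = -∑ i, lower G X x i * X x i
  grad : ∀ x ∈ O, ∀ j, pd j s x = 2 * ∑ i, (X x i : ℂ) * selfDual G e X x i j

/-- A solution `W` of the Ehlers equations on a region of `ℝ⁴`. -/
structure IsEhlersRegionForm (O : Set E4) (G : E4 → Matrix (Fin 4) (Fin 4) ℝ) (e : E4 → ℝ)
    (X : E4 → Fin 4 → ℝ) (s : E4 → ℂ) (γ δ : ℝ) (W : E4 → Fin 4 → ℝ) : Prop where
  smooth : ∀ x ∈ O, ∀ i, ContDiffAt ℝ ∞ (fun y => W y i) x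
  curl : ∀ x ∈ O, ∀ i j, pd i (fun y => W y j) x - pd j (fun y => W y i) x =
    (-4 * γ * (γ * (starRingEnd ℂ) (s x) + Complex.I * δ) * selfDual G e X x i j).re
  norm : ∀ x ∈ O, ∑ i, W x i * X x i + 1 = Complex.normSq (factor γ δ (s x))

/-! ### The factor iγσ + δ, the Möbius map and their derivatives -/

lemma conj_factor (γ δ : ℝ) (s : ℂ) :
    (starRingEnd ℂ) (factor γ δ s) = -Complex.I * γ * (starRingEnd ℂ) s + δ := by
  simp [factor]

/-- Since γσ̄ + iδ = i f̄, the curl equation depends on σ and δ only through f. -/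
lemma coeff_eq (γ δ : ℝ) (s : ℂ) :
    -4 * (γ : ℂ) * (γ * (starRingEnd ℂ) s + Complex.I * δ)
      = -4 * γ * Complex.I * (starRingEnd ℂ) (factor γ δ s) := by
  rw [conj_factor]
  linear_combination -4 * (γ : ℂ) * γ * (starRingEnd ℂ) s * Complex.I_sq

/-- Multiplying the numerator by f̄ and taking the real part leaves Re σ times the determinant αδ +
βγ. This is why λ' = λ/Ω². -/
lemma re_moebius {α β γ δ : ℝ} (h : α * δ + β * γ = 1) (s : ℂ) :
    ((α * s + Complex.I * β) / factor γ δ s).re = s.re / Complex.normSq (factor γ δ s) := by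
  rw [Complex.div_re, ← add_div]
  congr 1
  simp [factor]
  linear_combination s.re * h

lemma contDiffAt_factor {s : E4 → ℂ} {x : E4} (hs : ContDiffAt ℝ ∞ s x) (γ δ : ℝ) :
    ContDiffAt ℝ ∞ (fun y => factor γ δ (s y)) x :=
  (contDiffAt_const.mul hs).add contDiffAt_const

lemma pd_factor {s : E4 → ℂ} {x : E4} (hs : ContDiffAt ℝ ∞ s x) (γ δ : ℝ) (i : Fin 4) :
    pd i (fun y => factor γ δ (s y)) x = Complex.I * γ * pd i s x := by
  simp only [factor]
  rw [pd_add (contDiffAt_const.mul hs) contDiffAt_const, pd_const_mul _ hs, pd_const, add_zero]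

lemma contDiffAt_conj {s : E4 → ℂ} {x : E4} (hs : ContDiffAt ℝ ∞ s x) :
    ContDiffAt ℝ ∞ (fun y => (starRingEnd ℂ) (s y)) x :=
  Complex.conjCLE.contDiff.contDiffAt.comp x hs

lemma contDiffAt_re {s : E4 → ℂ} {x : E4} (hs : ContDiffAt ℝ ∞ s x) :
    ContDiffAt ℝ ∞ (fun y => (s y).re) x :=
  Complex.reCLM.contDiff.contDiffAt.comp x hs

lemma contDiffAt_ofReal {s : E4 → ℝ} {x : E4} (hs : ContDiffAt ℝ ∞ s x) :
    ContDiffAt ℝ ∞ (fun y => (s y : ℂ)) x :=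
  Complex.ofRealCLM.contDiff.contDiffAt.comp x hs

lemma normSq_eq_re (z : ℂ) : Complex.normSq z = (z * (starRingEnd ℂ) z).re := by
  rw [Complex.mul_conj, Complex.ofReal_re]

lemma contDiffAt_normSq {s : E4 → ℂ} {x : E4} (hs : ContDiffAt ℝ ∞ s x) :
    ContDiffAt ℝ ∞ (fun y => Complex.normSq (s y)) x := by
  simp only [normSq_eq_re]
  exact contDiffAt_re (hs.mul (contDiffAt_conj hs))

lemma pd_normSq {s : E4 → ℂ} {x : E4} (hs : ContDiffAt ℝ ∞ s x) (i : Fin 4) :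
    pd i (fun y => Complex.normSq (s y)) x = 2 * ((starRingEnd ℂ) (s x) * pd i s x).re := by
  simp only [normSq_eq_re]
  rw [pd_re (hs.mul (contDiffAt_conj hs)), pd_mul hs (contDiffAt_conj hs), pd_conj hs]
  simp; ring

lemma pd_moebius {α β γ δ : ℝ} (h : α * δ + β * γ = 1) {s : E4 → ℂ} {x : E4}
    (hs : ContDiffAt ℝ ∞ s x) (h0 : factor γ δ (s x) ≠ 0) (i : Fin 4) :
    pd i (fun y => (α * s y + Complex.I * β) / factor γ δ (s y)) x
      = pd i s x / factor γ δ (s x) ^ 2 := by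
  have hf := contDiffAt_factor hs γ δ
  have hn : ContDiffAt ℝ ∞ (fun y => α * s y + Complex.I * β) x :=
    (contDiffAt_const.mul hs).add contDiffAt_const
  have hi : ContDiffAt ℝ ∞ (fun y => (factor γ δ (s y))⁻¹) x := hf.inv h0
  simp only [div_eq_mul_inv]
  rw [pd_mul hn hi, pd_inv hf h0, pd_factor hs,
    pd_add (contDiffAt_const.mul hs) contDiffAt_const, pd_const_mul _ hs, pd_const]
  have hc : (α * δ + β * γ : ℂ) = 1 := by exact_mod_cast h
  field_simp
  rw [factor]
  linear_combination pd i s x * hc - pd i s x * β * γ * Complex.I_sq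

/-- The endomorphism `1 - n⁻¹ X ⊗ W`. -/
def shear (n : ℝ) (X W : Fin 4 → ℝ) : Matrix (Fin 4) (Fin 4) ℝ :=
  Matrix.of fun k j => (1 : Matrix (Fin 4) (Fin 4) ℝ) k j - n⁻¹ * X k * W j

lemma det_shear (n : ℝ) (X W : Fin 4 → ℝ) : (shear n X W).det = 1 - n⁻¹ * ∑ i, W i * X i := by
  rw [det_fin_four]
  simp [shear, Fin.sum_univ_four]
  ring

lemma conj_shear_apply (n : ℝ) (X W : Fin 4 → ℝ) (A : Matrix (Fin 4) (Fin 4) ℝ) (i j : Fin 4) :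
    ((shear n X W)ᵀ * A * shear n X W) i j = A i j - n⁻¹ * W i * (∑ k, X k * A k j)
      - n⁻¹ * W j * (∑ k, A i k * X k)
      + n⁻¹ ^ 2 * W i * W j * (∑ k, (∑ l, A k l * X l) * X k) := by
  have h1 : ∀ l, ((shear n X W)ᵀ * A) i l = A i l - n⁻¹ * W i * ∑ k, X k * A k l := by
    intro l
    simp only [Matrix.mul_apply, Matrix.transpose_apply, shear, Matrix.of_apply, sub_mul,
      Finset.sum_sub_distrib, Matrix.one_apply, ite_mul, one_mul, zero_mul,
      Finset.sum_ite_eq', Finset.mem_univ, if_true, Finset.mul_sum]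
    congr 1
    exact Finset.sum_congr rfl fun k _ => by ring
  rw [Matrix.mul_apply]
  simp only [h1]
  simp only [shear, Matrix.of_apply, mul_sub, Finset.sum_sub_distrib, Matrix.one_apply, mul_ite,
    mul_one, mul_zero, Finset.sum_ite_eq', Finset.mem_univ, if_true]
  simp only [Fin.sum_univ_four]
  ring

/-- The regions, metrics, volume forms and the one-form entering an Ehlers transformation. -/
structure IsTransformRegion (O : Set E4) (G : E4 → Matrix (Fin 4) (Fin 4) ℝ) (e : E4 → ℝ)
    (X : E4 → Fin 4 → ℝ) (s : E4 → ℂ) (α β γ δ : ℝ) (W : E4 → Fin 4 → ℝ) (O' : Set E4)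
    (G' : E4 → Matrix (Fin 4) (Fin 4) ℝ) (e' : E4 → ℝ) : Prop where
  base : IsErnstRegion O G e X s
  form : IsEhlersRegionForm O G e X s γ δ W
  det_eq : α * δ + β * γ = 1
  isOpen : IsOpen O'
  subset : O' ⊆ O
  factor_ne : ∀ x ∈ O', factor γ δ (s x) ≠ 0
  metric : ∀ x ∈ O', ∀ i j, G' x i j = Complex.normSq (factor γ δ (s x)) * G x i j
    - lower G X x i * W x j - lower G X x j * W x i
    - (s x).re / Complex.normSq (factor γ δ (s x)) * (W x i * W x j)
  volume : ∀ x ∈ O', e' x = Complex.normSq (factor γ δ (s x)) * e x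

/-! ### Identities satisfied by the original data -/

namespace IsErnstRegion

variable {O : Set E4} {G : E4 → Matrix (Fin 4) (Fin 4) ℝ} {e : E4 → ℝ} {X : E4 → Fin 4 → ℝ}
  {s : E4 → ℂ} {x : E4}

lemma of_nablaLower_transpose (h : IsErnstRegion O G e X s) (hx : x ∈ O) :
    (Matrix.of (nablaLower G X x))ᵀ = -Matrix.of (nablaLower G X x) := by
  ext a b; simpa using h.nablaLower_antisymm h.killing hx b a

lemma selfDual_antisymm (h : IsErnstRegion O G e X s) (hx : x ∈ O) (i j : Fin 4) :
    selfDual G e X x i j = -selfDual G e X x j i := by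
  simp only [selfDual, IsMetricRegion.hodgeNabla]
  rw [h.nablaLower_antisymm h.killing hx i j, dual_antisymm _ i j]
  push_cast; ring

lemma sum_field_mul_grad (h : IsErnstRegion O G e X s) (hx : x ∈ O) :
    ∑ k, (X x k : ℂ) * pd k s x = 0 := by
  have hK := h.selfDual_antisymm hx
  have h0 := fun i => hK i i
  simp only [h.grad x hx, Fin.sum_univ_four, hK 1 0, hK 2 0, hK 3 0, hK 2 1, hK 3 1, hK 3 2]
  linear_combination (X x 0) ^ 2 * h0 0 + (X x 1) ^ 2 * h0 1 + (X x 2) ^ 2 * h0 2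
    + (X x 3) ^ 2 * h0 3

/-- `£_X` annihilates the one-form `X_i`. -/
lemma lie_lower (h : IsErnstRegion O G e X s) (hx : x ∈ O) (i : Fin 4) :
    ∑ k, (X x k * pd k (fun y => lower G X y i) x
      + lower G X x k * pd i (fun y => X y k) x) = 0 := by
  have h1 : ∑ l, X x l * lieMetric G X x i l = 0 := by simp [h.killing x hx]
  rw [← h1]
  simp only [h.pd_lower hx]
  simp only [lower, lieMetric, Fin.sum_univ_four]
  have hs := h.symm x hx
  rw [hs 1 0, hs 2 0, hs 3 0, hs 2 1, hs 3 1, hs 3 2]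
  ring

lemma closed_nablaLower (h : IsErnstRegion O G e X s) (hx : x ∈ O) (a b c : Fin 4) :
    pd a (fun y => nablaLower G X y b c) x + pd b (fun y => nablaLower G X y c a) x
      + pd c (fun y => nablaLower G X y a b) x = 0 := by
  have hl := fun i => h.contDiffAt_lower hx i
  have h1 : ∀ a b c, pd a (fun y => nablaLower G X y b c) x
      = 1 / 2 * (pd a (pd b fun y => lower G X y c) x - pd a (pd c fun y => lower G X y b) x) := by
    intro a b c
    rw [pd_congr h.isOpen hx (fun y hy => h.nablaLower_eq_curl h.killing hy b c),
      pd_const_mul _ ((contDiffAt_pd (hl c) b).sub (contDiffAt_pd (hl b) c)),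
      pd_sub (contDiffAt_pd (hl c) b) (contDiffAt_pd (hl b) c)]
  rw [h1, h1, h1, pd_comm (hl c) a b, pd_comm (hl b) a c, pd_comm (hl a) b c]
  ring

lemma contDiffAt_selfDual (h : IsErnstRegion O G e X s) (hx : x ∈ O) (i j : Fin 4) :
    ContDiffAt ℝ ∞ (fun y => selfDual G e X y i j) x :=
  (contDiffAt_ofReal (h.contDiffAt_nablaLower hx i j)).add
    (contDiffAt_const.mul (contDiffAt_ofReal (h.contDiffAt_hodgeNabla hx i j)))

lemma pd_selfDual (h : IsErnstRegion O G e X s) (hx : x ∈ O) (a i j : Fin 4) :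
    pd a (fun y => selfDual G e X y i j) x = ((pd a (fun y => nablaLower G X y i j) x : ℝ) : ℂ)
      + Complex.I * ((pd a (fun y => IsMetricRegion.hodgeNabla G e X y i j) x : ℝ) : ℂ) := by
  have h1 := h.contDiffAt_nablaLower hx i j
  have h2 := h.contDiffAt_hodgeNabla hx i j
  simp only [selfDual]
  rw [pd_add (contDiffAt_ofReal h1) (contDiffAt_const.mul (contDiffAt_ofReal h2)), pd_ofReal h1,
    pd_const_mul _ (contDiffAt_ofReal h2), pd_ofReal h2]

lemma closed_selfDual (h : IsErnstRegion O G e X s) (hx : x ∈ O) (a b c : Fin 4) :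
    pd a (fun y => selfDual G e X y b c) x + pd b (fun y => selfDual G e X y c a) x
      + pd c (fun y => selfDual G e X y a b) x = 0 := by
  have h1 : ((_ : ℝ) : ℂ) = ((0 : ℝ) : ℂ) := congrArg _ (h.closed_nablaLower hx a b c)
  have h2 : ((_ : ℝ) : ℂ) = ((0 : ℝ) : ℂ) := congrArg _ (h.closed x hx a b c)
  push_cast at h1 h2
  rw [h.pd_selfDual hx, h.pd_selfDual hx, h.pd_selfDual hx]
  linear_combination h1 + Complex.I * h2

/-- `dσ̄ ∧ 𝓕 + dσ ∧ 𝓕̄ = 0`. -/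
lemma wedge_conj (h : IsErnstRegion O G e X s) (hx : x ∈ O) (a b c : Fin 4) :
    ((starRingEnd ℂ) (pd a s x) * selfDual G e X x b c
        + pd a s x * (starRingEnd ℂ) (selfDual G e X x b c))
      + ((starRingEnd ℂ) (pd b s x) * selfDual G e X x c a
        + pd b s x * (starRingEnd ℂ) (selfDual G e X x c a))
      + ((starRingEnd ℂ) (pd c s x) * selfDual G e X x a b
        + pd c s x * (starRingEnd ℂ) (selfDual G e X x a b)) = 0 := by
  set F := Matrix.of (nablaLower G X x) with hF
  have hFt : Fᵀ = -F := h.of_nablaLower_transpose hx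
  set H := IsMetricRegion.hodgeNabla G e X x with hH
  have hHt : Hᵀ = -H := dual_transpose _
  have hpf : pf F + pf H = 0 := pf_add_pf_hodgeMat hFt (h.det_ne x hx) (h.sq_volume x hx)
  have h1 := contract_wedge hFt (X x) a b c
  have h2 := contract_wedge hHt (X x) a b c
  -- Each bracket is a complex number plus its conjugate, hence real. With dσ = 2(u + iv) it is four
  -- times u F + v H, so the cyclic sum is governed by the two Pfaffians, which cancel.
  have h3 : ∀ a b c, (starRingEnd ℂ) (pd a s x) * selfDual G e X x b c
        + pd a s x * (starRingEnd ℂ) (selfDual G e X x b c)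
      = ((4 * ((∑ i, X x i * F i a) * F b c + (∑ i, X x i * H i a) * H b c) : ℝ) : ℂ) := by
    intro a b c
    have h4 : pd a s x = 2 * ((∑ i, X x i * F i a : ℝ) + Complex.I * (∑ i, X x i * H i a : ℝ)) := by
      rw [h.grad x hx]
      push_cast
      rw [Finset.mul_sum Finset.univ _ Complex.I, ← Finset.sum_add_distrib]
      congr 1
      refine Finset.sum_congr rfl fun i _ => ?_
      simp only [selfDual, hF, hH, Matrix.of_apply]; ring
    have h5 : selfDual G e X x b c = (F b c : ℂ) + Complex.I * (H b c : ℂ) := rfl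
    rw [h4, h5]
    generalize (∑ i, X x i * F i a) = u
    generalize (∑ i, X x i * H i a) = v
    simp only [map_add, map_mul, Complex.conj_ofReal, Complex.conj_I, map_ofNat]
    push_cast
    linear_combination -4 * (v : ℂ) * (H b c : ℂ) * Complex.I_sq
  rw [h3, h3, h3, ← Complex.ofReal_add, ← Complex.ofReal_add, Complex.ofReal_eq_zero]
  linear_combination 4 * h1 + 4 * h2 + 4 * (∑ d, X x d * eps d a b c) * hpf

end IsErnstRegion

/-- `(Ω² 𝓕 - ½ W ∧ dσ) / f²`, where `Ω² = |f|²`, `f = iγσ + δ`. -/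
def selfDualTransform (G : E4 → Matrix (Fin 4) (Fin 4) ℝ) (e : E4 → ℝ)
    (X : E4 → Fin 4 → ℝ) (s : E4 → ℂ) (γ δ : ℝ) (W : E4 → Fin 4 → ℝ) (x : E4) (i j : Fin 4) : ℂ :=
  (factor γ δ (s x))⁻¹ ^ 2 * (factor γ δ (s x) * (starRingEnd ℂ) (factor γ δ (s x))
      * selfDual G e X x i j
    - 1 / 2 * ((W x i : ℂ) * pd j s x - (W x j : ℂ) * pd i s x))

/-! ### The new metric, its Killing vector and its Killing form -/

namespace IsTransformRegion

variable {O : Set E4} {G : E4 → Matrix (Fin 4) (Fin 4) ℝ} {e : E4 → ℝ} {X : E4 → Fin 4 → ℝ}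
  {s : E4 → ℂ} {α β γ δ : ℝ} {W : E4 → Fin 4 → ℝ} {O' : Set E4}
  {G' : E4 → Matrix (Fin 4) (Fin 4) ℝ} {e' : E4 → ℝ} {x : E4}

lemma normSq_ne (h : IsTransformRegion O G e X s α β γ δ W O' G' e') (hx : x ∈ O') :
    Complex.normSq (factor γ δ (s x)) ≠ 0 := by
  simpa using h.factor_ne x hx

lemma contDiffAt_omega (h : IsTransformRegion O G e X s α β γ δ W O' G' e') (hx : x ∈ O') :
    ContDiffAt ℝ ∞ (fun y => Complex.normSq (factor γ δ (s y))) x :=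
  contDiffAt_normSq (contDiffAt_factor (h.base.potential x (h.subset hx)) γ δ)

lemma contDiffAt_ratio (h : IsTransformRegion O G e X s α β γ δ W O' G' e') (hx : x ∈ O') :
    ContDiffAt ℝ ∞ (fun y => (s y).re / Complex.normSq (factor γ δ (s y))) x :=
  (contDiffAt_re (h.base.potential x (h.subset hx))).div (h.contDiffAt_omega hx) (h.normSq_ne hx)

lemma pd_omega (h : IsTransformRegion O G e X s α β γ δ W O' G' e') (hx : x ∈ O') (i : Fin 4) :
    pd i (fun y => Complex.normSq (factor γ δ (s y))) x
      = 2 * ((starRingEnd ℂ) (factor γ δ (s x)) * (Complex.I * γ * pd i s x)).re := by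
  rw [pd_normSq (contDiffAt_factor (h.base.potential x (h.subset hx)) γ δ),
    pd_factor (h.base.potential x (h.subset hx))]

lemma contDiffAt_moebius (h : IsTransformRegion O G e X s α β γ δ W O' G' e') (hx : x ∈ O') :
    ContDiffAt ℝ ∞ (fun y => (α * s y + Complex.I * β) / factor γ δ (s y)) x := by
  have hs := h.base.potential x (h.subset hx)
  have hi : ContDiffAt ℝ ∞ (fun y => (factor γ δ (s y))⁻¹) x :=
    (contDiffAt_factor hs γ δ).inv (h.factor_ne x hx)
  simp only [div_eq_mul_inv]
  exact ((contDiffAt_const.mul hs).add contDiffAt_const).mul hi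

lemma pd_ratio (h : IsTransformRegion O G e X s α β γ δ W O' G' e') (hx : x ∈ O') (i : Fin 4) :
    pd i (fun y => (s y).re / Complex.normSq (factor γ δ (s y))) x
      = (pd i s x / factor γ δ (s x) ^ 2).re := by
  simp only [← re_moebius h.det_eq]
  rw [pd_re (h.contDiffAt_moebius hx),
    pd_moebius h.det_eq (h.base.potential x (h.subset hx)) (h.factor_ne x hx)]

/-- Expanding the conjugation, the term in W ⊗ W has coefficient Ω²·Ω⁻⁴·g(ξ, ξ) = −λ/Ω².
Determinant, volume and Hodge star of the new metric all follow from this factorisation. -/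
lemma metric_eq_conj (h : IsTransformRegion O G e X s α β γ δ W O' G' e') (hx : x ∈ O') :
    G' x = Complex.normSq (factor γ δ (s x)) •
      ((shear (Complex.normSq (factor γ δ (s x))) (X x) (W x))ᵀ * G x
        * shear (Complex.normSq (factor γ δ (s x))) (X x) (W x)) := by
  ext i j
  have h1 : ∀ j, ∑ k, X x k * G x k j = lower G X x j := fun j =>
    Finset.sum_congr rfl fun k _ => by rw [h.base.symm x (h.subset hx) k j, mul_comm]
  have h2 : ∀ i, ∑ k, G x i k * X x k = lower G X x i := fun i => rfl
  rw [Matrix.smul_apply, conj_shear_apply, h.metric x hx, h1]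
  simp only [h2]
  have h3 := h.base.re_eq x (h.subset hx)
  have h4 := h.normSq_ne hx
  rw [h3, smul_eq_mul]
  field_simp
  ring

lemma det_shear_eq (h : IsTransformRegion O G e X s α β γ δ W O' G' e') (hx : x ∈ O') :
    (shear (Complex.normSq (factor γ δ (s x))) (X x) (W x)).det
      = (Complex.normSq (factor γ δ (s x)))⁻¹ := by
  have h1 := h.form.norm x (h.subset hx)
  have h4 := h.normSq_ne hx
  rw [det_shear, show ∑ i, W x i * X x i = Complex.normSq (factor γ δ (s x)) - 1 by linarith]
  field_simp
  ring

lemma isMetricRegion (h : IsTransformRegion O G e X s α β γ δ W O' G' e') :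
    IsMetricRegion O' G' e' X where
  isOpen := h.isOpen
  metric x hx i j := by
    have hl := fun i => h.base.contDiffAt_lower (h.subset hx) i
    have hW := h.form.smooth x (h.subset hx)
    refine ((((h.contDiffAt_omega hx).mul (h.base.metric x (h.subset hx) i j)).sub
      ((hl i).mul (hW j))).sub ((hl j).mul (hW i))).sub
      ((h.contDiffAt_ratio hx).mul ((hW i).mul (hW j))) |>.congr_of_eventuallyEq ?_
    exact Filter.eventually_of_mem (h.isOpen.mem_nhds hx) fun y hy => h.metric y hy i j
  symm x hx i j := by
    rw [h.metric x hx, h.metric x hx, h.base.symm x (h.subset hx) i j]; ring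
  volume x hx :=
    ((h.contDiffAt_omega hx).mul (h.base.volume x (h.subset hx))).congr_of_eventuallyEq
      (Filter.eventually_of_mem (h.isOpen.mem_nhds hx) fun y hy => h.volume y hy)
  sq_volume x hx := by
    have h4 := h.normSq_ne hx
    rw [h.volume x hx, h.metric_eq_conj hx, Matrix.det_smul, Matrix.det_mul, Matrix.det_mul,
      Matrix.det_transpose, h.det_shear_eq hx, mul_pow, h.base.sq_volume x (h.subset hx)]
    simp only [Fintype.card_fin]
    field_simp
  det_ne x hx := by
    have h4 := h.normSq_ne hx
    rw [h.metric_eq_conj hx, Matrix.det_smul, Matrix.det_mul, Matrix.det_mul,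
      Matrix.det_transpose, h.det_shear_eq hx]
    exact mul_ne_zero (pow_ne_zero _ h4) (mul_ne_zero (mul_ne_zero (inv_ne_zero h4)
      (h.base.det_ne x (h.subset hx))) (inv_ne_zero h4))
  field x hx := h.base.field x (h.subset hx)

/-- Insert W(ξ) = Ω² − 1 and g(ξ, ξ) = −λ: the coefficients of ξ_i collapse to 1 and those of W_i to
λ/Ω². The new field strength then requires only dξ♭, dW and d(λ/Ω²). -/
lemma lower_eq (h : IsTransformRegion O G e X s α β γ δ W O' G' e') (hx : x ∈ O') (i : Fin 4) :
    lower G' X x i = lower G X x i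
      + (s x).re / Complex.normSq (factor γ δ (s x)) * W x i := by
  have h1 := h.form.norm x (h.subset hx)
  have h3 := h.base.re_eq x (h.subset hx)
  have h4 := h.normSq_ne hx
  have h2 : lower G X x i = ∑ k, G x i k * X x k := rfl
  have h5 : lower G' X x i = Complex.normSq (factor γ δ (s x)) * lower G X x i
      - lower G X x i * (∑ k, W x k * X x k) - (∑ k, lower G X x k * X x k) * W x i
      - (s x).re / Complex.normSq (factor γ δ (s x)) * W x i * (∑ k, W x k * X x k) := by
    rw [show lower G' X x i = ∑ j, G' x i j * X x j from rfl]
    simp only [h.metric x hx]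
    nth_rewrite 2 [h2]
    simp only [Fin.sum_univ_four]
    ring
  rw [h5, show ∑ i, W x i * X x i = Complex.normSq (factor γ δ (s x)) - 1 by linarith,
    show ∑ i, lower G X x i * X x i = -(s x).re by linarith]
  field_simp
  ring

lemma re_eq (h : IsTransformRegion O G e X s α β γ δ W O' G' e') (hx : x ∈ O') :
    ((α * s x + Complex.I * β) / factor γ δ (s x)).re = -∑ i, lower G' X x i * X x i := by
  have h1 := h.form.norm x (h.subset hx)
  have h3 := h.base.re_eq x (h.subset hx)
  have h4 := h.normSq_ne hx
  simp only [re_moebius h.det_eq, h.lower_eq hx, add_mul, Finset.sum_add_distrib, mul_assoc,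
    ← Finset.mul_sum]
  rw [show ∑ i, W x i * X x i = Complex.normSq (factor γ δ (s x)) - 1 by linarith,
    show ∑ i, lower G X x i * X x i = -(s x).re by linarith]
  field_simp
  ring

lemma sum_field_mul_selfDual (h : IsTransformRegion O G e X s α β γ δ W O' G' e') (hx : x ∈ O')
    (i : Fin 4) : ∑ k, (X x k : ℂ) * selfDual G e X x k i = pd i s x / 2 := by
  rw [h.base.grad x (h.subset hx)]; ring

/-- `£_X` annihilates `W`. -/
lemma lie_form (h : IsTransformRegion O G e X s α β γ δ W O' G' e') (hx : x ∈ O') (i : Fin 4) :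
    ∑ k, (X x k * pd k (fun y => W y i) x + W x k * pd i (fun y => X y k) x) = 0 := by
  have hW := h.form.smooth x (h.subset hx)
  have hX := h.base.field x (h.subset hx)
  -- Cartan's formula £_X W = d(W(X)) + i_X dW. Here W(X) = |f|² − 1, and the curl equation gives
  -- i_X dW = −d|f|² because i_X 𝓕 = dσ/2.
  have h1 : ∑ k, (W x k * pd i (fun y => X y k) x + pd i (fun y => W y k) x * X x k)
      = 2 * ((starRingEnd ℂ) (factor γ δ (s x)) * (Complex.I * γ * pd i s x)).re := by
    rw [← h.pd_omega hx, pd_congr h.isOpen hx (fun y hy => (h.form.norm y (h.subset hy)).symm),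
      pd_add (ContDiffAt.sum fun k _ => (hW k).mul (hX k)) contDiffAt_const, pd_const, add_zero,
      pd_sum _ fun k => (hW k).mul (hX k)]
    refine Finset.sum_congr rfl fun k _ => ?_
    rw [pd_mul (hW k) (hX k)]; ring
  have h2 : ∑ k, X x k * (pd k (fun y => W y i) x - pd i (fun y => W y k) x)
      = (-4 * γ * Complex.I * (starRingEnd ℂ) (factor γ δ (s x)) * (pd i s x / 2)).re := by
    rw [← h.sum_field_mul_selfDual hx, Finset.mul_sum, Complex.re_sum]
    refine Finset.sum_congr rfl fun k _ => ?_
    rw [h.form.curl x (h.subset hx), coeff_eq, ← Complex.re_ofReal_mul]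
    congr 1; ring
  have h3 : (-4 * γ * Complex.I * (starRingEnd ℂ) (factor γ δ (s x)) * (pd i s x / 2)).re
      = -(2 * ((starRingEnd ℂ) (factor γ δ (s x)) * (Complex.I * γ * pd i s x)).re) := by
    rw [← Complex.re_ofReal_mul, ← Complex.neg_re]
    congr 1; push_cast; ring
  rw [h3, ← h1] at h2
  simp only [Fin.sum_univ_four] at h2 ⊢
  linarith

lemma sum_field_mul_omega (h : IsTransformRegion O G e X s α β γ δ W O' G' e') (hx : x ∈ O') :
    ∑ k, X x k * pd k (fun y => Complex.normSq (factor γ δ (s y))) x = 0 := by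
  have h1 : ∑ k, X x k * pd k (fun y => Complex.normSq (factor γ δ (s y))) x
      = (2 * (starRingEnd ℂ) (factor γ δ (s x)) * Complex.I * γ
        * ∑ k, (X x k : ℂ) * pd k s x).re := by
    rw [Finset.mul_sum, Complex.re_sum]
    refine Finset.sum_congr rfl fun k _ => ?_
    rw [h.pd_omega hx, ← Complex.re_ofReal_mul, ← Complex.re_ofReal_mul]
    congr 1; push_cast; ring
  rw [h1, h.base.sum_field_mul_grad (h.subset hx)]; simp

lemma sum_field_mul_ratio (h : IsTransformRegion O G e X s α β γ δ W O' G' e') (hx : x ∈ O') :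
    ∑ k, X x k * pd k (fun y => (s y).re / Complex.normSq (factor γ δ (s y))) x = 0 := by
  have h1 : ∑ k, X x k * pd k (fun y => (s y).re / Complex.normSq (factor γ δ (s y))) x
      = ((∑ k, (X x k : ℂ) * pd k s x) / factor γ δ (s x) ^ 2).re := by
    rw [Finset.sum_div, Complex.re_sum]
    refine Finset.sum_congr rfl fun k _ => ?_
    rw [h.pd_ratio hx, ← Complex.re_ofReal_mul, mul_div_assoc]
  rw [h1, h.base.sum_field_mul_grad (h.subset hx)]; simp

/-- X annihilates, by Lie derivative, each ingredient of T: the metric, its lowered self, W, Ω² and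
λ/Ω². The Leibniz rule does the rest. -/
lemma killing (h : IsTransformRegion O G e X s α β γ δ W O' G' e') (hx : x ∈ O') (i j : Fin 4) :
    lieMetric G' X x i j = 0 := by
  have hx' := h.subset hx
  have hW := h.form.smooth x hx'
  have hl := fun i => h.base.contDiffAt_lower hx' i
  have hn := h.contDiffAt_omega hx
  have hr := h.contDiffAt_ratio hx
  have hG := h.base.metric x hx'
  have hpd : ∀ k, pd k (fun y => G' y i j) x = _ := fun k => by
    rw [pd_congr h.isOpen hx (fun y hy => h.metric y hy i j),
      pd_sub (((hn.mul (hG i j)).sub ((hl i).mul (hW j))).sub ((hl j).mul (hW i)))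
        (hr.mul ((hW i).mul (hW j))),
      pd_sub ((hn.mul (hG i j)).sub ((hl i).mul (hW j))) ((hl j).mul (hW i)),
      pd_sub (hn.mul (hG i j)) ((hl i).mul (hW j)), pd_mul hn (hG i j), pd_mul (hl i) (hW j),
      pd_mul (hl j) (hW i), pd_mul hr ((hW i).mul (hW j)), pd_mul (hW i) (hW j)]
  have h1 := h.base.killing x hx' i j
  have h2 := h.sum_field_mul_omega hx
  have h3 := h.sum_field_mul_ratio hx
  have h4 := h.base.lie_lower hx' i
  have h5 := h.base.lie_lower hx' j
  have h6 := h.lie_form hx i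
  have h7 := h.lie_form hx j
  simp only [lieMetric, hpd, h.metric x hx] at h1 ⊢
  set n := Complex.normSq (factor γ δ (s x))
  set μ := (s x).re / n
  simp only [Fin.sum_univ_four] at h1 h2 h3 h4 h5 h6 h7 ⊢
  linear_combination n * h1 + G x i j * h2 - W x i * W x j * h3 - W x j * h4 - W x i * h5
    - (lower G X x j + μ * W x j) * h6 - (lower G X x i + μ * W x i) * h7

/-- Here ½ d(ξ♭ + μW) is expanded with μ = λ/Ω². Since μ is the real part of the Möbius image of σ,
its differential is Re(dσ/f²). -/
lemma nablaLower_eq (h : IsTransformRegion O G e X s α β γ δ W O' G' e') (hx : x ∈ O')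
    (i j : Fin 4) :
    nablaLower G' X x i j = (selfDualTransform G e X s γ δ W x i j).re := by
  have hx' := h.subset hx
  have hW := h.form.smooth x hx'
  have hl := fun i => h.base.contDiffAt_lower hx' i
  have hr := h.contDiffAt_ratio hx
  have hpd : ∀ i j, pd i (fun y => lower G' X y j) x = _ := fun i j => by
    rw [pd_congr h.isOpen hx (fun y hy => h.lower_eq hy j), pd_add (hl j) (hr.mul (hW j)),
      pd_mul hr (hW j), h.pd_ratio hx]
  have h1 := h.base.nablaLower_eq_curl h.base.killing hx' i j
  have h2 := h.form.curl x hx' i j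
  rw [coeff_eq] at h2
  rw [h.isMetricRegion.nablaLower_eq_curl (fun y hy => h.killing hy) hx, hpd, hpd]
  have hf := h.factor_ne x hx
  have h3 : selfDualTransform G e X s γ δ W x i j
      = selfDual G e X x i j + ((1 / 2 * ((s x).re / Complex.normSq (factor γ δ (s x))) : ℝ) : ℂ)
        * (-4 * γ * Complex.I * (starRingEnd ℂ) (factor γ δ (s x)) * selfDual G e X x i j)
        + ((1 / 2 * W x j : ℝ) : ℂ) * (pd i s x / factor γ δ (s x) ^ 2)
        - ((1 / 2 * W x i : ℝ) : ℂ) * (pd j s x / factor γ δ (s x) ^ 2) := by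
    have hc : (starRingEnd ℂ) (factor γ δ (s x)) ≠ 0 := by simpa using hf
    have h4 : ((s x).re : ℂ) = (s x + (starRingEnd ℂ) (s x)) / 2 := by
      rw [Complex.add_conj]; simp
    -- With 2λ = σ + σ̄ this gives 1 − 2iγλ/f = f̄/f, the phase in front of 𝓕.
    have h5 : (starRingEnd ℂ) (factor γ δ (s x))
        = factor γ δ (s x) - Complex.I * γ * (s x + (starRingEnd ℂ) (s x)) := by
      rw [conj_factor, factor]; ring
    push_cast
    rw [h4, ← Complex.mul_conj, selfDualTransform]
    field_simp
    rw [h5]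
    ring
  have h6 : (selfDual G e X x i j).re = nablaLower G X x i j := by simp [selfDual]
  rw [h3, Complex.sub_re, Complex.add_re, Complex.add_re, Complex.re_ofReal_mul,
    Complex.re_ofReal_mul, Complex.re_ofReal_mul, ← h2, h6, h1]
  ring

/-- Pulling 𝓕 back by L subtracts W ∧ i_X 𝓕 divided by Ω², where i_X 𝓕 = dσ/2; the double
contraction with X vanishes by antisymmetry. The existential lets the two matrix entries be handled
as plain real numbers. -/
lemma conj_shear_nabla (h : IsTransformRegion O G e X s α β γ δ W O' G' e') (hx : x ∈ O')
    (i j : Fin 4) : ∃ F H : ℝ,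
    F = ((shear (Complex.normSq (factor γ δ (s x))) (X x) (W x))ᵀ *
      Matrix.of (nablaLower G X x) * shear (Complex.normSq (factor γ δ (s x))) (X x) (W x)) i j ∧
    H = ((shear (Complex.normSq (factor γ δ (s x))) (X x) (W x))ᵀ *
      hodgeMat (G x) (e x) (Matrix.of (nablaLower G X x))
      * shear (Complex.normSq (factor γ δ (s x))) (X x) (W x)) i j ∧
    selfDualTransform G e X s γ δ W x i j
      = (starRingEnd ℂ) (factor γ δ (s x)) / factor γ δ (s x) * (F + Complex.I * H) := by
  have hx' := h.subset hx
  have hf := h.factor_ne x hx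
  have hc : (starRingEnd ℂ) (factor γ δ (s x)) ≠ 0 := by simpa using hf
  refine ⟨_, _, rfl, rfl, ?_⟩
  have hz : ∀ A : Matrix (Fin 4) (Fin 4) ℝ, (∀ i j, A i j = -A j i) →
      ∑ k, (∑ l, A k l * X x l) * X x k = 0 := by
    intro A hA
    simp only [Fin.sum_univ_four, hA 1 0, hA 2 0, hA 3 0, hA 2 1, hA 3 1, hA 3 2]
    linear_combination X x 0 ^ 2 / 2 * hA 0 0 + X x 1 ^ 2 / 2 * hA 1 1 + X x 2 ^ 2 / 2 * hA 2 2
      + X x 3 ^ 2 / 2 * hA 3 3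
  have hF : ∀ i j, Matrix.of (nablaLower G X x) i j = -Matrix.of (nablaLower G X x) j i :=
    fun i j => h.base.nablaLower_antisymm h.base.killing hx' i j
  have hH : ∀ i j, hodgeMat (G x) (e x) (Matrix.of (nablaLower G X x)) i j
      = -hodgeMat (G x) (e x) (Matrix.of (nablaLower G X x)) j i := dual_antisymm _
  have hswap : ∀ A : Matrix (Fin 4) (Fin 4) ℝ, (∀ i j, A i j = -A j i) → ∀ i,
      ∑ k, A i k * X x k = -∑ k, X x k * A k i := by
    intro A hA i
    rw [← Finset.sum_neg_distrib]
    exact Finset.sum_congr rfl fun k _ => by rw [hA i k]; ring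
  have hg : ∀ i, pd i s x = 2 * ((∑ k, X x k * Matrix.of (nablaLower G X x) k i : ℝ)
      + Complex.I * (∑ k, X x k * hodgeMat (G x) (e x) (Matrix.of (nablaLower G X x)) k i : ℝ)) := by
    intro i
    rw [h.base.grad x hx']
    push_cast
    rw [Finset.mul_sum Finset.univ _ Complex.I, ← Finset.sum_add_distrib]
    congr 1
    refine Finset.sum_congr rfl fun k _ => ?_
    rw [show selfDual G e X x k i = ((Matrix.of (nablaLower G X x) k i : ℝ) : ℂ) + Complex.I
      * (hodgeMat (G x) (e x) (Matrix.of (nablaLower G X x)) k i : ℂ) from rfl]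
    ring
  rw [conj_shear_apply, conj_shear_apply, hz _ hF, hz _ hH, hswap _ hF, hswap _ hH,
    selfDualTransform, hg, hg,
    show selfDual G e X x i j = ((Matrix.of (nablaLower G X x) i j : ℝ) : ℂ) + Complex.I
      * (hodgeMat (G x) (e x) (Matrix.of (nablaLower G X x)) i j : ℂ) from rfl]
  push_cast
  rw [← Complex.mul_conj]
  field_simp
  ring

/-- The new F is Lᵗ(Re z · F − Im z · ⋆F)L with z = f̄/f. Naturality moves the star inside L, and ⋆⋆
= −1 turns the bracket into Re z · ⋆F + Im z · F, the imaginary part of z𝓕. -/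
lemma hodgeNabla_eq (h : IsTransformRegion O G e X s α β γ δ W O' G' e') (hx : x ∈ O')
    (i j : Fin 4) : IsMetricRegion.hodgeNabla G' e' X x i j
      = (selfDualTransform G e X s γ δ W x i j).im := by
  have hx' := h.subset hx
  set n := Complex.normSq (factor γ δ (s x)) with hn
  have hn0 : n ≠ 0 := h.normSq_ne hx
  set L := shear n (X x) (W x) with hL
  have hLd : L.det = n⁻¹ := h.det_shear_eq hx
  set F := Matrix.of (nablaLower G X x) with hF
  set H := hodgeMat (G x) (e x) F with hH
  set z := (starRingEnd ℂ) (factor γ δ (s x)) / factor γ δ (s x) with hz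
  have hFt : Fᵀ = -F := h.base.of_nablaLower_transpose hx'
  have hHt : Hᵀ = -H := dual_transpose _
  have hGt : (G x)ᵀ = G x := by ext a b; exact h.base.symm x hx' b a
  have hHH : hodgeMat (G x) (e x) H = -F :=
    hodgeMat_hodgeMat hFt hGt (h.base.det_ne x hx') (h.base.sq_volume x hx')
  have hF' : Matrix.of (nablaLower G' X x) = Lᵀ * (z.re • F - z.im • H) * L := by
    ext a b
    obtain ⟨f, k, hf, hk, hfk⟩ := h.conj_shear_nabla hx a b
    rw [Matrix.of_apply, h.nablaLower_eq hx, hfk, Matrix.mul_sub, Matrix.sub_mul, Matrix.mul_smul,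
      Matrix.smul_mul, Matrix.mul_smul, Matrix.smul_mul, Matrix.sub_apply, Matrix.smul_apply,
      Matrix.smul_apply, ← hf, ← hk]
    simp [← hz]
  have he : e' x = n ^ 2 * L.det * e x := by
    rw [h.volume x hx, hLd, ← hn]; field_simp
  have hlin : hodgeMat (G x) (e x) (z.re • F - z.im • H) = z.re • H + z.im • F := by
    have hadd : ∀ A B : Matrix (Fin 4) (Fin 4) ℝ, dual (A - B) = dual A - dual B := by
      intro A B; ext i j; fin_cases i <;> fin_cases j <;> simp [dual] <;> ring
    have h1 : hodgeMat (G x) (e x) (z.re • F - z.im • H)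
        = z.re • hodgeMat (G x) (e x) F - z.im • hodgeMat (G x) (e x) H := by
      simp only [hodgeMat, Matrix.mul_sub, Matrix.sub_mul, Matrix.mul_smul, Matrix.smul_mul,
        smul_sub, hadd, dual_smul, smul_comm (e x)]
    rw [h1, hHH, smul_neg, sub_neg_eq_add]
  have hanti : (z.re • F - z.im • H)ᵀ = -(z.re • F - z.im • H) := by
    rw [Matrix.transpose_sub, Matrix.transpose_smul, Matrix.transpose_smul, hFt, hHt]
    simp only [smul_neg]; abel
  have h2 : IsMetricRegion.hodgeNabla G' e' X x
      = hodgeMat (G' x) (e' x) (Matrix.of (nablaLower G' X x)) := rfl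
  rw [h2, hF', he, h.metric_eq_conj hx, hodgeMat_conj hanti hn0 (by rw [hLd]; exact inv_ne_zero hn0),
    hlin]
  obtain ⟨f, k, hf, hk, hfk⟩ := h.conj_shear_nabla hx i j
  rw [hfk, Matrix.mul_add, Matrix.add_mul, Matrix.mul_smul, Matrix.smul_mul, Matrix.mul_smul,
    Matrix.smul_mul, Matrix.add_apply, Matrix.smul_apply, Matrix.smul_apply, ← hf, ← hk]
  simp [← hz]

/-- The transformation law of the Killing form. -/
theorem selfDual_eq (h : IsTransformRegion O G e X s α β γ δ W O' G' e') (hx : x ∈ O')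
    (i j : Fin 4) : selfDual G' e' X x i j = selfDualTransform G e X s γ δ W x i j := by
  rw [selfDual, h.nablaLower_eq hx, h.hodgeNabla_eq hx, mul_comm]
  exact Complex.re_add_im _

end IsTransformRegion

/-! ### Closedness of the new Killing form and the induced one-forms -/

lemma pd_im {f : E4 → ℂ} {x : E4} (hf : ContDiffAt ℝ ∞ f x) (i : Fin 4) :
    pd i (fun y => (f y).im) x = (pd i f x).im := pd_clm Complex.imCLM hf i

/-- The denominator is a cocycle: it is the second row of the matrix applied to (σ, 1), so the
denominators of composed Möbius maps multiply. -/
lemma factor_moebius {α β γ δ : ℝ} (γ' δ' : ℝ) {s : ℂ} (h0 : factor γ δ s ≠ 0) :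
    factor γ' δ' ((α * s + Complex.I * β) / factor γ δ s) * factor γ δ s
      = factor (γ' * α + δ' * γ) (δ' * δ - γ' * β) s := by
  rw [factor, add_mul, mul_assoc (Complex.I * (γ' : ℂ)), div_mul_cancel₀ _ h0]
  simp only [factor]
  push_cast
  linear_combination (γ' : ℂ) * β * Complex.I_sq

namespace IsTransformRegion

variable {O : Set E4} {G : E4 → Matrix (Fin 4) (Fin 4) ℝ} {e : E4 → ℝ} {X : E4 → Fin 4 → ℝ}
  {s : E4 → ℂ} {α β γ δ : ℝ} {W : E4 → Fin 4 → ℝ} {O' : Set E4}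
  {G' : E4 → Matrix (Fin 4) (Fin 4) ℝ} {e' : E4 → ℝ} {x : E4}

lemma curl_complex (h : IsTransformRegion O G e X s α β γ δ W O' G' e') (hx : x ∈ O')
    (i j : Fin 4) :
    ((pd i (fun y => W y j) x : ℝ) : ℂ) - ((pd j (fun y => W y i) x : ℝ) : ℂ)
      = -2 * γ * Complex.I * (starRingEnd ℂ) (factor γ δ (s x)) * selfDual G e X x i j
        + 2 * γ * Complex.I * factor γ δ (s x) * (starRingEnd ℂ) (selfDual G e X x i j) := by
  have h1 := h.form.curl x (h.subset hx) i j
  rw [coeff_eq] at h1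
  rw [← Complex.ofReal_sub, h1, Complex.re_eq_add_conj]
  simp only [map_mul, map_neg, Complex.conj_I, Complex.conj_ofReal, Complex.conj_conj, map_ofNat]
  ring

/-- Contracting Ω²𝓕 − ½ W ∧ dσ with ξ gives ½(Ω² − W(ξ)) dσ, as ξ annihilates σ. The bracket equals
1. -/
lemma grad (h : IsTransformRegion O G e X s α β γ δ W O' G' e') (hx : x ∈ O') (j : Fin 4) :
    pd j s x / factor γ δ (s x) ^ 2 = 2 * ∑ i, (X x i : ℂ) * selfDual G' e' X x i j := by
  have hx' := h.subset hx
  have hf := h.factor_ne x hx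
  have h1 := h.sum_field_mul_selfDual hx j
  have h2 := h.base.sum_field_mul_grad hx'
  have h3 : ∑ i, (W x i : ℂ) * (X x i : ℂ) + 1
      = factor γ δ (s x) * (starRingEnd ℂ) (factor γ δ (s x)) := by
    rw [Complex.mul_conj, ← h.form.norm x hx']; push_cast; rfl
  simp only [h.selfDual_eq hx, selfDualTransform]
  simp only [Fin.sum_univ_four] at h1 h2 h3 ⊢
  set f := factor γ δ (s x)
  set c := (starRingEnd ℂ) f
  rw [div_eq_mul_inv, ← inv_pow]
  linear_combination -2 * f⁻¹ ^ 2 * f * c * h1 - f⁻¹ ^ 2 * W x j * h2 + f⁻¹ ^ 2 * pd j s x * h3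

lemma pd_selfDualTransform (h : IsTransformRegion O G e X s α β γ δ W O' G' e') (hx : x ∈ O')
    (a b c : Fin 4) : ContDiffAt ℝ ∞ (fun y => selfDualTransform G e X s γ δ W y b c) x ∧
    pd a (fun y => selfDualTransform G e X s γ δ W y b c) x =
      -Complex.I * γ * (starRingEnd ℂ) (pd a s x) * (factor γ δ (s x))⁻¹ * selfDual G e X x b c
      - Complex.I * γ * pd a s x * (factor γ δ (s x))⁻¹ ^ 2
        * (starRingEnd ℂ) (factor γ δ (s x)) * selfDual G e X x b c
      + (starRingEnd ℂ) (factor γ δ (s x)) * (factor γ δ (s x))⁻¹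
        * pd a (fun y => selfDual G e X y b c) x
      + Complex.I * γ * pd a s x * (factor γ δ (s x))⁻¹ ^ 3
        * ((W x b : ℂ) * pd c s x - (W x c : ℂ) * pd b s x)
      - 1 / 2 * (factor γ δ (s x))⁻¹ ^ 2
        * (((pd a (fun y => W y b) x : ℝ) : ℂ) * pd c s x + (W x b : ℂ) * pd a (pd c s) x
          - ((pd a (fun y => W y c) x : ℝ) : ℂ) * pd b s x - (W x c : ℂ) * pd a (pd b s) x) := by
  have hx' := h.subset hx
  have hs := h.base.potential x hx'
  have hf := contDiffAt_factor hs γ δ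
  have hf0 := h.factor_ne x hx
  have hi : ContDiffAt ℝ ∞ (fun y => (factor γ δ (s y))⁻¹) x := hf.inv hf0
  have hc := contDiffAt_conj hf
  have hK := h.base.contDiffAt_selfDual hx' b c
  have hW := fun i => contDiffAt_ofReal (h.form.smooth x hx' i)
  have hd := fun i => contDiffAt_pd hs i
  have heq : ∀ y ∈ O', selfDualTransform G e X s γ δ W y b c
      = (starRingEnd ℂ) (factor γ δ (s y)) * (factor γ δ (s y))⁻¹ * selfDual G e X y b c
        - 1 / 2 * ((factor γ δ (s y))⁻¹ * (factor γ δ (s y))⁻¹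
          * ((W y b : ℂ) * pd c s y - (W y c : ℂ) * pd b s y)) := by
    intro y hy
    have := h.factor_ne y hy
    rw [selfDualTransform]
    field_simp
  have hA := (hc.mul hi).mul hK
  have hV := ((hW b).mul (hd c)).sub ((hW c).mul (hd b))
  have hB := (hi.mul hi).mul hV
  refine ⟨(hA.sub (contDiffAt_const.mul hB)).congr_of_eventuallyEq
    (Filter.eventually_of_mem (h.isOpen.mem_nhds hx) heq), ?_⟩
  rw [pd_congr h.isOpen hx heq, pd_sub hA (contDiffAt_const.mul hB), pd_const_mul _ hB,
    pd_mul (hi.mul hi) hV, pd_sub ((hW b).mul (hd c)) ((hW c).mul (hd b)),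
    pd_mul (hW b) (hd c), pd_mul (hW c) (hd b), pd_mul (hc.mul hi) hK, pd_mul hc hi,
    pd_mul hi hi, pd_conj hf, pd_inv hf hf0, pd_factor hs,
    pd_ofReal (h.form.smooth x hx' b), pd_ofReal (h.form.smooth x hx' c)]
  simp only [map_mul, Complex.conj_I, Complex.conj_ofReal]
  field_simp
  ring

/-- The terms df ∧ W ∧ dσ vanish because df is a multiple of dσ, and second derivatives of σ cancel.
Substituting dW cancels the remaining f̄ dσ ∧ 𝓕, leaving −iγ f⁻¹ (dσ̄ ∧ 𝓕 + dσ ∧ 𝓕̄), which is zero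
by `wedge_conj`. -/
lemma closed_selfDual (h : IsTransformRegion O G e X s α β γ δ W O' G' e') (hx : x ∈ O')
    (a b c : Fin 4) :
    pd a (fun y => selfDualTransform G e X s γ δ W y b c) x
      + pd b (fun y => selfDualTransform G e X s γ δ W y c a) x
      + pd c (fun y => selfDualTransform G e X s γ δ W y a b) x = 0 := by
  have hx' := h.subset hx
  have hs := h.base.potential x hx'
  have h1 := h.base.closed_selfDual hx' a b c
  have h2 := h.base.wedge_conj hx' a b c
  have h3 := h.curl_complex hx a b
  have h4 := h.curl_complex hx b c
  have h5 := h.curl_complex hx c a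
  have h6 : (factor γ δ (s x))⁻¹ * factor γ δ (s x) = 1 := inv_mul_cancel₀ (h.factor_ne x hx)
  rw [(h.pd_selfDualTransform hx a b c).2, (h.pd_selfDualTransform hx b c a).2,
    (h.pd_selfDualTransform hx c a b).2, pd_comm hs b a, pd_comm hs c a, pd_comm hs c b]
  set f := factor γ δ (s x)
  linear_combination (starRingEnd ℂ) f * f⁻¹ * h1 - Complex.I * γ * f⁻¹ * h2
    - 1 / 2 * f⁻¹ ^ 2 * (pd c s x * h3 + pd a s x * h4 + pd b s x * h5)
    - γ * Complex.I * f⁻¹ * (pd c s x * (starRingEnd ℂ) (selfDual G e X x a b)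
      + pd a s x * (starRingEnd ℂ) (selfDual G e X x b c)
      + pd b s x * (starRingEnd ℂ) (selfDual G e X x c a)) * h6

/-- The transformed region is again of the same kind. -/
theorem isErnstRegion (h : IsTransformRegion O G e X s α β γ δ W O' G' e') :
    IsErnstRegion O' G' e' X (fun y => (α * s y + Complex.I * β) / factor γ δ (s y)) where
  toIsMetricRegion := h.isMetricRegion
  killing x hx := h.killing hx
  closed x hx a b c := by
    have h1 : ∀ a b c, pd a (fun y => IsMetricRegion.hodgeNabla G' e' X y b c) x
        = (pd a (fun y => selfDualTransform G e X s γ δ W y b c) x).im := fun a b c => by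
      rw [pd_congr h.isOpen hx (fun y hy => h.hodgeNabla_eq hy b c),
        pd_im (h.pd_selfDualTransform hx a b c).1]
    rw [h1, h1, h1, ← Complex.add_im, ← Complex.add_im, h.closed_selfDual hx, Complex.zero_im]
  potential x hx := h.contDiffAt_moebius hx
  re_eq x hx := h.re_eq hx
  grad x hx j := by
    rw [pd_moebius h.det_eq (h.base.potential x (h.subset hx)) (h.factor_ne x hx), h.grad hx]

/-- The one-form `W'' - Ω'² W` on the transformed region. -/
theorem isEhlersRegionForm (h : IsTransformRegion O G e X s α β γ δ W O' G' e') {γ' δ' : ℝ}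
    {W'' : E4 → Fin 4 → ℝ}
    (h'' : IsEhlersRegionForm O G e X s (γ' * α + δ' * γ) (δ' * δ - γ' * β) W'') :
    IsEhlersRegionForm O' G' e' X (fun y => (α * s y + Complex.I * β) / factor γ δ (s y)) γ' δ'
      (fun y i => W'' y i - Complex.normSq
        (factor γ' δ' ((α * s y + Complex.I * β) / factor γ δ (s y))) * W y i) where
  smooth x hx i := (h''.smooth x (h.subset hx) i).sub
    ((contDiffAt_normSq (contDiffAt_factor (h.contDiffAt_moebius hx) γ' δ')).mul
      (h.form.smooth x (h.subset hx) i))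
  norm x hx := by
    have h1 := h.form.norm x (h.subset hx)
    have h2 := h''.norm x (h.subset hx)
    rw [← factor_moebius (α := α) (β := β) γ' δ' (h.factor_ne x hx), map_mul] at h2
    simp only [sub_mul, Finset.sum_sub_distrib, mul_assoc, ← Finset.mul_sum]
    linear_combination h2 - Complex.normSq
      (factor γ' δ' ((α * s x + Complex.I * β) / factor γ δ (s x))) * h1
  curl x hx i j := by
    have hx' := h.subset hx
    have hs := h.base.potential x hx'
    have hW := h.form.smooth x hx'
    have hW'' := h''.smooth x hx'
    have hm := contDiffAt_factor (h.contDiffAt_moebius hx) γ' δ'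
    have hN := contDiffAt_normSq hm
    have hpd : ∀ i j, pd i (fun y => W'' y j - Complex.normSq
        (factor γ' δ' ((α * s y + Complex.I * β) / factor γ δ (s y))) * W y j) x = _ :=
      fun i j => by
        rw [pd_sub (hW'' j) (hN.mul (hW j)), pd_mul hN (hW j), pd_normSq hm,
          pd_factor (h.contDiffAt_moebius hx), pd_moebius h.det_eq hs (h.factor_ne x hx)]
    have h1 := h.form.curl x hx' i j
    have h2 := h''.curl x hx' i j
    rw [coeff_eq] at h1 h2
    have hfac := factor_moebius (α := α) (β := β) γ' δ' (h.factor_ne x hx)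
    rw [hpd, hpd, coeff_eq, h.selfDual_eq hx]
    rw [← hfac, map_mul] at h2
    set m := factor γ' δ' ((α * s x + Complex.I * β) / factor γ δ (s x)) with hmdef
    have hf0 := h.factor_ne x hx
    have hu : (factor γ δ (s x))⁻¹ * factor γ δ (s x) = 1 := inv_mul_cancel₀ hf0
    have hdet : (α * δ + β * γ : ℂ) = 1 := by exact_mod_cast h.det_eq
    -- This is the identity behind the curl equation: γ'' − mγ = γ'/f, where mf is the factor for
    -- the product. It is where αδ + βγ = 1 enters; it combines dW'' and |m|² dW into the
    -- coefficient γ' required for the new form.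
    have hg : ((γ' * α + δ' * γ : ℝ) : ℂ) - m * γ = γ' * (factor γ δ (s x))⁻¹ := by
      apply mul_right_cancel₀ hf0
      rw [sub_mul, mul_right_comm, hfac, mul_assoc, hu]
      simp only [factor]
      push_cast
      linear_combination (γ' : ℂ) * hdet
    -- Separates the two curls from the terms d|m|² ∧ W, which provide the W ∧ dσ part of the new
    -- Killing form.
    have hexp : ∀ a b c d p q r t n : ℝ, (a - ((2 * p) * q + n * b)) - (c - ((2 * r) * t + n * d))
        = (a - c) - n * (b - d) + (-2 * q) * p + (2 * t) * r := by intros; ring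
    rw [hexp, h1, h2, ← Complex.re_ofReal_mul, ← Complex.re_ofReal_mul, ← Complex.re_ofReal_mul,
      ← Complex.sub_re, ← Complex.add_re, ← Complex.add_re]
    congr 1
    push_cast at hg ⊢
    rw [← Complex.mul_conj, selfDualTransform, div_eq_mul_inv, div_eq_mul_inv, ← inv_pow]
    set f := factor γ δ (s x)
    linear_combination -4 * Complex.I * selfDual G e X x i j * (starRingEnd ℂ) m
      * (starRingEnd ℂ) f * hg + 4 * γ' * Complex.I * (starRingEnd ℂ) m * f⁻¹ * (starRingEnd ℂ) f
      * selfDual G e X x i j * hu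

end IsTransformRegion

/-! ## Components in a chart -/

lemma isOpen_coordSet {M : Type*} [TopologicalSpace M] (φ : OpenPartialHomeomorph M E4) {U : Set M}
    (hU : IsOpen U) : IsOpen (coordSet φ U) := φ.isOpen_inter_preimage_symm hU

lemma eq_sum_single (u : E4) : u = ∑ i, u i • (EuclideanSpace.single i (1 : ℝ) : E4) := by
  ext j; simp [Pi.single_apply]

section Charts

variable {M : Type*} [TopologicalSpace M] [ChartedSpace E4 M]

/-- The components of a tangent vector at the point with coordinates `x`. -/
def coordOf (φ : OpenPartialHomeomorph M E4) (x : E4) (v : TangentSpace (𝓡 4) (φ.symm x)) : E4 :=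
  mfderiv (𝓡 4) (𝓡 4) φ (φ.symm x) v

variable {φ : OpenPartialHomeomorph M E4} {x : E4}

lemma IsChart.mdifferentiable (hφ : IsChart φ) : φ.MDifferentiable (𝓡 4) (𝓡 4) :=
  ⟨(contMDiffOn_of_mem_maximalAtlas hφ).mdifferentiableOn (by simp),
    (contMDiffOn_symm_of_mem_maximalAtlas hφ).mdifferentiableOn (by simp)⟩

lemma isChart_chartAt [IsManifold (𝓡 4) ∞ M] (p : M) : IsChart (chartAt E4 p) := IsManifold.chart_mem_maximalAtlas p

lemma eq_sum_coordVec (hφ : IsChart φ) (hx : x ∈ φ.target) (v : TangentSpace (𝓡 4) (φ.symm x)) :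
    v = ∑ i, coordOf φ x v i • coordVec φ x i := by
  let A : E4 →ₗ[ℝ] E4 := (mfderiv (𝓡 4) (𝓡 4) φ.symm x : E4 →L[ℝ] E4).toLinearMap
  let B : E4 →ₗ[ℝ] E4 := (mfderiv (𝓡 4) (𝓡 4) φ (φ.symm x) : E4 →L[ℝ] E4).toLinearMap
  have hBA : B * A = 1 := by
    ext1 u
    exact DFunLike.congr_fun (hφ.mdifferentiable.comp_symm_deriv hx) u
  -- In finite dimension a one-sided inverse is two-sided.
  have hAB : A * B = 1 := (LinearMap.comp_eq_id_comm ℝ E4).1 hBA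
  have h1 : A (B v) = v := LinearMap.congr_fun hAB v
  have h2 := eq_sum_single (B v)
  have h3 : A (B v) = ∑ i, (B v) i • A (EuclideanSpace.single i (1 : ℝ) : E4) := by
    conv_lhs => rw [h2]
    simp only [map_sum, map_smul]
  exact h1.symm.trans h3

lemma vecComp_eq (X : VField M) (x : E4) (i : Fin 4) :
    vecComp φ X x i = coordOf φ x (X (φ.symm x)) i := rfl

lemma apply_eq_sum_oneComp (hφ : IsChart φ) (hx : x ∈ φ.target) (W : OneForm M)
    (v : TangentSpace (𝓡 4) (φ.symm x)) :
    W (φ.symm x) v = ∑ i, oneComp φ W x i * coordOf φ x v i := by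
  conv_lhs => rw [eq_sum_coordVec hφ hx v]
  simp only [map_sum, map_smul, smul_eq_mul, oneComp, mul_comm]

lemma apply_eq_sum_bilinComp (hφ : IsChart φ) (hx : x ∈ φ.target) (g : BilinField M)
    (v w : TangentSpace (𝓡 4) (φ.symm x)) :
    g (φ.symm x) v w
      = ∑ i, ∑ j, bilinComp φ g x i j * coordOf φ x v i * coordOf φ x w j := by
  conv_lhs => rw [eq_sum_coordVec hφ hx v, eq_sum_coordVec hφ hx w]
  simp only [map_sum, map_smul, LinearMap.sum_apply, LinearMap.smul_apply, smul_eq_mul,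
    bilinComp, Matrix.of_apply, Finset.mul_sum]
  rw [Finset.sum_comm]
  exact Finset.sum_congr rfl fun i _ => Finset.sum_congr rfl fun j _ => by ring

lemma apply_coordVec_eq_lower (hφ : IsChart φ) (hx : x ∈ φ.target) (g : BilinField M)
    (ξ : VField M) (i : Fin 4) :
    g (φ.symm x) (coordVec φ x i) (ξ (φ.symm x)) = lower (bilinComp φ g) (vecComp φ ξ) x i := by
  conv_lhs => rw [eq_sum_coordVec hφ hx (ξ (φ.symm x))]
  simp only [map_sum, map_smul, smul_eq_mul, lower, bilinComp, Matrix.of_apply, vecComp_eq,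
    mul_comm]

lemma normFn_eq (hφ : IsChart φ) (hx : x ∈ φ.target) (g : BilinField M) (ξ : VField M) :
    normFn g ξ (φ.symm x)
      = -∑ i, lower (bilinComp φ g) (vecComp φ ξ) x i * vecComp φ ξ x i := by
  rw [normFn, apply_eq_sum_bilinComp hφ hx]
  simp only [lower, Finset.sum_mul, vecComp_eq]
  congr 1
  exact Finset.sum_congr rfl fun i _ => Finset.sum_congr rfl fun j _ => by ring

/-- Four-forms in dimension four form a line spanned by the determinant; the form is pulled back to
coordinate space to use this. -/
lemma apply_eq_det_mul (hφ : IsChart φ) (hx : x ∈ φ.target) (η : FourForm M)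
    (v : Fin 4 → TangentSpace (𝓡 4) (φ.symm x)) :
    η (φ.symm x) v = (Matrix.of fun i j => coordOf φ x (v j) i).det * fourComp φ η x 0 1 2 3 := by
  let A : E4 →ₗ[ℝ] TangentSpace (𝓡 4) (φ.symm x) :=
    (mfderiv (𝓡 4) (𝓡 4) φ.symm x : E4 →L[ℝ] TangentSpace (𝓡 4) (φ.symm x)).toLinearMap
  let b := (EuclideanSpace.basisFun (Fin 4) ℝ).toBasis
  have hA : ∀ u, A (coordOf φ x u) = u := by
    intro u
    rw [eq_sum_single (coordOf φ x u), map_sum]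
    simp only [map_smul]
    exact (eq_sum_coordVec hφ hx u).symm
  have h1 := (η (φ.symm x)).compLinearMap A |>.eq_smul_basis_det b
  have h2 := DFunLike.congr_fun h1 (fun j => coordOf φ x (v j))
  rw [AlternatingMap.compLinearMap_apply] at h2
  simp only [hA] at h2
  rw [h2, AlternatingMap.smul_apply, smul_eq_mul, mul_comm, Module.Basis.det_apply]
  congr 1
  rw [AlternatingMap.compLinearMap_apply, fourComp]
  congr 1
  ext j
  fin_cases j <;> simp [b, A, coordVec] <;> rfl

lemma fourComp_eq_eps (η : FourForm M) (x : E4) (i j k l : Fin 4) :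
    fourComp φ η x i j k l = fourComp φ η x 0 1 2 3 * eps i j k l :=
  alternating_apply_eq_eps (η (φ.symm x)) (coordVec φ x) i j k l

lemma det_gram (hφ : IsChart φ) (hx : x ∈ φ.target) (g : BilinField M)
    (v : Fin 4 → TangentSpace (𝓡 4) (φ.symm x)) :
    (Matrix.of fun i j => g (φ.symm x) (v i) (v j)).det
      = (Matrix.of fun i j => coordOf φ x (v j) i).det ^ 2 * (bilinComp φ g x).det := by
  set P := Matrix.of fun i j => coordOf φ x (v j) i with hP
  have h1 : (Matrix.of fun i j => g (φ.symm x) (v i) (v j)) = Pᵀ * bilinComp φ g x * P := by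
    ext i j
    rw [Matrix.of_apply, apply_eq_sum_bilinComp hφ hx, Matrix.mul_apply, Finset.sum_comm]
    refine Finset.sum_congr rfl fun l _ => ?_
    rw [Matrix.mul_apply, Finset.sum_mul]
    refine Finset.sum_congr rfl fun k _ => ?_
    rw [hP, Matrix.transpose_apply, Matrix.of_apply, Matrix.of_apply]; ring
  rw [h1, Matrix.det_mul, Matrix.det_mul, Matrix.det_transpose]; ring

/-- Both sides of the volume condition scale by the squared determinant of the components, so the
coordinate basis suffices as a test. -/
lemma isVolumeAt_iff (hφ : IsChart φ) (hx : x ∈ φ.target) (g : BilinField M) (η : FourForm M) :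
    IsVolumeAt g η (φ.symm x) ↔ fourComp φ η x 0 1 2 3 ^ 2 = -(bilinComp φ g x).det := by
  constructor
  · intro h
    have h1 := h (coordVec φ x)
    have h2 : (![coordVec φ x 0, coordVec φ x 1, coordVec φ x 2, coordVec φ x 3]) = coordVec φ x := by
      ext1 a; fin_cases a <;> rfl
    rw [fourComp, h2, h1]; rfl
  · intro h v
    rw [apply_eq_det_mul hφ hx, det_gram hφ hx, mul_pow, h]; ring

lemma det_bilinComp_ne (hφ : IsChart φ) (hx : x ∈ φ.target) {g : BilinField M}
    (h : IsLorentzAt g (φ.symm x)) : (bilinComp φ g x).det ≠ 0 := by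
  obtain ⟨-, b, hb⟩ := h
  have h1 := det_gram hφ hx g b
  have h2 : (Matrix.of fun i j => g (φ.symm x) (b i) (b j))
      = Matrix.diagonal ![(-1 : ℝ), 1, 1, 1] := by
    ext i j; exact hb i j
  rw [h2, Matrix.det_diagonal] at h1
  simp only [Fin.prod_univ_four, Matrix.cons_val] at h1
  intro h0
  rw [h0] at h1
  norm_num at h1

lemma isMetricRegion_coordSet (hφ : IsChart φ) {D : ErnstData M} {ξ : VField M}
    (hU : IsOpen D.U) (hg : SmoothBilin D.g D.U) (hL : ∀ p ∈ D.U, IsLorentzAt D.g p)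
    (hη : SmoothFour D.η D.U) (hv : ∀ p ∈ D.U, IsVolumeAt D.g D.η p) (hξ : SmoothVec ξ D.U) :
    IsMetricRegion (coordSet φ D.U) (bilinComp φ D.g) (fun x => fourComp φ D.η x 0 1 2 3)
      (vecComp φ ξ) where
  isOpen := isOpen_coordSet φ hU
  metric _ hx i j := (hg φ hφ i j).contDiffAt ((isOpen_coordSet φ hU).mem_nhds hx)
  symm _ hx _ _ := (hL _ hx.2).1 _ _
  volume _ hx := (hη φ hφ 0 1 2 3).contDiffAt ((isOpen_coordSet φ hU).mem_nhds hx)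
  sq_volume _ hx := (isVolumeAt_iff hφ hx.1 D.g D.η).1 (hv _ hx.2)
  det_ne _ hx := det_bilinComp_ne hφ hx.1 (hL _ hx.2)
  field _ hx i := (hξ φ hφ i).contDiffAt ((isOpen_coordSet φ hU).mem_nhds hx)

lemma killingForm_eq {O : Set E4} {g : BilinField M} {η : FourForm M} {ξ : VField M}
    (h : IsMetricRegion O (bilinComp φ g) (fun x => fourComp φ η x 0 1 2 3) (vecComp φ ξ))
    (hK : ∀ x ∈ O, ∀ i j, lieMetric (bilinComp φ g) (vecComp φ ξ) x i j = 0) (hx : x ∈ O)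
    (i j : Fin 4) : killingForm φ g η ξ x i j
      = selfDual (bilinComp φ g) (fun x => fourComp φ η x 0 1 2 3) (vecComp φ ξ) x i j := by
  rw [killingForm, killingFormCoord,
    hodge_eq_hodgeMat (fourComp_eq_eps η x) (h.nablaLower_antisymm hK hx)]
  rfl

lemma ernstForm_eq {O : Set E4} {g : BilinField M} {η : FourForm M} {ξ : VField M}
    (h : IsMetricRegion O (bilinComp φ g) (fun x => fourComp φ η x 0 1 2 3) (vecComp φ ξ))
    (hK : ∀ x ∈ O, ∀ i j, lieMetric (bilinComp φ g) (vecComp φ ξ) x i j = 0) (hx : x ∈ O)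
    (j : Fin 4) : ernstForm φ g η ξ x j = 2 * ∑ i, (vecComp φ ξ x i : ℂ)
      * selfDual (bilinComp φ g) (fun x => fourComp φ η x 0 1 2 3) (vecComp φ ξ) x i j := by
  simp only [← killingForm_eq h hK hx]
  rfl

lemma contDiffAt_comp_symm (hφ : IsChart φ) {U : Set M} (hU : IsOpen U) {σ : M → ℂ}
    (hσ : ContMDiffOn (𝓡 4) 𝓘(ℝ, ℂ) ∞ σ U) (hx : x ∈ coordSet φ U) :
    ContDiffAt ℝ ∞ (fun y => σ (φ.symm y)) x := by
  rw [← contMDiffAt_iff_contDiffAt]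
  exact (hσ.contMDiffAt (hU.mem_nhds hx.2)).comp x
    (contMDiffAt_symm_of_mem_maximalAtlas hφ hx.1)

lemma IsErnstSpacetime.isErnstRegion (hφ : IsChart φ) {D : ErnstData M} {ξ : VField M}
    (h : IsErnstSpacetime ξ D) :
    IsErnstRegion (coordSet φ D.U) (bilinComp φ D.g) (fun x => fourComp φ D.η x 0 1 2 3)
      (vecComp φ ξ) (fun x => D.σ (φ.symm x)) := by
  have hm := isMetricRegion_coordSet hφ h.isOpen h.smooth_metric h.lorentz h.smooth_volume
    h.volume h.smooth_killing
  have hK := h.killing φ hφ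
  exact
  { toIsMetricRegion := hm
    killing := hK
    closed := fun x hx => (hm.ricci_annihilates_iff_closed hK hx).1 (h.ricci φ hφ x hx)
    potential := fun x hx => contDiffAt_comp_symm hφ h.isOpen h.potential.smooth hx
    re_eq := fun x hx => by rw [h.potential.re_eq _ hx.2, normFn_eq hφ hx.1]
    grad := fun x hx j => by rw [h.potential.grad φ hφ x hx, ernstForm_eq hm hK hx] }

lemma IsEhlersForm.isEhlersRegionForm (hφ : IsChart φ) {D : ErnstData M} {ξ : VField M}
    (h : IsErnstSpacetime ξ D) {γ δ : ℝ} {W : OneForm M} (hW : IsEhlersForm ξ D γ δ W) :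
    IsEhlersRegionForm (coordSet φ D.U) (bilinComp φ D.g) (fun x => fourComp φ D.η x 0 1 2 3)
      (vecComp φ ξ) (fun x => D.σ (φ.symm x)) γ δ (oneComp φ W) where
  smooth x hx i := (hW.smooth φ hφ i).contDiffAt ((isOpen_coordSet φ h.isOpen).mem_nhds hx)
  curl x hx i j := by
    have hr := h.isErnstRegion hφ
    rw [hW.ext_deriv φ hφ x hx, killingForm_eq hr.toIsMetricRegion hr.killing hx]
  norm x hx := by
    rw [← hW.norm _ hx.2, apply_eq_sum_oneComp hφ hx.1]; rfl

lemma isEhlersForm_of_region [IsManifold (𝓡 4) ∞ M] {D : ErnstData M} {ξ : VField M}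
    (h : IsErnstSpacetime ξ D) {γ δ : ℝ} {W : OneForm M}
    (hW : ∀ φ : OpenPartialHomeomorph M E4, IsChart φ →
      IsEhlersRegionForm (coordSet φ D.U) (bilinComp φ D.g) (fun x => fourComp φ D.η x 0 1 2 3)
      (vecComp φ ξ) (fun x => D.σ (φ.symm x)) γ δ (oneComp φ W)) : IsEhlersForm ξ D γ δ W where
  smooth φ hφ i x hx := ((hW φ hφ).smooth x hx i).contDiffWithinAt
  ext_deriv φ hφ x hx i j := by
    have hr := h.isErnstRegion hφ
    rw [(hW φ hφ).curl x hx, killingForm_eq hr.toIsMetricRegion hr.killing hx]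
  norm p hp := by
    have hφ := isChart_chartAt p
    set φ := chartAt E4 p
    have hpφ : p ∈ φ.source := mem_chart_source E4 p
    have hx : φ p ∈ coordSet φ D.U := ⟨φ.map_source hpφ, by simpa [φ.left_inv hpφ] using hp⟩
    have h1 := (hW φ hφ).norm (φ p) hx
    have h2 := apply_eq_sum_oneComp hφ hx.1 W (ξ (φ.symm (φ p)))
    simp only [← vecComp_eq] at h2
    rw [← h2, φ.left_inv hpφ] at h1
    exact h1

end Charts

/-! ## The parameter group -/

section Group

open Param

lemma entry_eq (A : ehlersGroup) : A.1.1 0 0 = (α A : ℂ) ∧ A.1.1 0 1 = Complex.I * β A ∧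
    A.1.1 1 0 = Complex.I * γ A ∧ A.1.1 1 1 = (δ A : ℂ) := by
  obtain ⟨h1, h2, h3, h4⟩ := A.2
  refine ⟨?_, ?_, ?_, ?_⟩ <;> apply Complex.ext <;> simp [α, β, γ, δ, h1, h2, h3, h4]

lemma det_param (A : ehlersGroup) : α A * δ A + β A * γ A = 1 := by
  have h := A.1.2
  obtain ⟨h1, h2, h3, h4⟩ := entry_eq A
  rw [Matrix.det_fin_two, h1, h2, h3, h4] at h
  have h5 : ((α A * δ A + β A * γ A : ℝ) : ℂ) = ((1 : ℝ) : ℂ) := by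
    push_cast
    linear_combination h + (β A : ℂ) * γ A * Complex.I_sq
  exact_mod_cast h5

lemma param_mul (B A : ehlersGroup) : α (B * A) = α B * α A - β B * γ A ∧
    β (B * A) = α B * β A + β B * δ A ∧ γ (B * A) = γ B * α A + δ B * γ A ∧
    δ (B * A) = δ B * δ A - γ B * β A := by
  obtain ⟨a1, a2, a3, a4⟩ := A.2
  obtain ⟨b1, b2, b3, b4⟩ := B.2
  refine ⟨?_, ?_, ?_, ?_⟩ <;>
    simp [α, β, γ, δ, Matrix.mul_apply, Fin.sum_univ_two, a1, a2, a3, a4, b1, b2, b3, b4] <;> ring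

lemma param_one : α 1 = 1 ∧ β 1 = 0 ∧ γ 1 = 0 ∧ δ 1 = 1 := by
  simp [α, β, γ, δ]

lemma param_ext {A B : ehlersGroup} (h1 : α A = α B) (h2 : β A = β B) (h3 : γ A = γ B)
    (h4 : δ A = δ B) : A = B := by
  obtain ⟨a1, a2, a3, a4⟩ := entry_eq A
  obtain ⟨b1, b2, b3, b4⟩ := entry_eq B
  apply Subtype.ext
  apply Subtype.ext
  ext i j
  fin_cases i <;> fin_cases j
  · exact a1.trans ((congrArg _ h1).trans b1.symm)
  · exact a2.trans ((congrArg (fun t : ℝ => Complex.I * (t : ℂ)) h2).trans b2.symm)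
  · exact a3.trans ((congrArg (fun t : ℝ => Complex.I * (t : ℂ)) h3).trans b3.symm)
  · exact a4.trans ((congrArg _ h4).trans b4.symm)

/-- The element of the group with given parameters. -/
def ofParam (a b c d : ℝ) (h : a * d + b * c = 1) : ehlersGroup :=
  ⟨⟨!![(a : ℂ), Complex.I * b; Complex.I * c, (d : ℂ)], by
    rw [Matrix.det_fin_two_of]
    have h5 : ((a * d + b * c : ℝ) : ℂ) = ((1 : ℝ) : ℂ) := by rw [h]
    push_cast at h5
    linear_combination h5 - (b : ℂ) * c * Complex.I_sq⟩, by
    change _ ∧ _ ∧ _ ∧ _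
    simp⟩

lemma param_ofParam {a b c d : ℝ} (h : a * d + b * c = 1) : α (ofParam a b c d h) = a ∧
    β (ofParam a b c d h) = b ∧ γ (ofParam a b c d h) = c ∧ δ (ofParam a b c d h) = d := by
  simp [α, β, γ, δ, ofParam]

/-- The parameter group is isomorphic to `SL(2, ℝ)`. -/
def equivSL : ehlersGroup ≃* Matrix.SpecialLinearGroup (Fin 2) ℝ where
  toFun A := ⟨!![α A, β A; -γ A, δ A], by
    rw [Matrix.det_fin_two_of]; linarith [det_param A]⟩
  invFun S := ofParam (S.1 0 0) (S.1 0 1) (-S.1 1 0) (S.1 1 1) (by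
    have h := S.2
    rw [Matrix.det_fin_two] at h
    linarith)
  left_inv A := by
    apply param_ext <;> simp [param_ofParam]
  right_inv S := by
    apply Subtype.ext
    ext i j
    fin_cases i <;> fin_cases j <;> simp [param_ofParam]
  map_mul' A B := by
    obtain ⟨h1, h2, h3, h4⟩ := param_mul A B
    apply Subtype.ext
    change !![α (A * B), β (A * B); -γ (A * B), δ (A * B)]
      = !![α A, β A; -γ A, δ A] * !![α B, β B; -γ B, δ B]
    ext i j
    fin_cases i <;> fin_cases j <;>
      simp [Matrix.mul_apply, Fin.sum_univ_two, h1, h2, h3, h4] <;> ring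

lemma factor_mobius (A B : ehlersGroup) {s : ℂ} (h0 : factor (γ A) (δ A) s ≠ 0) :
    factor (γ B) (δ B) (mobius A s) * factor (γ A) (δ A) s
      = factor (γ (B * A)) (δ (B * A)) s := by
  obtain ⟨-, -, h3, h4⟩ := param_mul B A
  rw [h3, h4]
  exact factor_moebius (γ B) (δ B) h0

lemma mobius_mobius (A B : ehlersGroup) {s : ℂ} (h0 : factor (γ A) (δ A) s ≠ 0)
    (h1 : factor (γ (B * A)) (δ (B * A)) s ≠ 0) :
    mobius B (mobius A s) = mobius (B * A) s := by
  have h2 := factor_mobius A B h0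
  have h3 : factor (γ B) (δ B) (mobius A s) ≠ 0 := fun h => h1 (by rw [← h2, h, zero_mul])
  obtain ⟨p1, p2, -, -⟩ := param_mul B A
  have h4 : mobius A s * factor (γ A) (δ A) s = α A * s + Complex.I * β A :=
    div_mul_cancel₀ _ h0
  rw [mobius, mobius.eq_def (B * A), div_eq_div_iff h3 h1, ← h2, p1, p2]
  push_cast
  have h5 : factor (γ A) (δ A) s = Complex.I * γ A * s + δ A := rfl
  linear_combination factor (γ B) (δ B) (mobius A s) * ((α B : ℂ) * h4 + Complex.I * β B * h5
    + (β B : ℂ) * γ A * s * Complex.I_sq)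

lemma param_ne_zero (A : ehlersGroup) : γ A ≠ 0 ∨ δ A ≠ 0 := by
  by_contra h
  push Not at h
  have := det_param A
  rw [h.1, h.2] at this
  norm_num at this

end Group

/-! ## A single transformation -/

section Single

variable {M : Type*} [TopologicalSpace M] [ChartedSpace E4 M]
  {ξ : VField M} {D : ErnstData M} {A : ehlersGroup} {W : OneForm M}

lemma Omega2_eq {γ δ : ℝ} (hW : IsEhlersForm ξ D γ δ W) {p : M} (hp : p ∈ D.U) :
    Omega2 ξ W p = Complex.normSq (factor γ δ (D.σ p)) := by
  rw [Omega2, add_comm, hW.norm p hp]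

lemma T_apply (ξ : VField M) (W : OneForm M) (g : BilinField M) (p : M)
    (v w : TangentSpace (𝓡 4) p) : T ξ W g p v w = Omega2 ξ W p * g p v w
      - g p v (ξ p) * W p w - g p w (ξ p) * W p v
      - normFn g ξ p / Omega2 ξ W p * (W p v * W p w) := rfl

lemma isOpen_transform (hD : IsErnstSpacetime ξ D) : IsOpen (D.transform ξ A W).U := by
  have h1 : Continuous fun z : ℂ => factor (Param.γ A) (Param.δ A) z := by
    unfold factor; fun_prop
  exact hD.potential.smooth.continuousOn.isOpen_inter_preimage hD.isOpen
    (isOpen_compl_singleton.preimage h1)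

lemma isTransformRegion {φ : OpenPartialHomeomorph M E4} (hφ : IsChart φ)
    (hD : IsErnstSpacetime ξ D) (hW : IsEhlersForm ξ D (Param.γ A) (Param.δ A) W) :
    IsTransformRegion (coordSet φ D.U) (bilinComp φ D.g) (fun x => fourComp φ D.η x 0 1 2 3)
      (vecComp φ ξ) (fun x => D.σ (φ.symm x)) (Param.α A) (Param.β A) (Param.γ A) (Param.δ A)
      (oneComp φ W) (coordSet φ (D.transform ξ A W).U) (bilinComp φ (D.transform ξ A W).g)
      (fun x => fourComp φ (D.transform ξ A W).η x 0 1 2 3) where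
  base := hD.isErnstRegion hφ
  form := hW.isEhlersRegionForm hφ hD
  det_eq := det_param A
  isOpen := isOpen_coordSet φ (isOpen_transform hD)
  subset _ hx := ⟨hx.1, hx.2.1⟩
  factor_ne _ hx := hx.2.2
  metric x hx i j := by
    have hp : φ.symm x ∈ D.U := hx.2.1
    change T ξ W D.g (φ.symm x) (coordVec φ x i) (coordVec φ x j) = _
    rw [T_apply, Omega2_eq hW hp, apply_coordVec_eq_lower hφ hx.1,
      apply_coordVec_eq_lower hφ hx.1, hD.potential.re_eq _ hp]
    rfl
  volume x hx := by
    change (Omega2 ξ W (φ.symm x) • D.η (φ.symm x)) _ = _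
    rw [AlternatingMap.smul_apply, smul_eq_mul, Omega2_eq hW hx.2.1]
    rfl

/-- The inverse of L is 1 + ξ ⊗ W. Scaled by 1/Ω, it carries a g-orthonormal basis to one
orthonormal for the new metric, which therefore has the same signature. -/
lemma isLorentzAt_T {g : BilinField M} {p : M} (hg : IsLorentzAt g p)
    (hn : 0 < Omega2 ξ W p) : IsLorentzAt (T ξ W g) p := by
  obtain ⟨hs, b, hb⟩ := hg
  set n := Omega2 ξ W p with hn'
  have hWξ : W p (ξ p) = n - 1 := by rw [hn', Omega2]; ring
  have hr : 0 < Real.sqrt n := Real.sqrt_pos.2 hn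
  have hr2 : Real.sqrt n ^ 2 = n := Real.sq_sqrt hn.le
  set r := Real.sqrt n
  refine ⟨fun v w => by rw [T_apply, T_apply, hs v w]; ring, ?_⟩
  let f : TangentSpace (𝓡 4) p →ₗ[ℝ] TangentSpace (𝓡 4) p :=
    r⁻¹ • (LinearMap.id + (W p).smulRight (ξ p))
  let f' : TangentSpace (𝓡 4) p →ₗ[ℝ] TangentSpace (𝓡 4) p :=
    r • (LinearMap.id - n⁻¹ • (W p).smulRight (ξ p))
  have hf : ∀ v, f v = r⁻¹ • (v + W p v • ξ p) := fun v => rfl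
  have hf' : ∀ v, f' v = r • (v - n⁻¹ • (W p v • ξ p)) := fun v => rfl
  have h1 : f ∘ₗ f' = LinearMap.id := by
    ext1 v
    rw [LinearMap.comp_apply, hf, hf']
    simp only [map_smul, map_sub, smul_eq_mul, hWξ, LinearMap.id_apply]
    match_scalars
    · field_simp
    · field_simp; ring
  have h2 : f' ∘ₗ f = LinearMap.id := by
    ext1 v
    rw [LinearMap.comp_apply, hf, hf']
    simp only [map_smul, map_add, smul_eq_mul, hWξ, LinearMap.id_apply]
    match_scalars
    · field_simp
    · field_simp; ring
  refine ⟨b.map (LinearEquiv.ofLinearMap f f' h1 h2), fun i j => ?_⟩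
  rw [← hb i j, Module.Basis.map_apply, Module.Basis.map_apply, LinearEquiv.coe_ofLinearMap, hf, hf, T_apply, ← hn', normFn]
  simp only [map_smul, map_add, LinearMap.add_apply, LinearMap.smul_apply, smul_eq_mul, hWξ,
    hs (ξ p) (b _)]
  rw [← hr2]
  field_simp
  ring

lemma exists_chart [IsManifold (𝓡 4) ∞ M] (p : M) : ∃ φ : OpenPartialHomeomorph M E4, IsChart φ ∧
    ∃ x ∈ φ.target, φ.symm x = p :=
  ⟨chartAt E4 p, isChart_chartAt p, chartAt E4 p p, mem_chart_target E4 p,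
    (chartAt E4 p).left_inv (mem_chart_source E4 p)⟩

theorem isErnstSpacetime_transform [IsManifold (𝓡 4) ∞ M] (hD : IsErnstSpacetime ξ D)
    (hW : IsEhlersForm ξ D (Param.γ A) (Param.δ A) W) :
    IsErnstSpacetime ξ (D.transform ξ A W) := by
  have hR := fun φ hφ => isTransformRegion (φ := φ) hφ hD hW
  have hsub : (D.transform ξ A W).U ⊆ D.U := fun p hp => hp.1
  refine
  { isOpen := isOpen_transform hD
    smooth_metric := fun φ hφ i j x hx =>
      ((hR φ hφ).isMetricRegion.metric x hx i j).contDiffWithinAt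
    lorentz := fun p hp => ?_
    smooth_volume := fun φ hφ i j k l x hx => ?_
    volume := fun p hp => ?_
    smooth_killing := fun φ hφ i => (hD.smooth_killing φ hφ i).mono fun x hx => ⟨hx.1, hsub hx.2⟩
    killing := fun φ hφ x hx i j => (hR φ hφ).killing hx i j
    ricci := fun φ hφ x hx => ?_
    potential :=
    { smooth := fun p hp => ?_
      re_eq := fun p hp => ?_
      grad := fun φ hφ x hx j => ?_ } }
  · refine isLorentzAt_T (hD.lorentz p hp.1) ?_
    rw [Omega2_eq hW hp.1]
    exact Complex.normSq_pos.2 hp.2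
  · have h1 : (fun x => fourComp φ (D.transform ξ A W).η x i j k l)
        = fun x => fourComp φ (D.transform ξ A W).η x 0 1 2 3 * eps i j k l :=
      funext fun x => fourComp_eq_eps _ x i j k l
    rw [h1]
    exact (((hR φ hφ).isMetricRegion.volume x hx).mul contDiffAt_const).contDiffWithinAt
  · obtain ⟨φ, hφ, x, hx, rfl⟩ := exists_chart p
    exact (isVolumeAt_iff hφ hx _ _).2 ((hR φ hφ).isMetricRegion.sq_volume x ⟨hx, hp⟩)
  -- The Ricci condition is recovered from closedness of the new dual form.
  · have h1 := (hR φ hφ).isErnstRegion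
    exact (h1.ricci_annihilates_iff_closed h1.killing hx).2 (h1.closed x hx)
  · have h1 : ContDiffAt ℝ ∞ (fun z => mobius A z) (D.σ p) := by
      simp only [mobius, factor, div_eq_mul_inv]
      refine (ContDiffAt.add (contDiffAt_const.mul contDiffAt_id) contDiffAt_const).mul
        (ContDiffAt.inv ((contDiffAt_const.mul contDiffAt_id).add contDiffAt_const) hp.2)
    exact h1.comp_contMDiffWithinAt ((hD.potential.smooth p hp.1).mono hsub)
  · obtain ⟨φ, hφ, x, hx, rfl⟩ := exists_chart p
    rw [normFn_eq hφ hx, ← (hR φ hφ).isErnstRegion.re_eq x ⟨hx, hp⟩]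
    rfl
  · have h1 := (hR φ hφ).isErnstRegion
    rw [ernstForm_eq h1.toIsMetricRegion h1.killing hx, ← h1.grad x hx j]
    rfl

theorem killingForm_transform (hD : IsErnstSpacetime ξ D)
    (hW : IsEhlersForm ξ D (Param.γ A) (Param.δ A) W) {φ : OpenPartialHomeomorph M E4}
    (hφ : IsChart φ) {x : E4} (hx : x ∈ coordSet φ (D.transform ξ A W).U) (i j : Fin 4) :
    killingForm φ (D.transform ξ A W).g (D.transform ξ A W).η ξ x i j =
      1 / (factor (Param.γ A) (Param.δ A) (D.σ (φ.symm x))) ^ 2 *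
        ((Omega2 ξ W (φ.symm x) : ℂ) * killingForm φ D.g D.η ξ x i j
          - 1 / 2 * ((oneComp φ W x i : ℂ) * ernstForm φ D.g D.η ξ x j
            - (oneComp φ W x j : ℂ) * ernstForm φ D.g D.η ξ x i)) := by
  have hR := isTransformRegion hφ hD hW
  have hx' := hR.subset hx
  rw [killingForm_eq hR.isErnstRegion.toIsMetricRegion hR.isErnstRegion.killing hx,
    hR.selfDual_eq hx, selfDualTransform, killingForm_eq hR.base.toIsMetricRegion hR.base.killing hx',
    ernstForm_eq hR.base.toIsMetricRegion hR.base.killing hx',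
    ernstForm_eq hR.base.toIsMetricRegion hR.base.killing hx', hR.base.grad x hx',
    hR.base.grad x hx', Omega2_eq hW hx'.2, Complex.mul_conj, inv_pow,
    ← one_div]

theorem ernstForm_transform (hD : IsErnstSpacetime ξ D)
    (hW : IsEhlersForm ξ D (Param.γ A) (Param.δ A) W) {φ : OpenPartialHomeomorph M E4}
    (hφ : IsChart φ) {x : E4} (hx : x ∈ coordSet φ (D.transform ξ A W).U) (j : Fin 4) :
    ernstForm φ (D.transform ξ A W).g (D.transform ξ A W).η ξ x j = ernstForm φ D.g D.η ξ x j /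
      (factor (Param.γ A) (Param.δ A) (D.σ (φ.symm x))) ^ 2 := by
  have hR := isTransformRegion hφ hD hW
  have hx' := hR.subset hx
  rw [ernstForm_eq hR.isErnstRegion.toIsMetricRegion hR.isErnstRegion.killing hx,
    ernstForm_eq hR.base.toIsMetricRegion hR.base.killing hx', ← hR.grad hx, hR.base.grad x hx']

/-- The one-form for `B` on the transformed spacetime. -/
theorem isEhlersForm_transform [IsManifold (𝓡 4) ∞ M] (hD : IsErnstSpacetime ξ D)
    (hW : IsEhlersForm ξ D (Param.γ A) (Param.δ A) W) (B : ehlersGroup) {W'' : OneForm M}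
    (hW'' : IsEhlersForm ξ D (Param.γ (B * A)) (Param.δ (B * A)) W'') :
    IsEhlersForm ξ (D.transform ξ A W) (Param.γ B) (Param.δ B) (fun p => W'' p
      - Complex.normSq (factor (Param.γ B) (Param.δ B) (mobius A (D.σ p))) • W p) := by
  refine isEhlersForm_of_region (isErnstSpacetime_transform hD hW) fun φ hφ => ?_
  have hR := isTransformRegion hφ hD hW
  have h'' := hW''.isEhlersRegionForm hφ hD
  obtain ⟨-, -, h3, h4⟩ := param_mul B A
  rw [h3, h4] at h''
  exact hR.isEhlersRegionForm h''

end Single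

/-! ## Composition of transformations -/

section Systems

variable {M : Type*} [TopologicalSpace M] [ChartedSpace E4 M] {ξ : VField M}

lemma factor_one (s : ℂ) : factor (Param.γ 1) (Param.δ 1) s = 1 := by
  simp [factor, param_one]

lemma mobius_one (s : ℂ) : mobius 1 s = s := by
  rw [mobius, factor_one]; simp [param_one]

theorem IsEhlersSystem.act [IsManifold (𝓡 4) ∞ M] {S : EhlersSystem M} (h : IsEhlersSystem ξ S)
    (A : ehlersGroup) : IsEhlersSystem ξ (EhlersSystem.act ξ A S) where
  spacetime := isErnstSpacetime_transform h.spacetime (h.form A)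
  form B := isEhlersForm_transform h.spacetime (h.form A) B (h.form (B * A))
  form_one p _ := by simp [EhlersSystem.act, factor_one]

theorem IsEhlersSystem.act_one {S : EhlersSystem M} (h : IsEhlersSystem ξ S) :
    (EhlersSystem.act ξ 1 S).U = S.U ∧ AgreeOn S.U (EhlersSystem.act ξ 1 S) S := by
  refine ⟨by ext p; simp [EhlersSystem.act, ErnstData.transform, factor_one], fun p hp => ?_⟩
  have h1 := h.form_one p hp
  have h2 : Omega2 ξ (S.W 1) p = 1 := by simp [Omega2, h1]
  refine ⟨?_, ?_, mobius_one _, fun B => ?_⟩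
  · ext v w
    change T ξ (S.W 1) S.g p v w = _
    simp [T_apply, h1, h2]
  · change Omega2 ξ (S.W 1) p • S.η p = _
    rw [h2, one_smul]
  · change S.W (B * 1) p - _ • S.W 1 p = _
    rw [h1, smul_zero, sub_zero, mul_one]

lemma T_apply_field {g : BilinField M} {W : OneForm M} {p : M} (hn : Omega2 ξ W p ≠ 0)
    (v : TangentSpace (𝓡 4) p) :
    T ξ W g p v (ξ p) = g p v (ξ p) + normFn g ξ p / Omega2 ξ W p * W p v := by
  have hWξ : W p (ξ p) = Omega2 ξ W p - 1 := by rw [Omega2]; ring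
  rw [T_apply, hWξ, show g p (ξ p) (ξ p) = -normFn g ξ p by rw [normFn]; ring]
  field_simp
  ring

lemma normFn_T {g : BilinField M} {W : OneForm M} {p : M} (hn : Omega2 ξ W p ≠ 0) :
    normFn (T ξ W g) ξ p = normFn g ξ p / Omega2 ξ W p := by
  have hWξ : W p (ξ p) = Omega2 ξ W p - 1 := by rw [Omega2]; ring
  rw [normFn, T_apply_field hn, hWξ, show g p (ξ p) (ξ p) = -normFn g ξ p by rw [normFn]; ring]
  field_simp
  ring

/-- Only the cocycle relation of the Ω² and the shape W' = W'' − N W matter. The first step adds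
(λ/Ω²) W to the lowered vector and divides λ by Ω²; after substitution the cross terms cancel. -/
lemma T_T {g : BilinField M} {W W' W'' : OneForm M} {p : M} {N : ℝ} (hn : Omega2 ξ W p ≠ 0)
    (hN : N ≠ 0) (hN' : Omega2 ξ W' p = N) (hn'' : Omega2 ξ W'' p = N * Omega2 ξ W p)
    (hW : W' p = W'' p - N • W p) : T ξ W' (T ξ W g) p = T ξ W'' g p := by
  ext v w
  rw [T_apply, T_apply_field hn, T_apply_field hn, normFn_T hn, T_apply, T_apply, hN', hn'', hW]
  simp only [LinearMap.sub_apply, LinearMap.smul_apply, smul_eq_mul]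
  field_simp
  ring

theorem IsEhlersSystem.act_act [IsManifold (𝓡 4) ∞ M] {S : EhlersSystem M}
    (h : IsEhlersSystem ξ S) (A B : ehlersGroup) :
    (EhlersSystem.act ξ B (EhlersSystem.act ξ A S)).U
        = (EhlersSystem.act ξ A S).U ∩ (EhlersSystem.act ξ (B * A) S).U ∧
      AgreeOn (EhlersSystem.act ξ B (EhlersSystem.act ξ A S)).U
        (EhlersSystem.act ξ B (EhlersSystem.act ξ A S)) (EhlersSystem.act ξ (B * A) S) := by
  have hU : ∀ p, p ∈ (EhlersSystem.act ξ B (EhlersSystem.act ξ A S)).U ↔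
      (p ∈ S.U ∧ factor (Param.γ A) (Param.δ A) (S.σ p) ≠ 0) ∧
        factor (Param.γ B) (Param.δ B) (mobius A (S.σ p)) ≠ 0 := fun p => Iff.rfl
  constructor
  -- On the first domain the factor for A is invertible, so by the cocycle identity the factors for
  -- B and for BA vanish together.
  · ext p
    rw [hU]
    change _ ↔ (p ∈ S.U ∧ factor (Param.γ A) (Param.δ A) (S.σ p) ≠ 0) ∧
      (p ∈ S.U ∧ factor (Param.γ (B * A)) (Param.δ (B * A)) (S.σ p) ≠ 0)
    refine and_congr_right fun hp => ?_
    rw [← factor_mobius A B hp.2]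
    simp [hp.1, hp.2]
  · intro p hp
    rw [hU] at hp
    obtain ⟨⟨hpU, hA⟩, hB⟩ := hp
    have hBA : factor (Param.γ (B * A)) (Param.δ (B * A)) (S.σ p) ≠ 0 := by
      rw [← factor_mobius A B hA]; exact mul_ne_zero hB hA
    have hn : Omega2 ξ (S.W A) p = _ := Omega2_eq (h.form A) hpU
    have hn'' : Omega2 ξ (S.W (B * A)) p = _ := Omega2_eq (h.form (B * A)) hpU
    have hN : Omega2 ξ ((EhlersSystem.act ξ A S).W B) p
      = Complex.normSq (factor (Param.γ B) (Param.δ B) (mobius A (S.σ p))) :=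
      Omega2_eq ((h.act A).form B) ⟨hpU, hA⟩
    have hn0 : Omega2 ξ (S.W A) p ≠ 0 := by rw [hn]; simpa using hA
    have hmul : Omega2 ξ (S.W (B * A)) p
        = Complex.normSq (factor (Param.γ B) (Param.δ B) (mobius A (S.σ p)))
          * Omega2 ξ (S.W A) p := by
      rw [hn'', hn, ← map_mul, factor_mobius A B hA]
    refine ⟨T_T hn0 (by simpa using hB) hN hmul rfl, ?_, mobius_mobius A B hA hBA, fun C => ?_⟩
    · change Omega2 ξ ((EhlersSystem.act ξ A S).W B) p • (Omega2 ξ (S.W A) p • S.η p)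
        = Omega2 ξ (S.W (B * A)) p • S.η p
      rw [smul_smul, hN, hmul]
    · change (S.W (C * B * A) p
          - Complex.normSq (factor (Param.γ (C * B)) (Param.δ (C * B)) (mobius A (S.σ p)))
            • S.W A p)
        - Complex.normSq (factor (Param.γ C) (Param.δ C) (mobius B (mobius A (S.σ p))))
          • (S.W (B * A) p
            - Complex.normSq (factor (Param.γ B) (Param.δ B) (mobius A (S.σ p))) • S.W A p)
        = S.W (C * (B * A)) p
          - Complex.normSq (factor (Param.γ C) (Param.δ C) (mobius (B * A) (S.σ p)))
            • S.W (B * A) p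
      -- Multiplicativity of |f|² along C, B makes the two terms in the one-form for A cancel.
      rw [← factor_mobius B C hB, map_mul, mobius_mobius A B hA hBA, mul_assoc]
      module

end Systems

/-! ## Closed one-forms annihilated by the Killing vector, and distinct parameters -/

section Distinct

variable {M : Type*} [TopologicalSpace M] [ChartedSpace E4 M] {ξ : VField M} {D : ErnstData M}

/-- The one-form `Re (c dσ)`. -/
def reDiff (c : ℂ) (σ : M → ℂ) : OneForm M := fun p =>
  Complex.reLm ∘ₗ (LinearMap.mulLeft ℝ c) ∘ₗ
    (mfderiv (𝓡 4) 𝓘(ℝ, ℂ) σ p : TangentSpace (𝓡 4) p →L[ℝ] ℂ).toLinearMap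

lemma oneComp_reDiff {φ : OpenPartialHomeomorph M E4} (hφ : IsChart φ) {U : Set M} (hU : IsOpen U)
    {σ : M → ℂ} (hσ : ContMDiffOn (𝓡 4) 𝓘(ℝ, ℂ) ∞ σ U) (c : ℂ) {x : E4} (hx : x ∈ coordSet φ U)
    (i : Fin 4) :
    oneComp φ (reDiff c σ) x i = (c * pd i (fun y => σ (φ.symm y)) x).re := by
  have h1 : MDifferentiableAt (𝓡 4) 𝓘(ℝ, ℂ) σ (φ.symm x) :=
    (hσ.contMDiffAt (hU.mem_nhds hx.2)).mdifferentiableAt (by simp)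
  have h2 := hφ.mdifferentiable.mdifferentiableAt_symm hx.1
  have h3 : mfderiv (𝓡 4) 𝓘(ℝ, ℂ) (σ ∘ φ.symm) x
      = (mfderiv (𝓡 4) 𝓘(ℝ, ℂ) σ (φ.symm x)).comp (mfderiv (𝓡 4) (𝓡 4) φ.symm x) :=
    mfderiv_comp x h1 h2
  have h4 : pd i (fun y => σ (φ.symm y)) x
      = mfderiv (𝓡 4) 𝓘(ℝ, ℂ) σ (φ.symm x) (coordVec φ x i) := by
    have h5 := DFunLike.congr_fun h3 (EuclideanSpace.single i (1 : ℝ) : E4)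
    rw [mfderiv_eq_fderiv] at h5
    exact h5
  rw [h4]
  rfl

/-- With γ = 0 and δ² = 1 the equations reduce to dW = 0 and W(ξ) = 0. Both hold for the real part
of a constant multiple of dσ, since ξ annihilates σ. -/
lemma isEhlersForm_reDiff [IsManifold (𝓡 4) ∞ M] (hD : IsErnstSpacetime ξ D) (c : ℂ) {δ : ℝ}
    (hδ : δ ^ 2 = 1) : IsEhlersForm ξ D 0 δ (reDiff c D.σ) := by
  refine isEhlersForm_of_region hD fun φ hφ => ?_
  have hR := hD.isErnstRegion hφ
  have hc : ∀ x ∈ coordSet φ D.U, ∀ i, oneComp φ (reDiff c D.σ) x i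
      = (c * pd i (fun y => D.σ (φ.symm y)) x).re :=
    fun x hx i => oneComp_reDiff hφ hD.isOpen hD.potential.smooth c hx i
  have hs : ∀ x ∈ coordSet φ D.U, ∀ i,
      ContDiffAt ℝ ∞ (fun x => c * pd i (fun y => D.σ (φ.symm y)) x) x :=
    fun x hx i => contDiffAt_const.mul (contDiffAt_pd (hR.potential x hx) i)
  refine ⟨fun x hx i => ?_, fun x hx i j => ?_, fun x hx => ?_⟩
  · exact (contDiffAt_re (hs x hx i)).congr_of_eventuallyEq
      (Filter.eventually_of_mem (hR.isOpen.mem_nhds hx) fun y hy => hc y hy i)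
  · have h1 : ∀ i j, pd i (fun y => oneComp φ (reDiff c D.σ) y j) x
        = (c * pd i (pd j fun y => D.σ (φ.symm y)) x).re := fun i j => by
      rw [pd_congr hR.isOpen hx (fun y hy => hc y hy j), pd_re (hs x hx j),
        pd_const_mul _ (contDiffAt_pd (hR.potential x hx) j)]
    rw [h1, h1, pd_comm (hR.potential x hx) i j]
    simp
  · have h1 : ∑ i, oneComp φ (reDiff c D.σ) x i * vecComp φ ξ x i
        = (c * ∑ k, (vecComp φ ξ x k : ℂ) * pd k (fun y => D.σ (φ.symm y)) x).re := by
      rw [Finset.mul_sum, Complex.re_sum]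
      refine Finset.sum_congr rfl fun i _ => ?_
      rw [hc x hx, mul_left_comm, Complex.re_ofReal_mul, mul_comm]
    rw [h1, hR.sum_field_mul_grad hx]
    simp only [factor, Complex.ofReal_zero, mul_zero, zero_mul, zero_add, Complex.zero_re,
      Complex.normSq_ofReal]
    nlinarith

lemma isEhlersForm_zero {δ : ℝ} (hδ : δ ^ 2 = 1) : IsEhlersForm ξ D 0 δ (fun _ => 0) where
  smooth φ _ i := by
    simp only [oneComp, LinearMap.zero_apply]; exact contDiffOn_const
  ext_deriv φ _ x _ i j := by simp [oneComp, pd_const]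
  norm p _ := by
    simp only [factor, Complex.ofReal_zero, mul_zero, zero_mul, zero_add, LinearMap.zero_apply,
      Complex.normSq_ofReal]
    nlinarith

/-- A function with vanishing partial derivatives on a preconnected open set is constant. -/
lemma eq_of_pd_eq_zero [IsManifold (𝓡 4) ∞ M] {U : Set M} (hU : IsOpen U) (hc : IsPreconnected U)
    {σ : M → ℂ} (hσ : ContMDiffOn (𝓡 4) 𝓘(ℝ, ℂ) ∞ σ U)
    (h : ∀ φ : OpenPartialHomeomorph M E4, IsChart φ → ∀ x ∈ coordSet φ U, ∀ i,
      pd i (fun y => σ (φ.symm y)) x = 0) {p q : M} (hp : p ∈ U) (hq : q ∈ U) : σ p = σ q := by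
  have hloc : IsLocallyConstant fun p : U => σ p := by
    rw [IsLocallyConstant.iff_eventually_eq]
    rintro ⟨p, hp⟩
    have hφ := isChart_chartAt p
    set φ := chartAt E4 p
    have hpφ : p ∈ φ.source := mem_chart_source E4 p
    have hx : φ p ∈ coordSet φ U := ⟨φ.map_source hpφ, by simpa [φ.left_inv hpφ] using hp⟩
    obtain ⟨r, hr, hball⟩ := Metric.isOpen_iff.1 (isOpen_coordSet φ hU) _ hx
    have hd : ∀ y ∈ Metric.ball (φ p) r, HasFDerivAt (fun y => σ (φ.symm y)) (0 : E4 →L[ℝ] ℂ) y := by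
      intro y hy
      have h1 := hasFDerivAt_of_smooth (contDiffAt_comp_symm hφ hU hσ (hball hy))
      have h2 : fderiv ℝ (fun y => σ (φ.symm y)) y = 0 := by
        ext1 u
        rw [eq_sum_single u, map_sum]
        simp only [map_smul]
        exact Finset.sum_eq_zero fun i _ => by
          rw [show fderiv ℝ (fun y => σ (φ.symm y)) y (EuclideanSpace.single i 1) = 0 from
            h φ hφ y (hball hy) i, smul_zero]
      rwa [h2] at h1
    have hconst : ∀ y ∈ Metric.ball (φ p) r, σ (φ.symm y) = σ (φ.symm (φ p)) := fun y hy =>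
      Metric.isOpen_ball.is_const_of_fderiv_eq_zero (convex_ball _ _).isPreconnected
        (fun z hz => (hd z hz).differentiableAt.differentiableWithinAt)
        (fun z hz => (hd z hz).fderiv) hy (Metric.mem_ball_self hr)
    have hn : ∀ᶠ q in nhds p, σ q = σ p := by
      have h1 : ∀ᶠ q in nhds p, φ q ∈ Metric.ball (φ p) r :=
        (φ.continuousAt hpφ).eventually (Metric.ball_mem_nhds _ hr)
      filter_upwards [h1, φ.open_source.mem_nhds hpφ] with q hq hqs
      have := hconst _ hq
      rwa [φ.left_inv hqs, φ.left_inv hpφ] at this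
    exact (continuous_subtype_val (p := fun q => q ∈ U)).continuousAt (x := ⟨p, hp⟩)
      |>.eventually hn
  have : PreconnectedSpace U := Subtype.preconnectedSpace hc
  exact hloc.apply_eq_of_preconnectedSpace ⟨p, hp⟩ ⟨q, hq⟩

/-- The points at which `factor` does not vanish are dense near points where `dσ ≠ 0`. -/
lemma exists_factor_ne {γ δ : ℝ} (hγδ : γ ≠ 0 ∨ δ ≠ 0) {s : E4 → ℂ} {x : E4} {i : Fin 4}
    (hs : ContDiffAt ℝ ∞ s x) (hd : pd i s x ≠ 0) {N : Set E4} (hN : N ∈ nhds x) :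
    ∃ y ∈ N, factor γ δ (s y) ≠ 0 := by
  by_contra hcon
  push Not at hcon
  have h1 : (fun y => factor γ δ (s y)) =ᶠ[nhds x] fun _ => 0 := Filter.eventually_of_mem hN hcon
  have h2 : pd i (fun y => factor γ δ (s y)) x = 0 := by
    rw [pd, h1.fderiv_eq]; simp
  rw [pd_factor hs] at h2
  have hγ : γ = 0 := by simpa [hd] using h2
  have hδ : δ ≠ 0 := hγδ.resolve_left (by simpa using hγ)
  have h3 := h1.self_of_nhds
  simp [factor, hγ, hδ] at h3

/-- A quadratic polynomial vanishing on the values of a function with nonzero derivative is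
zero. -/
lemma quadratic_eq_zero {s : E4 → ℂ} {O : Set E4} (hO : IsOpen O)
    (hs : ∀ y ∈ O, ContDiffAt ℝ ∞ s y) {x : E4} (hx : x ∈ O) {i : Fin 4} (hd : pd i s x ≠ 0)
    {a b c : ℂ} (h : ∀ y ∈ O, a * (s y * s y) + (b * s y + c) = 0) : a = 0 ∧ b = 0 ∧ c = 0 := by
  -- One derivative gives a linear relation wherever the derivative of s is nonzero, hence near x; a
  -- second derivative then isolates a.
  have h1 : ∀ y ∈ O, (2 * a * s y + b) * pd i s y = 0 := by
    intro y hy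
    have h2 := pd_congr hO hy h i
    have hsy := hs y hy
    rw [pd_const, pd_add (contDiffAt_const.mul (hsy.mul hsy))
      ((contDiffAt_const.mul hsy).add contDiffAt_const), pd_const_mul _ (hsy.mul hsy),
      pd_mul hsy hsy, pd_add (contDiffAt_const.mul hsy) contDiffAt_const, pd_const_mul _ hsy,
      pd_const] at h2
    linear_combination h2
  have hn : ∀ᶠ y in nhds x, 2 * a * s y + b = 0 := by
    filter_upwards [(contDiffAt_pd (hs x hx) i).continuousAt.eventually_ne hd,
      hO.mem_nhds hx] with y hy hyO
    exact (mul_eq_zero.1 (h1 y hyO)).resolve_right hy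
  have h2 : pd i (fun y => 2 * a * s y + b) x = 0 := by
    rw [pd, Filter.EventuallyEq.fderiv_eq (f := fun _ => (0 : ℂ)) hn]; simp
  rw [pd_add (contDiffAt_const.mul (hs x hx)) contDiffAt_const, pd_const_mul _ (hs x hx),
    pd_const] at h2
  have ha : a = 0 := by simpa [hd] using h2
  have hb : b = 0 := by simpa [ha] using hn.self_of_nhds
  exact ⟨ha, hb, by simpa [ha, hb] using h x hx⟩

/-- The element `-1` of the parameter group. -/
def negOne : ehlersGroup := ofParam (-1) 0 0 (-1) (by norm_num)

lemma param_negOne_mul (A : ehlersGroup) : Param.α (negOne * A) = -Param.α A ∧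
    Param.β (negOne * A) = -Param.β A ∧ Param.γ (negOne * A) = -Param.γ A ∧
    Param.δ (negOne * A) = -Param.δ A := by
  obtain ⟨h1, h2, h3, h4⟩ := param_mul negOne A
  obtain ⟨k1, k2, k3, k4⟩ := param_ofParam (a := -1) (b := 0) (c := 0) (d := -1) (by norm_num)
  rw [h1, h2, h3, h4, negOne, k1, k2, k3, k4]
  simp

lemma mul_negOne (A : ehlersGroup) : A * negOne = negOne * A := by
  obtain ⟨h1, h2, h3, h4⟩ := param_mul A negOne
  obtain ⟨k1, k2, k3, k4⟩ := param_ofParam (a := -1) (b := 0) (c := 0) (d := -1) (by norm_num)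
  obtain ⟨l1, l2, l3, l4⟩ := param_negOne_mul A
  rw [negOne] at h1 h2 h3 h4
  rw [k1, k3] at h1
  rw [k2, k4] at h2
  rw [k1, k3] at h3
  rw [k2, k4] at h4
  apply param_ext
  · rw [l1, negOne, h1]; ring
  · rw [l2, negOne, h2]; ring
  · rw [l3, negOne, h3]; ring
  · rw [l4, negOne, h4]; ring

lemma negOne_mul_negOne : negOne * negOne = 1 := by
  obtain ⟨l1, l2, l3, l4⟩ := param_negOne_mul negOne
  obtain ⟨k1, k2, k3, k4⟩ := param_ofParam (a := -1) (b := 0) (c := 0) (d := -1) (by norm_num)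
  obtain ⟨o1, o2, o3, o4⟩ := param_one
  apply param_ext
  · rw [l1, o1, negOne, k1]; norm_num
  · rw [l2, o2, negOne, k2]; norm_num
  · rw [l3, o3, negOne, k3]; norm_num
  · rw [l4, o4, negOne, k4]; norm_num

lemma negOne_ne_one : negOne ≠ 1 := by
  intro h
  have h1 := congrArg Param.δ h
  rw [negOne, (param_ofParam _).2.2.2, param_one.2.2.2] at h1
  norm_num at h1

lemma factor_neg (γ δ : ℝ) (s : ℂ) : factor (-γ) (-δ) s = -factor γ δ s := by
  simp [factor]; ring

/-- Two elements of the group defining the same Möbius map on the values of `σ` agree up to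
sign. -/
lemma eq_or_eq_negOne_mul {A B : ehlersGroup} {s : E4 → ℂ} {O : Set E4} (hO : IsOpen O)
    (hs : ∀ y ∈ O, ContDiffAt ℝ ∞ s y) {x : E4} (hx : x ∈ O) {i : Fin 4} (hd : pd i s x ≠ 0)
    (hA : ∀ y ∈ O, factor (Param.γ A) (Param.δ A) (s y) ≠ 0)
    (hB : ∀ y ∈ O, factor (Param.γ B) (Param.δ B) (s y) ≠ 0)
    (h : ∀ y ∈ O, mobius A (s y) = mobius B (s y)) : B = A ∨ B = negOne * A := by
  obtain ⟨h1, h2, h3⟩ := quadratic_eq_zero hO hs hx hd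
    -- The coefficients come from cross-multiplying the two Möbius fractions.
    (a := ((Param.α A * Param.γ B - Param.α B * Param.γ A : ℝ) : ℂ) * Complex.I)
    (b := ((Param.α A * Param.δ B - Param.β A * Param.γ B
      - (Param.α B * Param.δ A - Param.β B * Param.γ A) : ℝ) : ℂ))
    (c := ((Param.β A * Param.δ B - Param.β B * Param.δ A : ℝ) : ℂ) * Complex.I) (by
      intro y hy
      have h1 := h y hy
      rw [mobius, mobius, div_eq_div_iff (hA y hy) (hB y hy), factor, factor] at h1
      push_cast
      linear_combination h1 - s y * ((Param.β A : ℂ) * Param.γ B - Param.β B * Param.γ A)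
        * Complex.I_sq)
  have e1 : Param.α A * Param.γ B - Param.α B * Param.γ A = 0 := by
    have := (mul_eq_zero.1 h1).resolve_right Complex.I_ne_zero
    exact_mod_cast this
  have e2 := Complex.ofReal_eq_zero.1 h2
  have e3 : Param.β A * Param.δ B - Param.β B * Param.δ A = 0 := by
    have := (mul_eq_zero.1 h3).resolve_right Complex.I_ne_zero
    exact_mod_cast this
  have dA := det_param A
  have dB := det_param B
  obtain ⟨l1, l2, l3, l4⟩ := param_negOne_mul A
  set t := Param.δ A * Param.α B + Param.β A * Param.γ B with ht
  have f1 : Param.α B = t * Param.α A := by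
    rw [ht]; linear_combination -Param.α B * dA - Param.β A * e1
  have f2 : Param.β B = t * Param.β A := by
    rw [ht]; linear_combination -Param.β B * dA - Param.α A * e3 + Param.β A * e2
  have f3 : Param.γ B = t * Param.γ A := by
    rw [ht]; linear_combination -Param.γ B * dA + Param.δ A * e1
  have f4 : Param.δ B = t * Param.δ A := by
    rw [ht]; linear_combination -Param.δ B * dA + Param.γ A * e3 + Param.δ A * e2
  have ht2 : t ^ 2 = 1 := by
    rw [f1, f2, f3, f4] at dB
    linear_combination dB - t ^ 2 * dA
  rcases mul_self_eq_one_iff.1 ((sq t).symm.trans ht2) with h | h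
  · left
    rw [h, one_mul] at f1 f2 f3 f4
    exact param_ext f1 f2 f3 f4
  · right
    rw [h, neg_one_mul] at f1 f2 f3 f4
    exact param_ext (f1.trans l1.symm) (f2.trans l2.symm) (f3.trans l3.symm) (f4.trans l4.symm)

end Distinct

/-! ### Existence of systems, and of a faithful one -/

section Existence

variable {M : Type*} [TopologicalSpace M] [ChartedSpace E4 M] {ξ : VField M} {D : ErnstData M}

/-- No compatibility between the forms is required, so they are chosen independently. The value at 1
is forced to be zero; the one at −1 is left free in order to make the sign visible. -/
lemma exists_system_with (hD : IsErnstSpacetime ξ D)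
    (hW : ∀ γ δ : ℝ, (γ ≠ 0 ∨ δ ≠ 0) → ∃ W : OneForm M, IsEhlersForm ξ D γ δ W) {ν : OneForm M}
    (hν : IsEhlersForm ξ D 0 (-1) ν) :
    ∃ W : ehlersGroup → OneForm M, IsEhlersSystem ξ ⟨D, W⟩ ∧ W 1 = (fun _ => 0) ∧
      W negOne = ν := by
  classical
  choose V hV using fun A : ehlersGroup => hW (Param.γ A) (Param.δ A) (param_ne_zero A)
  refine ⟨fun A => if A = 1 then fun _ => 0 else if A = negOne then ν else V A,
    ⟨hD, fun A => ?_, fun p _ => by simp⟩, by simp, by simp [negOne_ne_one]⟩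
  by_cases h1 : A = 1
  · subst h1
    simp only [if_true, param_one.2.2.1, param_one.2.2.2]
    exact isEhlersForm_zero (by norm_num)
  · by_cases h2 : A = negOne
    · subst h2
      simp only [negOne_ne_one, if_true, if_false]
      rw [show Param.γ negOne = 0 from (param_ofParam _).2.2.1,
        show Param.δ negOne = -1 from (param_ofParam _).2.2.2]
      exact hν
    · simp only [h1, h2, if_false]
      exact hV A

lemma act_W_apply (A B : ehlersGroup) (W : ehlersGroup → OneForm M) (p : M) :
    (EhlersSystem.act ξ A ⟨D, W⟩).W B p = W (B * A) p
      - Complex.normSq (factor (Param.γ B) (Param.δ B) (mobius A (D.σ p))) • W A p := rfl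

/-- If the transforms by `A` and `-A` agree at a point, the one-forms for `1` and `-1` agree
there. -/
lemma form_eq_of_act_eq_act_neg {A : ehlersGroup} {W : ehlersGroup → OneForm M} {p : M}
    (hσ : mobius A (D.σ p) = mobius (negOne * A) (D.σ p))
    (h : ∀ C, (EhlersSystem.act ξ A ⟨D, W⟩).W C p
      = (EhlersSystem.act ξ (negOne * A) ⟨D, W⟩).W C p) : W 1 p = W negOne p := by
  -- Testing on ±A⁻¹ brings W(1) and W(−1) into play with opposite roles. The weights N agree, as a
  -- sign does not change |f|², so subtracting gives 2(W(1) − W(−1)) = 0.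
  have h1 := h A⁻¹
  have h2 := h (negOne * A⁻¹)
  obtain ⟨-, -, l3, l4⟩ := param_negOne_mul A⁻¹
  rw [act_W_apply, act_W_apply, ← hσ, inv_mul_cancel, ← mul_assoc, mul_negOne, mul_assoc,
    inv_mul_cancel, mul_one] at h1
  rw [act_W_apply, act_W_apply, ← hσ, l3, l4, factor_neg, Complex.normSq_neg, mul_assoc,
    inv_mul_cancel, mul_one, mul_assoc, ← mul_assoc A⁻¹, mul_negOne, mul_assoc, inv_mul_cancel,
    mul_one, negOne_mul_negOne] at h2
  ext v
  have e1 := LinearMap.congr_fun h1 v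
  have e2 := LinearMap.congr_fun h2 v
  simp only [LinearMap.sub_apply, LinearMap.smul_apply, smul_eq_mul] at e1 e2
  linarith

theorem exists_faithful_system [IsManifold (𝓡 4) ∞ M] (hD : IsErnstSpacetime ξ D)
    (hW : ∀ γ δ : ℝ, (γ ≠ 0 ∨ δ ≠ 0) → ∃ W : OneForm M, IsEhlersForm ξ D γ δ W)
    (hU : IsPreconnected D.U) (hσ : ∃ p ∈ D.U, ∃ q ∈ D.U, D.σ p ≠ D.σ q) :
    ∃ W : ehlersGroup → OneForm M, IsEhlersSystem ξ ⟨D, W⟩ ∧ ∀ A B,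
      (EhlersSystem.act ξ A ⟨D, W⟩).U = (EhlersSystem.act ξ B ⟨D, W⟩).U →
      AgreeOn (EhlersSystem.act ξ A ⟨D, W⟩).U
        (EhlersSystem.act ξ A ⟨D, W⟩) (EhlersSystem.act ξ B ⟨D, W⟩) → A = B := by
  obtain ⟨p, hp, q, hq, hpq⟩ := hσ
  have hex : ∃ φ : OpenPartialHomeomorph M E4, IsChart φ ∧ ∃ x ∈ coordSet φ D.U, ∃ i,
      pd i (fun y => D.σ (φ.symm y)) x ≠ 0 := by
    by_contra hcon
    push Not at hcon
    exact hpq (eq_of_pd_eq_zero hD.isOpen hU hD.potential.smooth hcon hp hq)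
  obtain ⟨φ, hφ, x, hx, i, hd⟩ := hex
  set s : E4 → ℂ := fun y => D.σ (φ.symm y) with hsdef
  have hO := isOpen_coordSet φ hD.isOpen
  have hs : ∀ y ∈ coordSet φ D.U, ContDiffAt ℝ ∞ s y := fun y hy =>
    contDiffAt_comp_symm hφ hD.isOpen hD.potential.smooth hy
  obtain ⟨c, hc⟩ : ∃ c : ℂ, (c * pd i s x).re ≠ 0 := by
    -- With c the conjugate of the derivative, the real part is its squared modulus.
    refine ⟨(starRingEnd ℂ) (pd i s x), ?_⟩
    rw [mul_comm, ← normSq_eq_re]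
    simpa using hd
  obtain ⟨W, hWsys, hW1, hWneg⟩ := exists_system_with hD hW
    (isEhlersForm_reDiff hD c (δ := -1) (by norm_num))
  refine ⟨W, hWsys, fun A B hAB hagree => ?_⟩
  have hN : {y | y ∈ coordSet φ D.U ∧ (c * pd i s y).re ≠ 0} ∈ nhds x := by
    have h1 : ContinuousAt (fun y => (c * pd i s y).re) x :=
      (contDiffAt_re (contDiffAt_const.mul (contDiffAt_pd (hs x hx) i))).continuousAt
    filter_upwards [h1.eventually_ne hc, hO.mem_nhds hx] with y h2 h3 using ⟨h3, h2⟩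
  -- The factor for A may vanish at x itself, so the comparison moves to a nearby point of the
  -- transformed region where Re(c ∂σ) is still nonzero.
  obtain ⟨y, ⟨hy, hcy⟩, hyA⟩ := exists_factor_ne (param_ne_zero A) (hs x hx) hd hN
  have hdy : pd i s y ≠ 0 := fun h => hcy (by rw [h, mul_zero, Complex.zero_re])
  have hmem : ∀ z ∈ coordSet φ (EhlersSystem.act ξ A ⟨D, W⟩).U, z ∈ coordSet φ D.U :=
    fun z hz => ⟨hz.1, hz.2.1⟩
  have hyO : y ∈ coordSet φ (EhlersSystem.act ξ A ⟨D, W⟩).U := ⟨hy.1, hy.2, hyA⟩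
  have hcases := eq_or_eq_negOne_mul (A := A) (B := B) (isOpen_coordSet φ (isOpen_transform hD))
    (fun z hz => hs z (hmem z hz)) hyO hdy (fun z hz => hz.2.2)
    (fun z hz => by
      have h1 := hz.2
      change φ.symm z ∈ (EhlersSystem.act ξ A ⟨D, W⟩).U at h1
      rw [hAB] at h1
      exact h1.2)
    (fun z hz => (hagree _ hz.2).2.2.1)
  rcases hcases with h | h
  · exact h.symm
  · exfalso
    subst h
    -- Agreement for A and −A would force Re(c dσ) = 0 at y.
    have h1 := form_eq_of_act_eq_act_neg (hagree _ hyO.2).2.2.1 (hagree _ hyO.2).2.2.2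
    rw [hW1, hWneg] at h1
    have h2 : oneComp φ (reDiff c D.σ) y i = 0 := by
      rw [oneComp, ← h1, LinearMap.zero_apply]
    rw [oneComp_reDiff hφ hD.isOpen hD.potential.smooth c hy] at h2
    exact hcy h2

end Existence

end Ehlers

end

theorem mainTheorem4 {M : Type*} [TopologicalSpace M] [ChartedSpace Ehlers.E4 M]
    [IsManifold (𝓡 4) ∞ M] (ξ : Ehlers.VField M) (D : Ehlers.ErnstData M)
    (hD : Ehlers.IsErnstSpacetime ξ D)
    (hW : ∀ γ δ : ℝ, (γ ≠ 0 ∨ δ ≠ 0) → ∃ W : Ehlers.OneForm M, Ehlers.IsEhlersForm ξ D γ δ W) :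
    -- a single transformation: `ξ` is a Killing vector of `T(ξ, W, g)`, the transformed region
    -- is again a spacetime of the same kind with potential `σ'`, and the transformed Killing
    -- form and Ernst form are explicit
    (∀ (A : Ehlers.ehlersGroup) (W : Ehlers.OneForm M),
      Ehlers.IsEhlersForm ξ D (Ehlers.Param.γ A) (Ehlers.Param.δ A) W →
      Ehlers.IsErnstSpacetime ξ (D.transform ξ A W) ∧
      ∀ φ : OpenPartialHomeomorph M Ehlers.E4, Ehlers.IsChart φ →
        ∀ x ∈ Ehlers.coordSet φ (D.transform ξ A W).U,
          (∀ i j, Ehlers.killingForm φ (D.transform ξ A W).g (D.transform ξ A W).η ξ x i j =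
            1 / (Ehlers.factor (Ehlers.Param.γ A) (Ehlers.Param.δ A) (D.σ (φ.symm x))) ^ 2 *
              ((Ehlers.Omega2 ξ W (φ.symm x) : ℂ) * Ehlers.killingForm φ D.g D.η ξ x i j
                - 1 / 2 * ((Ehlers.oneComp φ W x i : ℂ) * Ehlers.ernstForm φ D.g D.η ξ x j
                  - (Ehlers.oneComp φ W x j : ℂ) * Ehlers.ernstForm φ D.g D.η ξ x i))) ∧
          (∀ j, Ehlers.ernstForm φ (D.transform ξ A W).g (D.transform ξ A W).η ξ x j =
            Ehlers.ernstForm φ D.g D.η ξ x j /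
              (Ehlers.factor (Ehlers.Param.γ A) (Ehlers.Param.δ A) (D.σ (φ.symm x))) ^ 2)) ∧
    -- the required choices of one-forms exist
    (∃ W : Ehlers.ehlersGroup → Ehlers.OneForm M, Ehlers.IsEhlersSystem ξ ⟨D, W⟩) ∧
    -- for every such choice the transformations can be iterated and compose according to the
    -- product in the parameter group
    (∀ W : Ehlers.ehlersGroup → Ehlers.OneForm M, Ehlers.IsEhlersSystem ξ ⟨D, W⟩ →
      (∀ A, Ehlers.IsEhlersSystem ξ (Ehlers.EhlersSystem.act ξ A ⟨D, W⟩)) ∧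
      ((Ehlers.EhlersSystem.act ξ 1 ⟨D, W⟩).U = D.U ∧
        Ehlers.AgreeOn D.U (Ehlers.EhlersSystem.act ξ 1 ⟨D, W⟩) ⟨D, W⟩) ∧
      (∀ A B,
        (Ehlers.EhlersSystem.act ξ B (Ehlers.EhlersSystem.act ξ A ⟨D, W⟩)).U =
          (Ehlers.EhlersSystem.act ξ A ⟨D, W⟩).U ∩
            (Ehlers.EhlersSystem.act ξ (B * A) ⟨D, W⟩).U ∧
        Ehlers.AgreeOn (Ehlers.EhlersSystem.act ξ B (Ehlers.EhlersSystem.act ξ A ⟨D, W⟩)).U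
          (Ehlers.EhlersSystem.act ξ B (Ehlers.EhlersSystem.act ξ A ⟨D, W⟩))
          (Ehlers.EhlersSystem.act ξ (B * A) ⟨D, W⟩))) ∧
    -- distinct parameters give distinct transformations
    (IsPreconnected D.U → (∃ p ∈ D.U, ∃ q ∈ D.U, D.σ p ≠ D.σ q) →
      ∃ W : Ehlers.ehlersGroup → Ehlers.OneForm M, Ehlers.IsEhlersSystem ξ ⟨D, W⟩ ∧
        ∀ A B,
          (Ehlers.EhlersSystem.act ξ A ⟨D, W⟩).U = (Ehlers.EhlersSystem.act ξ B ⟨D, W⟩).U →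
          Ehlers.AgreeOn (Ehlers.EhlersSystem.act ξ A ⟨D, W⟩).U
            (Ehlers.EhlersSystem.act ξ A ⟨D, W⟩) (Ehlers.EhlersSystem.act ξ B ⟨D, W⟩) →
          A = B) ∧
    -- the parameter group is `SL(2, ℝ)`
    (∃ Φ : Ehlers.ehlersGroup ≃* Matrix.SpecialLinearGroup (Fin 2) ℝ,
      ∀ A, (Φ A : Matrix (Fin 2) (Fin 2) ℝ) =
        !![Ehlers.Param.α A, Ehlers.Param.β A; -Ehlers.Param.γ A, Ehlers.Param.δ A]) := by
  refine ⟨fun A W hWA => ⟨Ehlers.isErnstSpacetime_transform hD hWA, fun φ hφ x hx =>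
      ⟨fun i j => Ehlers.killingForm_transform hD hWA hφ hx i j,
        fun j => Ehlers.ernstForm_transform hD hWA hφ hx j⟩⟩, ?_,
    fun W hS => ⟨fun A => hS.act A, hS.act_one, fun A B => hS.act_act A B⟩,
    fun hU hσ => Ehlers.exists_faithful_system hD hW hU hσ, Ehlers.equivSL, fun A => rfl⟩
  -- The pair (0, −1) belongs to the element −1; mere existence works with any solution there.
  obtain ⟨ν, hν⟩ := hW 0 (-1) (Or.inr (by norm_num))
  obtain ⟨W, hS, -⟩ := Ehlers.exists_system_with hD hW hν
  exact ⟨W, hS⟩
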